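/- Identify $\mathbb R^2$ with $\mathbb C$, let $\mathbb D$ be the open unit disk, and $H^{1/2}(\partial\mathbb D)=H^1(\mathbb D)/H^1_0(\mathbb D)$ with dual $H^{-1/2}(\partial\mathbb D)$ and bilinear duality pairing $\langle\cdot,\cdot\rangle$. Let $\mathcal E'(\mathbb D)$ be the space of distributions with compact support in $\mathbb D$, let $e_\ell(e^{i\theta})=e^{i\ell\theta}/\sqrt{2\pi}$ for $\ell\in\mathbb Z$, $\widehat x=x/|x|$, let $J_n$ be the Bessel functions of the first kind and $\lambda_{0,1}$ the first positive zero of $J_0$. For $\kappa\in\mathbb R$ put $\sqrt\kappa=i\sqrt{|\kappa|}$ if $\kappa<0$, $\sigma_\kappa(x)=J_0(\sqrt\kappa|x|)^2$, and $$\phi_\ell^\kappa(r)=\frac{J_{|\ell|}(\sqrt\kappa r)}{J_{|\ell|}(\sqrt\kappa)}\ (\kappa\ne0),\quad \phi^0_\ell(r)=r^{|\ell|},\qquad \psi_\ell^\kappa(r)=\sqrt\kappa\,r\left(\frac{J_1(\sqrt\kappa r)}{J_0(\sqrt\kappa r)}-\frac{J_{|\ell|+1}(\sqrt\kappa r)}{J_{|\ell|}(\sqrt\kappa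 r)}\right)\ (\kappa\ne0),\quad \psi_\ell^0=0,$$ with $\psi_\ell^\kappa(0)=0$. For a real function $\gamma\in L^\infty(\mathbb D)$ bounded below by a positive constant let $u_f^\gamma\in H^1(\mathbb D)$ solve $\nabla\cdot(\gamma\nabla u)=0$ in $\mathbb D$, $u=f$ on $\partial\mathbb D$, and let $\Phi(\gamma)=\Lambda_\gamma:H^{1/2}\to H^{-1/2}$ be its Dirichlet-to-Neumann map, $\Lambda_\gamma f=\gamma\partial_\nu u^\gamma_f$ (in the weak sense). For real $q\in L^\infty(\mathbb D)$ such that $0$ is not in the Dirichlet spectrum of $-\Delta+q$ on $\mathbb D$, let $v_f^q\in H^1(\mathbb D)$ solve $(-\Delta+q)v=0$ in $\mathbb D$, $v=f$ on $\partial\mathbb D$, and let $\Phi^{\rm S}(q)=\Lambda_q^{\rm S}:H^{1/2}\to H^{-1/2}$, $\Lambda^{\rm S}_qf=\partial_\nu v_f^q$ (in the weak sense). The Fréchet differentials $d\Phi_\sigma$, $d\Phi^{\rm S}_{q_0}$ on $L^\infty(\mathbb D;\mathbb R)$ are extended $\mathbb C$-linearly to $L^\infty(\mathbb D)$, and, for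 $\sigma,q_0\in C^\infty(\overline{\mathbb D})$, to $L^\infty(\mathbb D)+\mathcal E'(\mathbb D)$ by $\langle f,d\Phi_\sigma(T)g\rangle=\langle T,\chi\nabla u_f^\sigma\cdot\nabla u_g^\sigma\rangle$ and $\langle f,d\Phi^{\rm S}_{q_0}(T)g\rangle=\langle T,\chi v_f^{q_0}v_g^{q_0}\rangle$ for $T\in\mathcal E'(\mathbb D)$, where $\chi\in C_c^\infty(\mathbb D)$ satisfies $\chi T=T$. Integrals below against an element of $L^\infty(\mathbb D)+\mathcal E'(\mathbb D)$ are understood in the same way, after extending the weight continuously to $x=0$. If $\kappa<\lambda_{0,1}^2$, then $0$ is not in the Dirichlet spectrum of $-\Delta-\kappa$ on $\mathbb D$. Moreover: (i) For every $\kappa\in\mathbb R$ such that $0$ is not in the Dirichlet spectrum of $-\Delta-\kappa$ on $\mathbb D$ (in particular for every $\kappa<\lambda_{0,1}^2$), $\Phi^{\rm S}$ is Fréchet differentiable at the constant $-\kappa$, and for all $\ell,m\in\mathbb Z$ the weight $\phi^\kappa_\ell(|x|)\phi^\kappa_m(|x|)\overline{e_\ell(\widehat x)}e_m(\widehat x)$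 is integrable on $\mathbb D$, extends smoothly to $\mathbb D$, and for all $q\in L^\infty(\mathbb D)+\mathcal E'(\mathbb D)$ $$\langle\overline{e_\ell},d\Phi^{\rm S}_{-\kappa}(q)e_m\rangle=\mu^\kappa_{\ell,m}[q]:=\int_{\mathbb D}q(x)\,\phi^\kappa_\ell(|x|)\phi^\kappa_m(|x|)\overline{e_\ell(\widehat x)}e_m(\widehat x)\,dx .$$ (ii) For every $\kappa<\lambda_{0,1}^2$, $\Phi$ is Fréchet differentiable at $\sigma_\kappa$, and for all $\ell,m\in\mathbb Z$ one has $\lim_{r\to0^+}\psi^\kappa_\ell(r)=0$, the function multiplying $\gamma(x)$ in the integral below is integrable on $\mathbb D$ and extends smoothly to $\mathbb D$, and for all $\gamma\in L^\infty(\mathbb D)+\mathcal E'(\mathbb D)$, $\mathfrak m^\kappa_{\ell,m}[\gamma]:=\langle\overline{e_\ell},d\Phi_{\sigma_\kappa}(\gamma)e_m\rangle$ equals $$J_0(\sqrt\kappa)^2\int_{\mathbb D}\frac{\gamma(x)}{\sigma_\kappa(x)}\,\frac{\ell m+(|\ell|+\psi^\kappa_\ell(|x|))(|m|+\psi^\kappa_m(|x|))}{|x|^2}\,\phi^\kappa_\ell(|x|)\phi^\kappa_m(|x|)\overline{e_\ell(\widehat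 x)}e_m(\widehat x)\,dx .$$ -/

import Mathlib

namespace Calderon

noncomputable section

open MeasureTheory TopologicalSpace Filter Topology
open scoped Distributions ContDiff ComplexConjugate ENNReal

/-! ### The unit disk and the Sobolev spaces on it

The plane `ℝ²` is identified with `ℂ` (Euclidean norm, Lebesgue measure). -/

/-- The open unit disk. -/
def disk : Opens ℂ := ⟨Metric.ball 0 1, Metric.isOpen_ball⟩

/-- Lebesgue measure on the unit disk. -/
abbrev diskMeasure : Measure ℂ := volume.restrict (Metric.ball 0 1)

instance : IsFiniteMeasure diskMeasure :=
  ⟨by rw [Measure.restrict_apply_univ]; exact measure_ball_lt_top⟩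

/-- `L²(𝔻; ℂ)`. -/
abbrev L2 : Type := Lp ℂ 2 diskMeasure

/-- `L^∞(𝔻; ℝ)`. -/
abbrev LInftyReal : Type := Lp ℝ ∞ diskMeasure

/-- `L^∞(𝔻; ℂ)`. -/
abbrev LInfty : Type := Lp ℂ ∞ diskMeasure

/-- The two coordinate directions of `ℝ² = ℂ`. -/
def coordDir (j : Fin 2) : ℂ := if j = 0 then 1 else Complex.I

/-- The partial derivative `∂_j F`. -/
def partialDeriv {E : Type*} [NormedAddCommGroup E] [NormedSpace ℝ E]
    (j : Fin 2) (F : ℂ → E) (z : ℂ) : E :=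
  fderiv ℝ F z (coordDir j)

theorem memLp_disk_of_continuous {F : ℂ → ℂ} (hF : Continuous F) (p : ℝ≥0∞) :
    MemLp F p diskMeasure := by
  obtain ⟨C, hC⟩ := (isCompact_closedBall (0 : ℂ) 1).exists_bound_of_continuousOn hF.continuousOn
  refine MemLp.of_bound hF.aestronglyMeasurable C ?_
  filter_upwards [ae_restrict_mem measurableSet_ball] with z hz
  exact hC z (Metric.ball_subset_closedBall hz)

theorem continuous_partialDeriv {E : Type*} [NormedAddCommGroup E] [NormedSpace ℝ E]
    {F : ℂ → E} (hF : ContDiff ℝ ∞ F) (j : Fin 2) :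
    Continuous (partialDeriv j F) :=
  (hF.continuous_fderiv (by simp)).clm_apply continuous_const

theorem integrable_L2_mul {F : ℂ → ℝ} (hF : Continuous F) (u : L2) :
    Integrable (fun z => u z * ((F z : ℝ) : ℂ)) diskMeasure :=
  (Lp.memLp u).integrable_mul
    (memLp_disk_of_continuous (Complex.continuous_ofReal.comp hF) 2)

/-- The Hilbert space of triples `(u, p₀, p₁)` of functions in `L²(𝔻; ℂ)`, with the norm
`(‖u‖² + ‖p₀‖² + ‖p₁‖²)^{1/2}`. -/
abbrev L2Triple : Type := PiLp 2 (fun _ : Fin 3 => L2)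

/-- `H¹(𝔻; ℂ)`: an element is a triple `(u, ∂₀u, ∂₁u)`, where `u` and its weak partial derivatives
are in `L²`. The norm is the usual `H¹` norm. -/
def H1 : Submodule ℂ L2Triple where
  carrier := {U | ∀ (j : Fin 2) (φ : 𝓓(disk, ℝ)),
    ∫ z, U 0 z * ((partialDeriv j φ z : ℝ) : ℂ) ∂diskMeasure
      = -∫ z, U j.succ z * ((φ z : ℝ) : ℂ) ∂diskMeasure}
  zero_mem' := by
    intro j φ
    have h : ∀ i : Fin 3, ⇑((0 : L2Triple) i) =ᵐ[diskMeasure] 0 := fun i =>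
      Lp.coeFn_zero ℂ 2 diskMeasure
    rw [integral_eq_zero_of_ae, integral_eq_zero_of_ae, neg_zero]
    · filter_upwards [h j.succ] with z hz
      rw [hz]; simp
    · filter_upwards [h 0] with z hz
      rw [hz]; simp
  add_mem' := by
    intro U V hU hV j φ
    have h : ∀ i : Fin 3, ⇑((U + V) i) =ᵐ[diskMeasure] ⇑(U i) + ⇑(V i) := fun i =>
      Lp.coeFn_add (U i) (V i)
    have key : ∀ (i : Fin 3) (F : ℂ → ℝ), Continuous F →
        ∫ z, (U + V) i z * ((F z : ℝ) : ℂ) ∂diskMeasure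
          = ∫ z, U i z * ((F z : ℝ) : ℂ) ∂diskMeasure
            + ∫ z, V i z * ((F z : ℝ) : ℂ) ∂diskMeasure := by
      intro i F hF
      rw [← integral_add (integrable_L2_mul hF (U i)) (integrable_L2_mul hF (V i))]
      refine integral_congr_ae ?_
      filter_upwards [h i] with z hz
      rw [hz]; simp [add_mul]
    rw [key 0 _ (continuous_partialDeriv φ.contDiff j), key j.succ _ φ.continuous, hU j φ, hV j φ]
    ring
  smul_mem' := by
    intro c U hU j φ
    have h : ∀ i : Fin 3, ⇑((c • U) i) =ᵐ[diskMeasure] c • ⇑(U i) := fun i =>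
      Lp.coeFn_smul c (U i)
    have e0 : ∫ z, (c • U) 0 z * ((partialDeriv j φ z : ℝ) : ℂ) ∂diskMeasure
        = c * ∫ z, U 0 z * ((partialDeriv j φ z : ℝ) : ℂ) ∂diskMeasure := by
      rw [← integral_const_mul]
      refine integral_congr_ae ?_
      filter_upwards [h 0] with z hz
      rw [hz]; simp [mul_assoc]
    have e1 : ∫ z, (c • U) j.succ z * ((φ z : ℝ) : ℂ) ∂diskMeasure
        = c * ∫ z, U j.succ z * ((φ z : ℝ) : ℂ) ∂diskMeasure := by
      rw [← integral_const_mul]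
      refine integral_congr_ae ?_
      filter_upwards [h j.succ] with z hz
      rw [hz]; simp [mul_assoc]
    rw [e0, e1, hU j φ, mul_neg]

/-- The function underlying an element of `H¹(𝔻)`. -/
def h1val (U : H1) : ℂ → ℂ := (U : L2Triple) 0

/-- The weak partial derivative `∂_j u` of an element of `H¹(𝔻)`. -/
def h1grad (U : H1) (j : Fin 2) : ℂ → ℂ := (U : L2Triple) j.succ

/-- The pointwise bilinear product `∇u · ∇v`. -/
def gradDot (U V : H1) (z : ℂ) : ℂ := ∑ j : Fin 2, h1grad U j z * h1grad V j z

/-- The triple `(F, ∂₀F, ∂₁F)` of a smooth function on the plane, restricted to the disk. -/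
def smoothTriple (F : ℂ → ℂ) (hF : ContDiff ℝ ∞ F) : L2Triple :=
  WithLp.toLp 2 (Fin.cons ((memLp_disk_of_continuous hF.continuous 2).toLp F)
    fun j => (memLp_disk_of_continuous (continuous_partialDeriv hF j) 2).toLp (partialDeriv j F))

theorem smoothTriple_mem (F : ℂ → ℂ) (hF : ContDiff ℝ ∞ F) : smoothTriple F hF ∈ H1 := by
  intro j φ
  have hφ : ContDiff ℝ ∞ (fun z => ((φ z : ℝ) : ℂ)) := Complex.ofRealCLM.contDiff.comp φ.contDiff
  have hd : ∀ z, fderiv ℝ (fun z => ((φ z : ℝ) : ℂ)) z (coordDir j)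
      = ((partialDeriv j φ z : ℝ) : ℂ) := by
    intro z
    have h1 : HasFDerivAt (fun z => ((φ z : ℝ) : ℂ))
        (Complex.ofRealCLM.comp (fderiv ℝ φ z)) z :=
      Complex.ofRealCLM.hasFDerivAt.comp z
        ((φ.contDiff.differentiable (by simp)) z).hasFDerivAt
    rw [h1.fderiv]; rfl
  have hc : HasCompactSupport (fun z => ((φ z : ℝ) : ℂ)) :=
    φ.hasCompactSupport.comp_left Complex.ofReal_zero
  have h0 : ∀ z, z ∉ Metric.ball (0 : ℂ) 1 → φ z = 0 := fun z hz =>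
    image_eq_zero_of_notMem_tsupport fun h => hz (φ.tsupport_subset h)
  have h0' : ∀ z, z ∉ Metric.ball (0 : ℂ) 1 → partialDeriv j φ z = 0 := fun z hz => by
    have : z ∉ tsupport (fderiv ℝ φ) := fun h =>
      hz (φ.tsupport_subset (tsupport_fderiv_subset ℝ h))
    rw [partialDeriv, image_eq_zero_of_notMem_tsupport this]; rfl
  have e0 : ∫ z, smoothTriple F hF 0 z * ((partialDeriv j φ z : ℝ) : ℂ) ∂diskMeasure
      = ∫ z, F z * ((partialDeriv j φ z : ℝ) : ℂ) := by
    rw [← setIntegral_eq_integral_of_forall_compl_eq_zero (s := Metric.ball (0 : ℂ) 1)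
      (f := fun z => F z * ((partialDeriv j φ z : ℝ) : ℂ))
      (fun z hz => by rw [h0' z hz]; simp)]
    refine integral_congr_ae ?_
    filter_upwards [(memLp_disk_of_continuous hF.continuous 2).coeFn_toLp] with z hz
    exact congrArg (· * _) hz
  have e1 : ∫ z, smoothTriple F hF j.succ z * ((φ z : ℝ) : ℂ) ∂diskMeasure
      = ∫ z, partialDeriv j F z * ((φ z : ℝ) : ℂ) := by
    rw [← setIntegral_eq_integral_of_forall_compl_eq_zero (s := Metric.ball (0 : ℂ) 1)
      (f := fun z => partialDeriv j F z * ((φ z : ℝ) : ℂ)) (fun z hz => by rw [h0 z hz]; simp)]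
    refine integral_congr_ae ?_
    filter_upwards [(memLp_disk_of_continuous (continuous_partialDeriv hF j) 2).coeFn_toLp]
      with z hz
    exact congrArg (· * _) hz
  rw [e0, e1]
  have hdc : HasCompactSupport (fun z => fderiv ℝ (fun z => ((φ z : ℝ) : ℂ)) z (coordDir j)) :=
    (hc.fderiv (𝕜 := ℝ)).comp_left (g := fun L : ℂ →L[ℝ] ℂ => L (coordDir j)) rfl
  have hdcont : Continuous (fun z => fderiv ℝ (fun z => ((φ z : ℝ) : ℂ)) z (coordDir j)) :=
    continuous_partialDeriv hφ j
  have := integral_mul_fderiv_eq_neg_fderiv_mul_of_integrable (μ := (volume : Measure ℂ))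
    (f := F) (g := fun z => ((φ z : ℝ) : ℂ)) (v := coordDir j)
    (((continuous_partialDeriv hF j).mul hφ.continuous).integrable_of_hasCompactSupport
      hc.mul_left)
    ((hF.continuous.mul hdcont).integrable_of_hasCompactSupport hdc.mul_left)
    ((hF.continuous.mul hφ.continuous).integrable_of_hasCompactSupport hc.mul_left)
    (fun z _ => (hF.differentiable (by simp)) z) (fun z _ => (hφ.differentiable (by simp)) z)
  simp only [hd] at this
  exact this

/-- A smooth function on the plane, restricted to the disk, as an element of `H¹(𝔻)`. -/
def smoothH1 (F : ℂ → ℂ) (hF : ContDiff ℝ ∞ F) : H1 := ⟨smoothTriple F hF, smoothTriple_mem F hF⟩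

/-- `H¹₀(𝔻)`: the closure of `C_c^∞(𝔻; ℂ)` in `H¹(𝔻; ℂ)`. -/
def H10 : Submodule ℂ H1 :=
  (Submodule.span ℂ (Set.range fun φ : 𝓓(disk, ℂ) => smoothH1 φ φ.contDiff)).topologicalClosure

instance : IsClosed ((H10 : Submodule ℂ H1) : Set H1) := Submodule.isClosed_topologicalClosure _

/-- The trace space `H^{1/2}(∂𝔻) = H¹(𝔻) / H¹₀(𝔻)`, with the quotient norm. -/
abbrev HHalf : Type := H1 ⧸ H10

/-- The boundary trace of an element of `H¹(𝔻)`. -/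
def trace (U : H1) : HHalf := Submodule.Quotient.mk U

/-- Operators from `H^{1/2}(∂𝔻)` to its dual `H^{-1/2}(∂𝔻)`, with the operator norm. For such an
operator `A`, the bilinear duality pairing `⟨f, A g⟩` is `A g f`. -/
abbrev BdryOp : Type := HHalf →L[ℂ] HHalf →L[ℂ] ℂ

/-! ### Dirichlet-to-Neumann maps -/

/-- `u` is a weak solution of `-∇·(γ∇u) = 0` in `𝔻`, `u = f` on `∂𝔻`. -/
def IsCondSol (γ : LInftyReal) (f : HHalf) (U : H1) : Prop :=
  trace U = f ∧ ∀ V ∈ H10, ∫ z, ((γ z : ℝ) : ℂ) * gradDot U V z ∂diskMeasure = 0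

open Classical in
/-- The solution `u_f^γ` of the conductivity equation. -/
def condSol (γ : LInftyReal) (f : HHalf) : H1 :=
  if h : ∃ U, IsCondSol γ f U then h.choose else 0

/-- `A` is the operator `Λ_γ`: `⟨f, A g⟩ = ∫ γ ∇u_f · ∇u_g^γ` for every `u_f` with trace `f`. -/
def IsDtN (γ : LInftyReal) (A : BdryOp) : Prop :=
  ∀ (g : HHalf) (V : H1),
    A g (trace V) = ∫ z, ((γ z : ℝ) : ℂ) * gradDot V (condSol γ g) z ∂diskMeasure

open Classical in
/-- The map `Φ : γ ↦ Λ_γ`. -/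
def Phi (γ : LInftyReal) : BdryOp := if h : ∃ A, IsDtN γ A then h.choose else 0

/-- The bilinear form `∫ ∇u·∇v + q u v`. -/
def schrForm (q : LInftyReal) (U V : H1) : ℂ :=
  ∫ z, (gradDot U V z + ((q z : ℝ) : ℂ) * (h1val U z * h1val V z)) ∂diskMeasure

/-- `0` is not in the Dirichlet spectrum of `-Δ + q` on `𝔻`: for each `h ∈ L²(𝔻)`, the equation
`(-Δ + q) w = h` has exactly one weak solution `w ∈ H¹₀(𝔻)`. -/
def ZeroNotInDirichletSpectrum (q : LInftyReal) : Prop :=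
  ∀ h : L2, ∃! W : H1, W ∈ H10 ∧
    ∀ V ∈ H10, schrForm q W V = ∫ z, h z * h1val V z ∂diskMeasure

/-- `v` is a weak solution of `(-Δ + q) v = 0` in `𝔻`, `v = f` on `∂𝔻`. -/
def IsSchrSol (q : LInftyReal) (f : HHalf) (U : H1) : Prop :=
  trace U = f ∧ ∀ V ∈ H10, schrForm q U V = 0

open Classical in
/-- The solution `v_f^q` of the Schrödinger equation. -/
def schrSol (q : LInftyReal) (f : HHalf) : H1 :=
  if h : ∃ U, IsSchrSol q f U then h.choose else 0

/-- `A` is the operator `Λ^S_q`, `g ↦ ∂_ν v_g^q` (weak normal derivative):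
`⟨f, A g⟩ = ∫ ∇v_f · ∇v_g^q + q v_f v_g^q` for every `v_f` with trace `f`. -/
def IsSchrDtN (q : LInftyReal) (A : BdryOp) : Prop :=
  ∀ (g : HHalf) (V : H1), A g (trace V) = schrForm q V (schrSol q g)

open Classical in
/-- The map `Φ^S : q ↦ Λ^S_q`. -/
def PhiS (q : LInftyReal) : BdryOp := if h : ∃ A, IsSchrDtN q A then h.choose else 0

/-! ### Compactly supported distributions -/

/-- `T` belongs to `ℰ'(𝔻)`: its support is a compact subset of `𝔻`. -/
def IsCompactlySupported (T : 𝓓'(disk, ℂ)) : Prop :=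
  ∃ K : Set ℂ, IsCompact K ∧ K ⊆ disk ∧ Distribution.IsVanishingOn T Kᶜ

/-- `G` agrees almost everywhere in `𝔻` with the function `W`, which is smooth in `𝔻`. -/
def IsSmoothRep (G W : ℂ → ℂ) : Prop :=
  ContDiffOn ℝ ∞ W disk ∧ W =ᵐ[diskMeasure] G

/-- The product of a test function with a real function that is smooth in `𝔻`. -/
def cutMul (χ : 𝓓(disk, ℝ)) (w : ℂ → ℝ) (hw : ContDiffOn ℝ ∞ w disk) : 𝓓(disk, ℝ) where
  toFun z := χ z * w z
  contDiff' := by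
    rw [contDiff_iff_contDiffAt]
    intro z
    by_cases hz : z ∈ disk
    · exact χ.contDiff.contDiffAt.mul (hw.contDiffAt (disk.isOpen.mem_nhds hz))
    · have h : z ∉ tsupport χ := fun h => hz (χ.tsupport_subset h)
      have h2 : (fun z => χ z * w z) =ᶠ[𝓝 z] fun _ => 0 := by
        filter_upwards [notMem_tsupport_iff_eventuallyEq.mp h] with y hy
        rw [hy]; simp
      exact contDiffAt_const.congr_of_eventuallyEq h2
  hasCompactSupport' := χ.hasCompactSupport.mul_right
  tsupport_subset' := (tsupport_mul_subset_left).trans χ.tsupport_subset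

/-- `χ T = T`. -/
def IsCutoffFor (χ : 𝓓(disk, ℝ)) (T : 𝓓'(disk, ℂ)) : Prop :=
  ∀ φ : 𝓓(disk, ℝ), T (cutMul χ φ φ.contDiff.contDiffOn) = T φ

/-- `⟨T, χ W⟩` for a complex-valued function `W` that is smooth in `𝔻`. -/
def cutPair (T : 𝓓'(disk, ℂ)) (χ : 𝓓(disk, ℝ)) (W : ℂ → ℂ) (hW : ContDiffOn ℝ ∞ W disk) : ℂ :=
  T (cutMul χ (fun z => (W z).re) (Complex.reCLM.contDiff.comp_contDiffOn hW))
    + Complex.I * T (cutMul χ (fun z => (W z).im) (Complex.imCLM.contDiff.comp_contDiffOn hW))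

open Classical in
/-- The pairing `⟨T, G⟩` of `T ∈ ℰ'(𝔻)` with a function `G` which, after modification on a null
set, is smooth in `𝔻`: it is `⟨T, χ W⟩`, where `W` is the smooth representative of `G` and `χ` is a
test function with `χ T = T`. -/
def distPair (T : 𝓓'(disk, ℂ)) (G : ℂ → ℂ) : ℂ :=
  if h : (∃ W, IsSmoothRep G W) ∧ ∃ χ, IsCutoffFor χ T then
    cutPair T h.2.choose h.1.choose h.1.choose_spec.1
  else 0

/-- `∫_𝔻 (q + T) G` for `q ∈ L^∞(𝔻)` and `T ∈ ℰ'(𝔻)`. -/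
def integralPair (q : LInfty) (T : 𝓓'(disk, ℂ)) (G : ℂ → ℂ) : ℂ :=
  ∫ z, q z * G z ∂diskMeasure + distPair T G

/-! ### The Fréchet differentials on `L^∞(𝔻) + ℰ'(𝔻)` -/

/-- The `ℂ`-linear extension of an `ℝ`-linear map on `L^∞(𝔻; ℝ)` to `L^∞(𝔻; ℂ)`. -/
def complexify (D : LInftyReal →L[ℝ] BdryOp) (γ : LInfty) : BdryOp :=
  D (Complex.reCLM.compLp γ) + Complex.I • D (Complex.imCLM.compLp γ)

/-- `⟨f, dΦ_σ(γ + T) g⟩` for `γ ∈ L^∞(𝔻)` and `T ∈ ℰ'(𝔻)`: the Fréchet derivative of `Φ` on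
`L^∞(𝔻)`, extended by `⟨T, χ ∇u_f^σ · ∇u_g^σ⟩`. -/
def dPhi (σ : LInftyReal) (γ : LInfty) (T : 𝓓'(disk, ℂ)) (f g : HHalf) : ℂ :=
  complexify (fderiv ℝ Phi σ) γ g f + distPair T (gradDot (condSol σ f) (condSol σ g))

/-- `⟨f, dΦ^S_{q₀}(q + T) g⟩` for `q ∈ L^∞(𝔻)` and `T ∈ ℰ'(𝔻)`: the Fréchet derivative of `Φ^S` on
`L^∞(𝔻)`, extended by `⟨T, χ v_f v_g⟩`. -/
def dPhiS (q₀ : LInftyReal) (q : LInfty) (T : 𝓓'(disk, ℂ)) (f g : HHalf) : ℂ :=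
  complexify (fderiv ℝ PhiS q₀) q g f
    + distPair T (fun z => h1val (schrSol q₀ f) z * h1val (schrSol q₀ g) z)

/-! ### Bessel functions and the radial profiles -/

/-- The Bessel function `J_n` of the first kind, of order `n ∈ ℕ`. -/
def besselJ (n : ℕ) (z : ℂ) : ℂ :=
  ∑' k : ℕ, (-1) ^ k / ((k.factorial : ℂ) * ((k + n).factorial : ℂ)) * (z / 2) ^ (2 * k + n)

/-- `λ_{0,1}`, the first positive zero of `J_0`. -/
def firstZero : ℝ := sInf {x : ℝ | 0 < x ∧ besselJ 0 (x : ℂ) = 0}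

/-- `√κ` (principal branch: `√κ = i √|κ|` for `κ < 0`). -/
def sqrtC (κ : ℝ) : ℂ := (κ : ℂ) ^ (1 / 2 : ℂ)

/-- `σ_κ(x) = J_0(√κ |x|)²`; this number is real. -/
def sigmaFun (κ : ℝ) (x : ℂ) : ℝ := (besselJ 0 (sqrtC κ * (‖x‖ : ℂ)) ^ 2).re

theorem sqrtC_sq (κ : ℝ) : sqrtC κ ^ 2 = κ := by
  rw [sqrtC, one_div]
  exact_mod_cast Complex.cpow_nat_inv_pow (κ : ℂ) (two_ne_zero)

theorem besselJ_zero_sqrtC (κ r : ℝ) : besselJ 0 (sqrtC κ * (r : ℂ)) =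
    ((∑' k : ℕ, (-1) ^ k / ((k.factorial : ℝ) * (k.factorial : ℝ)) * (κ * r ^ 2 / 4) ^ k : ℝ)
      : ℂ) := by
  rw [Complex.ofReal_tsum, besselJ]
  refine tsum_congr fun k => ?_
  have h : (sqrtC κ * (r : ℂ) / 2) ^ (2 * k) = ((κ : ℂ) * r ^ 2 / 4) ^ k := by
    rw [pow_mul, div_pow, mul_pow, sqrtC_sq]; norm_num
  simp [h]

theorem sigmaFun_eq (κ : ℝ) (x : ℂ) :
    (sigmaFun κ x : ℂ) = besselJ 0 (sqrtC κ * (‖x‖ : ℂ)) ^ 2 := by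
  rw [sigmaFun, besselJ_zero_sqrtC]
  norm_cast

theorem memLp_sigmaFun (κ : ℝ) : MemLp (sigmaFun κ) ∞ diskMeasure := by
  have hs : Summable fun k : ℕ => |κ / 4| ^ k / (k.factorial : ℝ) :=
    Real.summable_pow_div_factorial _
  have hb : ∀ (k : ℕ) (x : ℂ), x ∈ Metric.closedBall (0 : ℂ) 1 →
      ‖(-1) ^ k / ((k.factorial : ℝ) * (k.factorial : ℝ)) * (κ * ‖x‖ ^ 2 / 4) ^ k‖
        ≤ |κ / 4| ^ k / (k.factorial : ℝ) := by
    intro k x hx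
    have hx1 : ‖x‖ ≤ 1 := by simpa using hx
    have hx2 : ‖x‖ ^ 2 ≤ 1 := pow_le_one₀ (norm_nonneg x) hx1
    have hf : (1 : ℝ) ≤ k.factorial := by exact_mod_cast k.factorial_pos
    have h1 : |κ * ‖x‖ ^ 2 / 4| ≤ |κ / 4| := by
      have : κ * ‖x‖ ^ 2 / 4 = κ / 4 * ‖x‖ ^ 2 := by ring
      rw [this, abs_mul, abs_of_nonneg (sq_nonneg ‖x‖)]
      exact mul_le_of_le_one_right (abs_nonneg _) hx2
    rw [norm_mul, norm_div, norm_pow, norm_neg, norm_one, one_pow, norm_pow, Real.norm_eq_abs,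
      Real.norm_eq_abs, abs_of_nonneg (by positivity : (0 : ℝ) ≤ k.factorial * k.factorial),
      div_mul_eq_mul_div, one_mul]
    have hff : (k.factorial : ℝ) ≤ k.factorial * k.factorial := by nlinarith
    gcongr
  have hcont : ContinuousOn (sigmaFun κ) (Metric.closedBall 0 1) := by
    have h1 : ContinuousOn (fun x : ℂ => ∑' k : ℕ,
        (-1) ^ k / ((k.factorial : ℝ) * (k.factorial : ℝ)) * (κ * ‖x‖ ^ 2 / 4) ^ k)
        (Metric.closedBall (0 : ℂ) 1) :=
      continuousOn_tsum (fun k => by fun_prop) hs hb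
    refine (h1.pow 2).congr fun x _ => ?_
    rw [sigmaFun, besselJ_zero_sqrtC]
    norm_cast
  obtain ⟨C, hC⟩ := (isCompact_closedBall (0 : ℂ) 1).exists_bound_of_continuousOn hcont
  refine MemLp.of_bound
    ((hcont.mono Metric.ball_subset_closedBall).aestronglyMeasurable measurableSet_ball) C ?_
  filter_upwards [ae_restrict_mem measurableSet_ball] with z hz
  exact hC z (Metric.ball_subset_closedBall hz)

/-- `σ_κ` as an element of `L^∞(𝔻; ℝ)`. -/
def sigma (κ : ℝ) : LInftyReal := (memLp_sigmaFun κ).toLp (sigmaFun κ)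

/-- The constant potential `c`. -/
def constPot (c : ℝ) : LInftyReal := Lp.const ∞ diskMeasure c

/-- `φ^κ_ℓ(r)`. -/
def phi (κ : ℝ) (l : ℤ) (r : ℝ) : ℂ :=
  if κ = 0 then (r : ℂ) ^ l.natAbs
  else besselJ l.natAbs (sqrtC κ * r) / besselJ l.natAbs (sqrtC κ)

/-- `ψ^κ_ℓ(r)`; the value at `r = 0` is `0`. -/
def psi (κ : ℝ) (l : ℤ) (r : ℝ) : ℂ :=
  if r = 0 then 0
  else sqrtC κ * r * (besselJ 1 (sqrtC κ * r) / besselJ 0 (sqrtC κ * r)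
    - besselJ (l.natAbs + 1) (sqrtC κ * r) / besselJ l.natAbs (sqrtC κ * r))

/-! ### The Fourier basis of the circle -/

/-- `e_ℓ(w) = w^ℓ / √(2π)`, for `w` on the unit circle. -/
def e (l : ℤ) (w : ℂ) : ℂ := w ^ l / (Real.sqrt (2 * Real.pi) : ℂ)

/-- `x̂ = x / |x|`. -/
def hat (x : ℂ) : ℂ := x / (‖x‖ : ℂ)

/-- A smooth function on the plane that agrees with `e_ℓ` on the unit circle. -/
def eExt (l : ℤ) (z : ℂ) : ℂ :=
  (if 0 ≤ l then z ^ l.natAbs else (conj z) ^ l.natAbs) / (Real.sqrt (2 * Real.pi) : ℂ)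

theorem eExt_eq (l : ℤ) (z : ℂ) (hz : ‖z‖ = 1) : eExt l z = e l z := by
  rw [eExt, e]
  congr 1
  split_ifs with h
  · rw [← zpow_natCast, Int.natAbs_of_nonneg h]
  · have hl : l = -(l.natAbs : ℤ) := by omega
    rw [← Complex.inv_eq_conj hz, inv_pow, ← zpow_natCast, ← zpow_neg, ← hl]

theorem contDiff_conj : ContDiff ℝ ∞ (fun z : ℂ => conj z) :=
  Complex.conjCLE.contDiff

theorem contDiff_eExt (l : ℤ) : ContDiff ℝ ∞ (eExt l) := by
  unfold eExt
  split_ifs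
  · exact (contDiff_id.pow _).div_const _
  · exact (contDiff_conj.pow _).div_const _

/-- `e_ℓ` as an element of `H^{1/2}(∂𝔻)`. -/
def eTrace (l : ℤ) : HHalf := trace (smoothH1 (eExt l) (contDiff_eExt l))

/-- The complex conjugate of `e_ℓ` as an element of `H^{1/2}(∂𝔻)`. -/
def eBarTrace (l : ℤ) : HHalf :=
  trace (smoothH1 (fun z => conj (eExt l z)) (contDiff_conj.comp (contDiff_eExt l)))

/-! ### The moments -/

/-- The weight `φ^κ_ℓ(|x|) φ^κ_m(|x|) conj(e_ℓ(x̂)) e_m(x̂)`. -/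
def muWeight (κ : ℝ) (l m : ℤ) (x : ℂ) : ℂ :=
  phi κ l ‖x‖ * phi κ m ‖x‖ * conj (e l (hat x)) * e m (hat x)

/-- The moment `μ^κ_{ℓ,m}[q + T]`. -/
def muMoment (κ : ℝ) (l m : ℤ) (q : LInfty) (T : 𝓓'(disk, ℂ)) : ℂ :=
  integralPair q T (muWeight κ l m)

/-- The moment `𝔪^κ_{ℓ,m}[γ + T] = ⟨conj e_ℓ, dΦ_{σ_κ}(γ + T) e_m⟩`. -/
def mMoment (κ : ℝ) (l m : ℤ) (γ : LInfty) (T : 𝓓'(disk, ℂ)) : ℂ :=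
  dPhi (sigma κ) γ T (eBarTrace l) (eTrace m)

/-- The weight
`(1/σ_κ(x)) (ℓ m + (|ℓ| + ψ_ℓ(|x|)) (|m| + ψ_m(|x|))) / |x|² φ_ℓ(|x|) φ_m(|x|) conj(e_ℓ(x̂)) e_m(x̂)`.
-/
def mWeight (κ : ℝ) (l m : ℤ) (x : ℂ) : ℂ :=
  1 / (sigmaFun κ x : ℂ)
    * (((l : ℂ) * m + ((l.natAbs : ℂ) + psi κ l ‖x‖) * ((m.natAbs : ℂ) + psi κ m ‖x‖))
      / (‖x‖ : ℂ) ^ 2)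
    * phi κ l ‖x‖ * phi κ m ‖x‖ * conj (e l (hat x)) * e m (hat x)

end

end Calderon

namespace Calderon

noncomputable section

open MeasureTheory TopologicalSpace Filter Topology
open scoped Distributions ContDiff ComplexConjugate ENNReal

/-! ### Bilinear forms on Hilbert spaces -/

section Abstract

open scoped InnerProductSpace

/-! Both boundary maps come from a symmetric bilinear form `b₀ + B p` on `H1` that depends affinely
on the coefficient `p`. Where the form restricted to `H10` is invertible, write `S_p` for the
operator sending boundary data to the solution; then `⟨f, Λ_p g⟩ = (b₀ + B p)(U, S_p g)` for every
`U` with trace `f`. Taking `U = S_{p₀} f` and using that `S_p g - S_{p₀} g` lies in `H10`, the first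
order remainder at `p₀` is exactly `B (p - p₀) (S_{p₀} f) ((S_p - S_{p₀}) g)`. Continuity of `p ↦
S_p` therefore already gives the derivative `h ↦ B h (S_{p₀} f) (S_{p₀} g)` (`hasFDerivAt_dtnOp`,
`fderiv_dtn`). The differentials are thus integrals against `v_f v_g` and `∇u_f · ∇u_g`, as is their
extension to distributions, and it remains to compute the solutions with Fourier data.

Write `J_n(x) = (x/2)^n B_n(x²/4)` with `B_n` real and entire. The recurrence for `B_n` makes
`w^{|ℓ|} B_{|ℓ|}(κ|z|²/4)`, with `w = z` or its conjugate, a smooth solution of `Δu = -κu`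
(`laplacian_mode`). If `B_{|ℓ|}(κ/4)` vanished, this mode would be a Dirichlet eigenfunction
(`besselB_ne_zero`, through `smoothH1_mem_H10`); so off the spectrum it can be normalized to have
trace `e_ℓ`, and products of two modes are the Schrödinger weights.

For `κ < λ_{0,1}²` the radial mode `w₀` is positive on the closed disk. Substituting `φ = w₀ v`
gives `∫|∇φ|² = κ∫|φ|² + ∫w₀²|∇v|²`; applied at some larger `κ' < λ_{0,1}²` when `κ > 0`, this makes
the form for `κ` coercive (`mul_integral_norm_sq_le`). Finally `σ_κ = w₀²`, and quotients of modes
by `w₀` solve the conductivity equation, because `w₀² ∇(F/w₀) = w₀∇F - F∇w₀` is divergence free. The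
logarithmic gradient of such a quotient has an angular part governed by `|ℓ|` and a radial part
governed by `ψ_ℓ` (`wronskian_mode`); multiplying two of them produces the conductivity weight
(`gradDot_condSol_ae_eq`). -/

theorem exists_clm_of_conjugation {H : Type*} [NormedAddCommGroup H] [InnerProductSpace ℂ H]
    (C : H → H) (hC : ∀ x, C (C x) = x) (hin : ∀ a b, ⟪C a, b⟫_ℂ = ⟪C b, a⟫_ℂ) :
    ∃ C' : H →L⋆[ℂ] H, ∀ x, C' x = C x :=
  ⟨LinearMap.mkContinuous
    { toFun := C
      -- The exchange identity turns a pairing with `C (x + y)` into a pairing of `C z` with `x +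
      -- y`, where additivity is available.
      map_add' := fun x y => ext_inner_right ℂ fun z => by
        rw [hin, inner_add_left, inner_add_right, hin x, hin y]
      map_smul' := fun a x => ext_inner_right ℂ fun z => by
        rw [hin, inner_smul_left, inner_smul_right, hin x, RCLike.conj_conj] } 1 fun x => by
      have h1 : ‖C x‖ ^ 2 = ‖x‖ ^ 2 := by
        have h2 : ⟪C x, C x⟫_ℂ = ⟪x, x⟫_ℂ := by rw [hin, hC]
        rw [inner_self_eq_norm_sq_to_K, inner_self_eq_norm_sq_to_K] at h2
        exact_mod_cast h2
      rw [one_mul]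
      exact ((sq_eq_sq₀ (norm_nonneg _) (norm_nonneg _)).1 h1).le, fun _ => rfl⟩

/-- Lax–Milgram for a bilinear form on a complex Hilbert space with a conjugation `C`. -/
theorem bijective_of_coercive {H : Type*} [NormedAddCommGroup H] [InnerProductSpace ℂ H]
    [CompleteSpace H] (A : H →L[ℂ] H →L[ℂ] ℂ) (C : H → H) (hC : ∀ x, C (C x) = x)
    (hin : ∀ a b, ⟪C a, b⟫_ℂ = ⟪C b, a⟫_ℂ) {c : ℝ} (hc : 0 < c)
    (h : ∀ u, c * ‖u‖ ^ 2 ≤ ‖A u (C u)‖) : Function.Bijective A := by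
  let R : (H →L[ℂ] ℂ) →L⋆[ℂ] H :=
    ((InnerProductSpace.toDual ℂ H).symm.toContinuousLinearEquiv : (H →L[ℂ] ℂ) →L⋆[ℂ] H)
  have hR : ∀ (f : H →L[ℂ] ℂ) (x : H), ⟪R f, x⟫_ℂ = f x := fun f x =>
    InnerProductSpace.toDual_symm_apply
  have hRinj : ∀ f g, R f = R g → f = g := fun f g hfg =>
    (InnerProductSpace.toDual ℂ H).symm.injective hfg
  obtain ⟨C', hC'⟩ := exists_clm_of_conjugation C hC hin
  -- The Riesz map and the conjugation are both antilinear, so `T` is complex linear, and `⟪T u, u⟫`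
  -- is the conjugate of `A u (C u)`. Coercivity makes `T` invertible, and this passes back to `A`.
  let T : H →L[ℂ] H := (C'.comp R).comp A
  have hT : IsUnit T := by
    refine ContinuousLinearMap.isUnit_of_forall_le_norm_inner_map T (c := ⟨c, hc.le⟩) hc fun u => ?_
    have : ⟪T u, u⟫_ℂ = conj (A u (C u)) := by
      change ⟪C' (R (A u)), u⟫_ℂ = _
      rw [hC', hin, ← inner_conj_symm, hR]
    rw [this, RCLike.norm_conj, mul_comm]
    exact h u
  obtain ⟨hi, hs⟩ := (ContinuousLinearMap.isUnit_iff_bijective).1 hT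
  refine ⟨fun u v huv => hi ?_, fun f => ?_⟩
  · change C' (R (A u)) = C' (R (A v))
    rw [huv]
  · obtain ⟨u, hu⟩ := hs (C (R f))
    refine ⟨u, hRinj _ _ ?_⟩
    have := congrArg C ((hC' (R (A u))).symm.trans hu)
    rwa [hC, hC] at this

/-! ### Solution operator and Dirichlet-to-Neumann operator of an abstract form -/

variable {X Y Q : Type*} [NormedAddCommGroup X] [NormedSpace ℂ X]
  [NormedAddCommGroup Y] [NormedSpace ℂ Y] [NormedAddCommGroup Q] [NormedSpace ℂ Q]

/-- Restriction of a bilinear form along `ι`. -/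
def formRestrict (ι : Y →L[ℂ] X) (b : X →L[ℂ] X →L[ℂ] ℂ) : Y →L[ℂ] Y →L[ℂ] ℂ :=
  (ContinuousLinearMap.precomp ℂ ι).comp (b.comp ι)

theorem formRestrict_apply (ι : Y →L[ℂ] X) (b : X →L[ℂ] X →L[ℂ] ℂ) (x y : Y) :
    formRestrict ι b x y = b (ι x) (ι y) := rfl

theorem continuous_formRestrict (ι : Y →L[ℂ] X) : Continuous (formRestrict ι) := by
  unfold formRestrict
  fun_prop

/-- The solution operator of the problem `b u v = 0` for `v ∈ range ι`, `π u = g`, given a section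
`s` of the quotient map `π`. -/
def solOp (ι : Y →L[ℂ] X) (s : Q →L[ℂ] X) (b : X →L[ℂ] X →L[ℂ] ℂ) : Q →L[ℂ] X :=
  s - ι.comp ((ContinuousLinearMap.inverse (formRestrict ι b)).comp
    ((ContinuousLinearMap.precomp ℂ ι).comp (b.comp s)))

/-- The Dirichlet-to-Neumann operator of the form `b`. -/
def dtnOp (ι : Y →L[ℂ] X) (s : Q →L[ℂ] X) (b : X →L[ℂ] X →L[ℂ] ℂ) : Q →L[ℂ] Q →L[ℂ] ℂ :=
  (ContinuousLinearMap.precomp ℂ s).comp (b.flip.comp (solOp ι s b))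

section

variable [CompleteSpace Y] {ι : Y →L[ℂ] X} {π : X →L[ℂ] Q} {s : Q →L[ℂ] X}
  {b b₀ : X →L[ℂ] X →L[ℂ] ℂ}

theorem exists_equiv_of_bijective (hb : Function.Bijective (formRestrict ι b)) :
    ∃ e : Y ≃L[ℂ] (Y →L[ℂ] ℂ), (e : Y →L[ℂ] Y →L[ℂ] ℂ) = formRestrict ι b :=
  ⟨ContinuousLinearEquiv.ofBijective (formRestrict ι b) (LinearMap.ker_eq_bot.2 hb.1)
    (LinearMap.range_eq_top.2 hb.2), ContinuousLinearEquiv.coe_ofBijective _ _ _⟩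

/-- Invertible operators between Banach spaces form an open set, and restriction of forms is
continuous. -/
theorem eventually_bijective (hb : Function.Bijective (formRestrict ι b₀)) :
    ∀ᶠ b in 𝓝 b₀, Function.Bijective (formRestrict ι b) := by
  obtain ⟨e, he⟩ := exists_equiv_of_bijective hb
  have h1 := ContinuousLinearEquiv.nhds e
  rw [he] at h1
  filter_upwards [(continuous_formRestrict ι).continuousAt h1] with b hb
  obtain ⟨e', he'⟩ := hb
  rw [← he']
  exact e'.bijective

/-- Inversion of operators is continuous at an invertible one. -/
theorem continuousAt_solOp (hb : Function.Bijective (formRestrict ι b)) :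
    ContinuousAt (solOp ι s) b := by
  obtain ⟨e, he⟩ := exists_equiv_of_bijective hb
  have h1 : ContinuousAt (fun b => ContinuousLinearMap.inverse (formRestrict ι b)) b := by
    refine ContinuousAt.comp (g := ContinuousLinearMap.inverse) ?_
      (continuous_formRestrict ι).continuousAt
    rw [← he]
    exact (contDiffAt_map_inverse (n := 0) e).continuousAt
  unfold solOp
  fun_prop

/-- The correction subtracted from `s g` is the element of `Y` on which the form acts, against `Y`,
exactly as it does on `s g`. -/
theorem solOp_apply_eq_zero (hb : Function.Bijective (formRestrict ι b)) (g : Q) (v : Y) :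
    b (solOp ι s b g) (ι v) = 0 := by
  obtain ⟨e, he⟩ := exists_equiv_of_bijective hb
  have h1 : solOp ι s b g = s g - ι (e.symm (ContinuousLinearMap.precomp ℂ ι (b (s g)))) := by
    simp [solOp, ← he]
  have h2 := congrArg (fun f => f v)
    (e.apply_symm_apply (ContinuousLinearMap.precomp ℂ ι (b (s g))))
  have h3 : ∀ y, e y v = b (ι y) (ι v) := fun y => by
    rw [← formRestrict_apply ι b y v, ← he]; rfl
  simp only [h3] at h2
  rw [h1, map_sub, sub_apply, h2]
  exact sub_self _

omit [CompleteSpace Y] in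
theorem map_solOp (hπ : ∀ x, π x = 0 ↔ ∃ y, ι y = x) (hs : ∀ g, π (s g) = g) (g : Q) :
    π (solOp ι s b g) = g := by
  have : π (ι (ContinuousLinearMap.inverse (formRestrict ι b)
      (ContinuousLinearMap.precomp ℂ ι (b (s g))))) = 0 := (hπ _).2 ⟨_, rfl⟩
  rw [solOp, sub_apply, map_sub, hs]
  exact (congrArg (g - ·) this).trans (sub_zero g)

theorem eq_solOp (hπ : ∀ x, π x = 0 ↔ ∃ y, ι y = x) (hs : ∀ g, π (s g) = g)
    (hb : Function.Bijective (formRestrict ι b)) {g : Q} {u : X}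
    (hu : π u = g) (h : ∀ v, b u (ι v) = 0) : u = solOp ι s b g := by
  obtain ⟨y, hy⟩ := (hπ (u - solOp ι s b g)).1 (by rw [map_sub, hu, map_solOp hπ hs, sub_self])
  have h2 : formRestrict ι b y = 0 := by
    ext v
    rw [formRestrict_apply, hy, map_sub, sub_apply, h, solOp_apply_eq_zero hb]
    simp
  rw [(map_eq_zero_iff _ hb.1).1 h2, map_zero] at hy
  exact sub_eq_zero.1 hy.symm

/-- The pairing does not depend on the extension of the boundary data: two extensions differ by an
element of `Y`, which by symmetry pairs to zero with a solution. -/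
theorem dtnOp_apply_map (hπ : ∀ x, π x = 0 ↔ ∃ y, ι y = x) (hs : ∀ g, π (s g) = g)
    (hb : Function.Bijective (formRestrict ι b)) (hsym : ∀ u v, b u v = b v u)
    (g : Q) (v : X) : dtnOp ι s b g (π v) = b v (solOp ι s b g) := by
  change b (s (π v)) (solOp ι s b g) = _
  obtain ⟨y, hy⟩ := (hπ (s (π v) - v)).1 (by rw [map_sub, hs, sub_self])
  have h2 := solOp_apply_eq_zero (s := s) hb g y
  rw [hy, hsym, map_sub, sub_apply, sub_eq_zero] at h2
  exact h2

end

/-! ### Fréchet derivative of the abstract Dirichlet-to-Neumann operator -/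

variable {P : Type*} [NormedAddCommGroup P] [NormedSpace ℝ P]

theorem hasFDerivAt_of_norm_le {P G : Type*} [NormedAddCommGroup P] [NormedSpace ℝ P]
    [NormedAddCommGroup G] [NormedSpace ℝ G] {f : P → G} {D : P →L[ℝ] G} {p₀ : P} {k : P → ℝ}
    (hk : Tendsto k (𝓝 p₀) (𝓝 0))
    (h : ∀ᶠ p in 𝓝 p₀, ‖f p - f p₀ - D (p - p₀)‖ ≤ k p * ‖p - p₀‖) : HasFDerivAt f D p₀ := by
  refine hasFDerivAt_iff_isLittleO.2 (Asymptotics.isLittleO_iff.2 fun ε hε => ?_)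
  filter_upwards [h, hk.eventually (ge_mem_nhds hε)] with p hp1 hp2
  exact hp1.trans (by gcongr)

theorem continuous_of_map_add_of_norm_le {P F : Type*} [NormedAddCommGroup P]
    [NormedAddCommGroup F] {B : P → F} {K : ℝ} (hadd : ∀ p q, B (p + q) = B p + B q)
    (hK : ∀ p, ‖B p‖ ≤ K * ‖p‖) (b : F) : Continuous fun p => b + B p :=
  (AddMonoidHomClass.continuous_of_bound (AddMonoidHom.mk' B hadd) K hK).const_add b

/-- An additive, homogeneous and bounded map as a continuous linear map. -/
def clmOfBound {P G : Type*} [NormedAddCommGroup P] [NormedSpace ℝ P]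
    [NormedAddCommGroup G] [NormedSpace ℝ G] (f : P → G) (hadd : ∀ p q, f (p + q) = f p + f q)
    (hsmul : ∀ (c : ℝ) p, f (c • p) = c • f p) (K : ℝ) (hK : ∀ p, ‖f p‖ ≤ K * ‖p‖) : P →L[ℝ] G :=
  LinearMap.mkContinuous { toFun := f, map_add' := hadd, map_smul' := hsmul } K hK

/-- A real-linear bounded family of bilinear forms. -/
structure IsFormFamily (B : P → X →L[ℂ] X →L[ℂ] ℂ) (K : ℝ) : Prop where
  map_add : ∀ p q, B (p + q) = B p + B q
  map_smul : ∀ (c : ℝ) p u v, B (c • p) u v = c * B p u v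
  norm_le : ∀ p, ‖B p‖ ≤ K * ‖p‖
  nonneg : 0 ≤ K
  symm : ∀ p u v, B p u v = B p v u

/-- The derivative of the Dirichlet-to-Neumann operator along a linear family of forms. -/
def dtnDeriv (ι : Y →L[ℂ] X) (s : Q →L[ℂ] X) {B : P → X →L[ℂ] X →L[ℂ] ℂ} {K : ℝ}
    (hB : IsFormFamily B K) (b : X →L[ℂ] X →L[ℂ] ℂ) : P →L[ℝ] Q →L[ℂ] Q →L[ℂ] ℂ :=
  clmOfBound (G := Q →L[ℂ] Q →L[ℂ] ℂ)
    (fun h => (ContinuousLinearMap.precomp ℂ (solOp ι s b)).comp ((B h).flip.comp (solOp ι s b)))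
    (fun p q => by ext; simp [hB.map_add]) (fun c p => by ext; simp [hB.map_smul])
    (‖solOp ι s b‖ * (K * ‖solOp ι s b‖)) fun h => by
      have := hB.nonneg
      refine ContinuousLinearMap.opNorm_le_bound₂ _ (by positivity) fun g f => ?_
      change ‖B h (solOp ι s b f) (solOp ι s b g)‖ ≤ _
      calc _ ≤ ‖B h‖ * ‖solOp ι s b f‖ * ‖solOp ι s b g‖ := (B h).le_opNorm₂ _ _
        _ ≤ (K * ‖h‖) * (‖solOp ι s b‖ * ‖f‖) * (‖solOp ι s b‖ * ‖g‖) := by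
          gcongr
          · exact hB.norm_le h
          · exact (solOp ι s b).le_opNorm f
          · exact (solOp ι s b).le_opNorm g
        _ = _ := by ring

theorem dtnDeriv_apply (ι : Y →L[ℂ] X) (s : Q →L[ℂ] X) {B : P → X →L[ℂ] X →L[ℂ] ℂ} {K : ℝ}
    (hB : IsFormFamily B K) (b : X →L[ℂ] X →L[ℂ] ℂ) (h : P) (g f : Q) :
    dtnDeriv ι s hB b h g f = B h (solOp ι s b f) (solOp ι s b g) := rfl

variable [CompleteSpace Y] {ι : Y →L[ℂ] X} {π : X →L[ℂ] Q} {s : Q →L[ℂ] X}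
  {b₀ : X →L[ℂ] X →L[ℂ] ℂ}

omit [CompleteSpace Y] in
theorem continuous_form {B : P → X →L[ℂ] X →L[ℂ] ℂ} {K : ℝ} (hB : IsFormFamily B K)
    (b₀ : X →L[ℂ] X →L[ℂ] ℂ) : Continuous fun p => b₀ + B p :=
  continuous_of_map_add_of_norm_le (F := X →L[ℂ] X →L[ℂ] ℂ) hB.map_add hB.norm_le b₀

/-- Evaluate both operators on the same extension `S p₀ f`. Since `S p g - S p₀ g` lies in `Y`, the
form at `p₀` annihilates it against `S p₀ f`, and what remains after removing the derivative is `B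
(p - p₀) (S p₀ f) ((S p - S p₀) g)`. This is `o(‖p - p₀‖)` as soon as `S` is continuous. -/
theorem hasFDerivAt_dtnOp (hπ : ∀ x, π x = 0 ↔ ∃ y, ι y = x) (hs : ∀ g, π (s g) = g)
    {B : P → X →L[ℂ] X →L[ℂ] ℂ} {K : ℝ} (hB : IsFormFamily B K) (p₀ : P)
    (hb₀ : ∀ u v, b₀ u v = b₀ v u) (hb : Function.Bijective (formRestrict ι (b₀ + B p₀))) :
    HasFDerivAt (fun p => dtnOp ι s (b₀ + B p)) (dtnDeriv ι s hB (b₀ + B p₀)) p₀ := by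
  have hcont := continuous_form hB b₀
  have hS : ContinuousAt (fun p => solOp ι s (b₀ + B p)) p₀ :=
    ContinuousAt.comp (g := solOp ι s) (f := fun p => b₀ + B p) (continuousAt_solOp hb)
      hcont.continuousAt
  have hsym : ∀ p u v, (b₀ + B p) u v = (b₀ + B p) v u := fun p u v => by
    simp [hb₀ u v, hB.symm p u v]
  have hK := hB.nonneg
  set S := fun p => solOp ι s (b₀ + B p) with hSdef
  have hlim : Tendsto (fun p => K * ‖S p₀‖ * ‖S p - S p₀‖) (𝓝 p₀) (𝓝 0) := by
    have h1 : Tendsto (fun p => S p - S p₀) (𝓝 p₀) (𝓝 0) := by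
      have := hS.tendsto.sub_const (S p₀)
      rwa [sub_self] at this
    simpa using h1.norm.const_mul (K * ‖S p₀‖)
  refine hasFDerivAt_of_norm_le (G := Q →L[ℂ] Q →L[ℂ] ℂ) hlim ?_
  filter_upwards [hcont.continuousAt.eventually (eventually_bijective hb)] with p hp
  refine ContinuousLinearMap.opNorm_le_bound₂ _ (by positivity) fun g f => ?_
  have e1 : (dtnOp ι s (b₀ + B p) - dtnOp ι s (b₀ + B p₀)
      - dtnDeriv ι s hB (b₀ + B p₀) (p - p₀)) g f = B (p - p₀) (S p₀ f) ((S p - S p₀) g) := by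
    have h1 : dtnOp ι s (b₀ + B p) g f = (b₀ + B p) (S p₀ f) (S p g) := by
      have := dtnOp_apply_map hπ hs hp (hsym p) g (S p₀ f)
      rwa [map_solOp hπ hs] at this
    have h2 : dtnOp ι s (b₀ + B p₀) g f = (b₀ + B p₀) (S p₀ f) (S p₀ g) := by
      have := dtnOp_apply_map hπ hs hb (hsym p₀) g (S p₀ f)
      rwa [map_solOp hπ hs] at this
    obtain ⟨y, hy⟩ := (hπ (S p g - S p₀ g)).1
      (by rw [map_sub, map_solOp hπ hs, map_solOp hπ hs, sub_self])
    have h3 : (b₀ + B p₀) (S p₀ f) (S p g - S p₀ g) = 0 := by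
      rw [← hy]; exact solOp_apply_eq_zero hb f y
    have h4 : B p = B p₀ + B (p - p₀) := by rw [← hB.map_add, add_sub_cancel]
    simp only [sub_apply, dtnDeriv_apply, h1, h2]
    simp only [h4, add_apply, map_sub] at h3 ⊢
    linear_combination h3
  rw [e1]
  calc _ ≤ ‖B (p - p₀)‖ * ‖S p₀ f‖ * ‖(S p - S p₀) g‖ := (B (p - p₀)).le_opNorm₂ _ _
    _ ≤ (K * ‖p - p₀‖) * (‖S p₀‖ * ‖f‖) * (‖S p - S p₀‖ * ‖g‖) := by
      gcongr
      · exact hB.norm_le _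
      · exact (S p₀).le_opNorm f
      · exact (S p - S p₀).le_opNorm g
    _ = _ := by ring

omit [CompleteSpace Y] in
-- The map `x ↦ x - P x`, with `P` the orthogonal projection onto `Y`, kills `Y` and so descends to
-- the quotient.
theorem exists_section_of_quotient {X : Type*} [NormedAddCommGroup X] [InnerProductSpace ℂ X]
    (Y : Submodule ℂ X) [CompleteSpace Y] :
    ∃ s : (X ⧸ Y) →L[ℂ] X, ∀ g, (Submodule.Quotient.mk (s g) : X ⧸ Y) = g := by
  refine ⟨Y.liftQL (ContinuousLinearMap.id ℂ X - Y.starProjection) fun y hy => by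
    simp [Submodule.starProjection_eq_self_iff.2 hy], fun g => ?_⟩
  induction g using Submodule.Quotient.induction_on with
  | H x =>
    rw [Submodule.Quotient.eq]
    change (x - Y.starProjection x) - x ∈ Y
    simp

omit [CompleteSpace Y] in
theorem fderiv_eq_of_hasFDerivAt {G : Type*} [NormedAddCommGroup G] [NormedSpace ℝ G] {f : P → G}
    {D : P →L[ℝ] G} {p : P} (h : HasFDerivAt f D p) : fderiv ℝ f p = D := h.fderiv

/-- Fréchet differentiability of a family of Dirichlet-to-Neumann operators. -/
theorem fderiv_dtn (hπ : ∀ x, π x = 0 ↔ ∃ y, ι y = x) (hs : ∀ g, π (s g) = g)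
    {B : P → X →L[ℂ] X →L[ℂ] ℂ} {K : ℝ} (hB : IsFormFamily B K) (p₀ : P)
    (hb₀ : ∀ u v, b₀ u v = b₀ v u) (hb : Function.Bijective (formRestrict ι (b₀ + B p₀)))
    (sol : P → Q → X) (Λ : P → Q →L[ℂ] Q →L[ℂ] ℂ)
    (hsol : ∀ p g, (∃ U, π U = g ∧ ∀ v, (b₀ + B p) U (ι v) = 0) →
      π (sol p g) = g ∧ ∀ v, (b₀ + B p) (sol p g) (ι v) = 0)
    (hΛ : ∀ p, (∃ A : Q →L[ℂ] Q →L[ℂ] ℂ, ∀ g V, A g (π V) = (b₀ + B p) V (sol p g)) →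
      ∀ g V, Λ p g (π V) = (b₀ + B p) V (sol p g)) :
    (∀ g U, π U = g → (∀ v, (b₀ + B p₀) U (ι v) = 0) → sol p₀ g = U) ∧
    DifferentiableAt ℝ Λ p₀ ∧
    ∀ h g f, fderiv ℝ Λ p₀ h g f = B h (sol p₀ f) (sol p₀ g) := by
  have hsym : ∀ p u v, (b₀ + B p) u v = (b₀ + B p) v u := fun p u v => by
    simp [hb₀ u v, hB.symm p u v]
  -- `sol` and `Λ` are arbitrary choices, constrained only where a solution or an operator exists.
  -- Uniqueness identifies them with `solOp` and `dtnOp` wherever the restricted form is invertible,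
  -- hence on a neighbourhood of `p₀`.
  have h1 : ∀ p, Function.Bijective (formRestrict ι (b₀ + B p)) →
      ∀ g, sol p g = solOp ι s (b₀ + B p) g := fun p hp g => by
    obtain ⟨h2, h3⟩ := hsol p g
      ⟨solOp ι s (b₀ + B p) g, map_solOp hπ hs g, solOp_apply_eq_zero hp g⟩
    exact eq_solOp hπ hs hp h2 h3
  have h2 : ∀ p, Function.Bijective (formRestrict ι (b₀ + B p)) →
      Λ p = dtnOp ι s (b₀ + B p) := fun p hp => by
    have h3 : ∀ g V, dtnOp ι s (b₀ + B p) g (π V) = (b₀ + B p) V (sol p g) := fun g V => by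
      rw [h1 p hp, dtnOp_apply_map hπ hs hp (hsym p)]
    have h4 := hΛ p ⟨_, h3⟩
    ext g f
    rw [← hs f, h4, h3]
  have hD : HasFDerivAt Λ (dtnDeriv ι s hB (b₀ + B p₀)) p₀ := by
    refine (hasFDerivAt_dtnOp hπ hs hB p₀ hb₀ hb).congr_of_eventuallyEq ?_
    filter_upwards [(continuous_form hB b₀).continuousAt.eventually (eventually_bijective hb)]
      with p hp using h2 p hp
  refine ⟨fun g U hU hU' => ?_, hD.differentiableAt, fun h g f => ?_⟩
  · rw [h1 p₀ hb, eq_solOp hπ hs hb hU hU']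
  · rw [h1 p₀ hb, h1 p₀ hb, ← dtnDeriv_apply ι s hB]
    exact congrArg (fun D : P →L[ℝ] Q →L[ℂ] Q →L[ℂ] ℂ => D h g f)
      (fderiv_eq_of_hasFDerivAt (G := Q →L[ℂ] Q →L[ℂ] ℂ) hD)

end Abstract

/-! ### Bilinear forms on `L²` and on `H¹` -/

/-- The bilinear pairing `∫ u v` on `L²(𝔻)`. -/
def pairL2 : L2 →L[ℂ] L2 →L[ℂ] ℂ := (ContinuousLinearMap.mul ℂ ℂ).lpPairing diskMeasure 2 2

theorem pairL2_apply (u v : L2) : pairL2 u v = ∫ z, u z * v z ∂diskMeasure := by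
  rw [pairL2, ContinuousLinearMap.lpPairing_eq_integral]
  rfl

/-- Multiplication of `L²` functions by `L^∞` functions. -/
def mulL2 : LInfty →L[ℂ] L2 →L[ℂ] L2 := (ContinuousLinearMap.mul ℂ ℂ).holderL diskMeasure ∞ 2 2

theorem coeFn_mulL2 (q : LInfty) (u : L2) : mulL2 q u =ᵐ[diskMeasure] fun z => q z * u z :=
  (ContinuousLinearMap.mul ℂ ℂ).coeFn_holder q u

/-- A real bounded function as a complex one. -/
def toComplex (q : LInftyReal) : LInfty := Complex.ofRealCLM.compLp q

theorem coeFn_toComplex (q : LInftyReal) : toComplex q =ᵐ[diskMeasure] fun z => ((q z : ℝ) : ℂ) :=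
  Complex.ofRealCLM.coeFn_compLp q

theorem pairL2_mulL2 (q : LInfty) (u v : L2) :
    pairL2 (mulL2 q u) v = ∫ z, q z * (u z * v z) ∂diskMeasure := by
  rw [pairL2_apply]
  refine integral_congr_ae ?_
  filter_upwards [coeFn_mulL2 q u] with z hz
  rw [hz, mul_assoc]

section Forms

variable {X : Type*} [NormedAddCommGroup X] [NormedSpace ℂ X] (c : X →L[ℂ] L2)

/-- The form `∫ (c u) (c v)`. -/
def pairForm : X →L[ℂ] X →L[ℂ] ℂ := pairL2.bilinearComp c c

theorem pairForm_apply (u v : X) : pairForm c u v = ∫ z, c u z * c v z ∂diskMeasure :=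
  pairL2_apply _ _

/-- The form `∫ q (c u) (c v)`. -/
def weightForm (q : LInftyReal) : X →L[ℂ] X →L[ℂ] ℂ :=
  (pairL2.comp (mulL2 (toComplex q))).bilinearComp c c

theorem weightForm_apply' (q : LInftyReal) (u v : X) :
    weightForm c q u v = pairL2 (mulL2 (toComplex q) (c u)) (c v) := rfl

theorem weightForm_apply (q : LInftyReal) (u v : X) :
    weightForm c q u v = ∫ z, ((q z : ℝ) : ℂ) * (c u z * c v z) ∂diskMeasure := by
  rw [weightForm_apply', pairL2_mulL2]
  refine integral_congr_ae ?_
  filter_upwards [coeFn_toComplex q] with z hz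
  rw [hz]

theorem isFormFamily_weightForm :
    IsFormFamily (weightForm c) (‖pairL2‖ * ‖mulL2‖ * ‖Complex.ofRealCLM‖ * (‖c‖ * ‖c‖)) where
  map_add p q := by
    have : toComplex (p + q) = toComplex p + toComplex q :=
      (Complex.ofRealCLM.compLpₗ ∞ diskMeasure).map_add p q
    ext u v
    rw [add_apply, add_apply]
    simp [weightForm_apply', this]
  map_smul a q u v := by
    have : toComplex (a • q) = (a : ℂ) • toComplex q := by
      rw [Complex.coe_smul]
      exact (Complex.ofRealCLM.compLpₗ ∞ diskMeasure).map_smul a q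
    rw [weightForm_apply', this, weightForm_apply']
    simp
  norm_le q := by
    refine ContinuousLinearMap.opNorm_le_bound₂ _ (by positivity) fun u v => ?_
    rw [weightForm_apply']
    have h1 : ‖toComplex q‖ ≤ ‖Complex.ofRealCLM‖ * ‖q‖ := Complex.ofRealCLM.norm_compLp_le q
    calc _ ≤ ‖pairL2‖ * ‖mulL2 (toComplex q) (c u)‖ * ‖c v‖ := pairL2.le_opNorm₂ _ _
      _ ≤ ‖pairL2‖ * (‖mulL2‖ * ‖toComplex q‖ * ‖c u‖) * ‖c v‖ := by
        gcongr; exact mulL2.le_opNorm₂ _ _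
      _ ≤ ‖pairL2‖ * (‖mulL2‖ * (‖Complex.ofRealCLM‖ * ‖q‖) * (‖c‖ * ‖u‖)) * (‖c‖ * ‖v‖) := by
        gcongr
        · exact c.le_opNorm u
        · exact c.le_opNorm v
      _ = _ := by ring
  nonneg := by positivity
  symm q u v := by
    simp_rw [weightForm_apply]
    exact integral_congr_ae (.of_forall fun z => by ring)

theorem IsFormFamily.add {P : Type*} [NormedAddCommGroup P] [NormedSpace ℝ P]
    {B B' : P → X →L[ℂ] X →L[ℂ] ℂ} {K K' : ℝ} (hB : IsFormFamily B K) (hB' : IsFormFamily B' K') :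
    IsFormFamily (fun p => B p + B' p) (K + K') where
  map_add p q := by rw [hB.map_add, hB'.map_add]; abel
  map_smul a p u v := by
    have h1 := hB.map_smul a p u v
    have h2 := hB'.map_smul a p u v
    rw [add_apply, add_apply, add_apply, add_apply, h1, h2]
    ring
  norm_le p := by
    have h1 := hB.norm_le p
    have h2 := hB'.norm_le p
    exact (norm_add_le (B p) (B' p)).trans (by linarith)
  nonneg := add_nonneg hB.nonneg hB'.nonneg
  symm p u v := by
    rw [add_apply, add_apply, add_apply, add_apply, hB.symm, hB'.symm]

end Forms

/-- The components `u`, `∂₀u`, `∂₁u` of an element of `H¹`. -/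
def h1comp (i : Fin 3) : H1 →L[ℂ] L2 := (PiLp.proj 2 (fun _ : Fin 3 => L2) i).comp H1.subtypeL

theorem h1_ext {U V : H1} (h0 : h1val U =ᵐ[diskMeasure] h1val V)
    (h1 : ∀ j, h1grad U j =ᵐ[diskMeasure] h1grad V j) : U = V := by
  refine Subtype.ext (PiLp.ext fun i => Lp.ext ?_)
  induction i using Fin.cases with
  | zero => exact h0
  | succ j => exact h1 j

theorem integrable_comp_mul (U V : H1) (i : Fin 3) :
    Integrable (fun z => h1comp i U z * h1comp i V z) diskMeasure :=
  (Lp.memLp (h1comp i U)).integrable_mul (Lp.memLp (h1comp i V))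

theorem integrable_bdd_mul_comp_mul (q : LInfty) (U V : H1) (i : Fin 3) :
    Integrable (fun z => q z * (h1comp i U z * h1comp i V z)) diskMeasure := by
  have := (Lp.memLp (mulL2 q (h1comp i U))).integrable_mul (Lp.memLp (h1comp i V))
  refine this.congr ?_
  filter_upwards [coeFn_mulL2 q (h1comp i U)] with z hz
  simp [hz, mul_assoc]

theorem gradDot_eq (U V : H1) (z : ℂ) :
    gradDot U V z = h1comp 1 U z * h1comp 1 V z + h1comp 2 U z * h1comp 2 V z := by
  rw [gradDot, Fin.sum_univ_two]; rfl

theorem integrable_gradDot (U V : H1) : Integrable (gradDot U V) diskMeasure := by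
  simp_rw [funext (gradDot_eq U V)]
  exact (integrable_comp_mul U V 1).add (integrable_comp_mul U V 2)

theorem integrable_bdd_mul_gradDot (q : LInfty) (U V : H1) :
    Integrable (fun z => q z * gradDot U V z) diskMeasure := by
  simp_rw [gradDot_eq, mul_add]
  exact (integrable_bdd_mul_comp_mul q U V 1).add (integrable_bdd_mul_comp_mul q U V 2)

theorem integrable_bdd_mul_val (q : LInfty) (U V : H1) :
    Integrable (fun z => q z * (h1val U z * h1val V z)) diskMeasure :=
  integrable_bdd_mul_comp_mul q U V 0

/-- The form `∫ γ ∇u·∇v`. -/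
def condForm (γ : LInftyReal) : H1 →L[ℂ] H1 →L[ℂ] ℂ :=
  weightForm (h1comp 1) γ + weightForm (h1comp 2) γ

/-- The form `∫ q u v`. -/
def potForm (q : LInftyReal) : H1 →L[ℂ] H1 →L[ℂ] ℂ := weightForm (h1comp 0) q

/-- The form `∫ ∇u·∇v`. -/
def dirichletForm : H1 →L[ℂ] H1 →L[ℂ] ℂ := pairForm (h1comp 1) + pairForm (h1comp 2)

theorem integral_toComplex_mul (q : LInftyReal) (F : ℂ → ℂ) :
    ∫ z, ((q z : ℝ) : ℂ) * F z ∂diskMeasure = ∫ z, toComplex q z * F z ∂diskMeasure := by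
  refine integral_congr_ae ?_
  filter_upwards [coeFn_toComplex q] with z hz
  rw [hz]

theorem condForm_apply (γ : LInftyReal) (U V : H1) :
    condForm γ U V = ∫ z, ((γ z : ℝ) : ℂ) * gradDot U V z ∂diskMeasure := by
  rw [integral_toComplex_mul]
  simp_rw [gradDot_eq, mul_add]
  rw [integral_add (integrable_bdd_mul_comp_mul _ U V 1) (integrable_bdd_mul_comp_mul _ U V 2),
    ← integral_toComplex_mul, ← integral_toComplex_mul, ← weightForm_apply, ← weightForm_apply]
  rfl

theorem potForm_apply (q : LInftyReal) (U V : H1) :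
    potForm q U V = ∫ z, ((q z : ℝ) : ℂ) * (h1val U z * h1val V z) ∂diskMeasure :=
  weightForm_apply _ q U V

theorem dirichletForm_apply (U V : H1) :
    dirichletForm U V = ∫ z, gradDot U V z ∂diskMeasure := by
  simp_rw [gradDot_eq]
  rw [integral_add (integrable_comp_mul U V 1) (integrable_comp_mul U V 2), ← pairForm_apply,
    ← pairForm_apply]
  rfl

theorem dirichletForm_symm (U V : H1) : dirichletForm U V = dirichletForm V U := by
  simp_rw [dirichletForm_apply, gradDot, mul_comm]

theorem schrForm_eq (q : LInftyReal) (U V : H1) :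
    schrForm q U V = (dirichletForm + potForm q) U V := by
  have h : Integrable (fun z => ((q z : ℝ) : ℂ) * (h1val U z * h1val V z)) diskMeasure := by
    refine (integrable_bdd_mul_val (toComplex q) U V).congr ?_
    filter_upwards [coeFn_toComplex q] with z hz
    rw [hz]
  rw [schrForm, integral_add (integrable_gradDot U V) h, ← dirichletForm_apply, ← potForm_apply]
  rfl

theorem isFormFamily_condForm : ∃ K, IsFormFamily condForm K :=
  ⟨_, (isFormFamily_weightForm (h1comp 1)).add (isFormFamily_weightForm (h1comp 2))⟩

theorem isFormFamily_potForm : ∃ K, IsFormFamily potForm K :=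
  ⟨_, isFormFamily_weightForm (h1comp 0)⟩

/-! ### Completeness and conjugation -/

/-- Each instance of the weak derivative identity is an equality of two continuous functionals of
the triple. -/
theorem isClosed_H1 : IsClosed (H1 : Set L2Triple) := by
  have h : (H1 : Set L2Triple) = ⋂ (j : Fin 2) (φ : 𝓓(disk, ℝ)), {U : L2Triple |
      pairL2 (U 0) ((memLp_disk_of_continuous (Complex.continuous_ofReal.comp
        (continuous_partialDeriv φ.contDiff j)) 2).toLp _)
      = -pairL2 (U j.succ) ((memLp_disk_of_continuous (Complex.continuous_ofReal.comp
        φ.continuous) 2).toLp _)} := by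
    ext U
    simp only [Set.mem_iInter, Set.mem_ofPred_eq]
    refine forall_congr' fun j => forall_congr' fun φ => ?_
    rw [pairL2_apply, pairL2_apply]
    refine iff_of_eq (congrArg₂ _ (integral_congr_ae ?_) (congrArg _ (integral_congr_ae ?_)))
    · filter_upwards [(memLp_disk_of_continuous (Complex.continuous_ofReal.comp
        (continuous_partialDeriv φ.contDiff j)) 2).coeFn_toLp] with z hz
      rw [hz]; rfl
    · filter_upwards [(memLp_disk_of_continuous (Complex.continuous_ofReal.comp
        φ.continuous) 2).coeFn_toLp] with z hz
      rw [hz]; rfl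
  rw [h]
  refine isClosed_iInter fun j => isClosed_iInter fun φ => isClosed_eq ?_ ?_
  · exact ((pairL2.flip _).continuous).comp (PiLp.continuous_apply 2 _ 0)
  · exact (((pairL2.flip _).continuous).comp (PiLp.continuous_apply 2 _ j.succ)).neg

instance : CompleteSpace H1 := isClosed_H1.completeSpace_coe

instance : CompleteSpace H10 :=
  (Submodule.isClosed_topologicalClosure _).completeSpace_coe

theorem coeFn_star_L2 (u : L2) : (star u : L2) =ᵐ[diskMeasure] fun z => conj (u z) := Lp.coeFn_star u

open scoped InnerProductSpace in
theorem inner_star_L2 (u v : L2) : ⟪star u, v⟫_ℂ = ⟪star v, u⟫_ℂ := by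
  rw [L2.inner_def, L2.inner_def]
  refine integral_congr_ae ?_
  filter_upwards [coeFn_star_L2 u, coeFn_star_L2 v] with z h1 h2
  rw [h1, h2]
  simp [mul_comm]

/-- The complex conjugate of an element of `H¹`. -/
def conjH1 (U : H1) : H1 := ⟨WithLp.toLp 2 fun i => star ((U : L2Triple) i), by
  intro j φ
  have h := congrArg conj (U.2 j φ)
  rw [map_neg, ← integral_conj, ← integral_conj] at h
  have e : ∀ (i : Fin 3) (F : ℂ → ℝ),
      ∫ z, (star ((U : L2Triple) i) : L2) z * ((F z : ℝ) : ℂ) ∂diskMeasure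
        = ∫ z, conj ((U : L2Triple) i z * ((F z : ℝ) : ℂ)) ∂diskMeasure := fun i F => by
    refine integral_congr_ae ?_
    filter_upwards [coeFn_star_L2 ((U : L2Triple) i)] with z hz
    rw [hz]; simp
  exact (e 0 _).trans (h.trans (congrArg Neg.neg (e j.succ _).symm))⟩

theorem h1val_conjH1 (U : H1) : h1val (conjH1 U) =ᵐ[diskMeasure] fun z => conj (h1val U z) :=
  coeFn_star_L2 _

theorem h1grad_conjH1 (U : H1) (j : Fin 2) :
    h1grad (conjH1 U) j =ᵐ[diskMeasure] fun z => conj (h1grad U j z) :=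
  coeFn_star_L2 _

theorem conjH1_conjH1 (U : H1) : conjH1 (conjH1 U) = U :=
  Subtype.ext (PiLp.ext fun i => star_star ((U : L2Triple) i))

open scoped InnerProductSpace in
theorem inner_conjH1 (U V : H1) : ⟪conjH1 U, V⟫_ℂ = ⟪conjH1 V, U⟫_ℂ := by
  rw [Submodule.coe_inner, Submodule.coe_inner, PiLp.inner_apply, PiLp.inner_apply]
  exact Finset.sum_congr rfl fun i _ => inner_star_L2 _ _

theorem continuous_conjH1 : Continuous conjH1 := by
  obtain ⟨C, hC⟩ := exists_clm_of_conjugation conjH1 conjH1_conjH1 inner_conjH1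
  exact (funext hC : ⇑C = conjH1) ▸ C.continuous

/-! ### Test functions and `H¹₀` -/

/-- `φ` is a complex test function on the disk. -/
structure IsTest (φ : ℂ → ℂ) : Prop where
  contDiff : ContDiff ℝ ∞ φ
  hasCompactSupport : HasCompactSupport φ
  tsupport_subset : tsupport φ ⊆ Metric.ball 0 1

theorem IsTest.mul_left {φ F : ℂ → ℂ} (hφ : IsTest φ) (hF : ContDiff ℝ ∞ F) :
    IsTest fun z => F z * φ z :=
  ⟨hF.mul hφ.contDiff, hφ.hasCompactSupport.mul_left,
    (tsupport_mul_subset_right).trans hφ.tsupport_subset⟩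

theorem IsTest.conj {φ : ℂ → ℂ} (hφ : IsTest φ) : IsTest fun z => conj (φ z) := by
  have h : tsupport (fun z => conj (φ z)) ⊆ tsupport φ :=
    closure_mono fun z hz => by
      simp only [Function.mem_support] at hz ⊢
      exact fun h0 => hz (by rw [h0, map_zero])
  exact ⟨contDiff_conj.comp hφ.contDiff, hφ.hasCompactSupport.comp_left (map_zero _),
    h.trans hφ.tsupport_subset⟩

theorem IsTest.add {φ ψ : ℂ → ℂ} (hφ : IsTest φ) (hψ : IsTest ψ) : IsTest fun z => φ z + ψ z :=
  ⟨hφ.contDiff.add hψ.contDiff, hφ.hasCompactSupport.add hψ.hasCompactSupport,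
    (tsupport_add φ ψ).trans (Set.union_subset hφ.tsupport_subset hψ.tsupport_subset)⟩

theorem IsTest.eq_zero {φ : ℂ → ℂ} (hφ : IsTest φ) {z : ℂ} (hz : z ∉ Metric.ball (0 : ℂ) 1) :
    φ z = 0 :=
  image_eq_zero_of_notMem_tsupport fun h => hz (hφ.tsupport_subset h)

theorem IsTest.partialDeriv {φ : ℂ → ℂ} (hφ : IsTest φ) (j : Fin 2) :
    IsTest (partialDeriv j φ) := by
  have h : tsupport (Calderon.partialDeriv j φ) ⊆ tsupport φ := by
    refine (closure_mono fun z hz => ?_).trans (tsupport_fderiv_subset ℝ)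
    simp only [Function.mem_support] at hz ⊢
    exact fun h0 => hz (by rw [Calderon.partialDeriv, h0]; rfl)
  refine ⟨?_, hφ.hasCompactSupport.mono' (subset_closure.trans h), h.trans hφ.tsupport_subset⟩
  exact (hφ.contDiff.fderiv_right (m := ∞) (by simp)).clm_apply contDiff_const

theorem IsTest.integrable {φ : ℂ → ℂ} (hφ : IsTest φ) : Integrable φ :=
  hφ.contDiff.continuous.integrable_of_hasCompactSupport hφ.hasCompactSupport

theorem IsTest.setIntegral {φ : ℂ → ℂ} (hφ : IsTest φ) :
    ∫ z, φ z ∂diskMeasure = ∫ z, φ z :=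
  setIntegral_eq_integral_of_forall_compl_eq_zero fun _ hz => hφ.eq_zero hz

theorem contDiff_partialDeriv {F : ℂ → ℂ} (hF : ContDiff ℝ ∞ F) (j : Fin 2) :
    ContDiff ℝ ∞ (partialDeriv j F) :=
  (hF.fderiv_right (m := ∞) (by simp)).clm_apply contDiff_const

theorem partialDeriv_mul {F G : ℂ → ℂ} {z : ℂ} (hF : DifferentiableAt ℝ F z)
    (hG : DifferentiableAt ℝ G z) (j : Fin 2) :
    partialDeriv j (fun z => F z * G z) z
      = F z * partialDeriv j G z + G z * partialDeriv j F z := by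
  simp [partialDeriv, fderiv_fun_mul hF hG]

theorem partialDeriv_add {F G : ℂ → ℂ} {z : ℂ} (hF : DifferentiableAt ℝ F z)
    (hG : DifferentiableAt ℝ G z) (j : Fin 2) :
    partialDeriv j (fun z => F z + G z) z = partialDeriv j F z + partialDeriv j G z := by
  simp [partialDeriv, fderiv_fun_add hF hG]

theorem partialDeriv_conj {F : ℂ → ℂ} {z : ℂ} (hF : DifferentiableAt ℝ F z) (j : Fin 2) :
    partialDeriv j (fun z => conj (F z)) z = conj (partialDeriv j F z) := by
  have : HasFDerivAt (fun z => conj (F z))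
      ((Complex.conjCLE : ℂ →L[ℝ] ℂ).comp (fderiv ℝ F z)) z :=
    (Complex.conjCLE : ℂ →L[ℝ] ℂ).hasFDerivAt.comp z hF.hasFDerivAt
  rw [partialDeriv, this.fderiv]
  rfl

theorem partialDeriv_const_mul {F : ℂ → ℂ} {z : ℂ} (hF : DifferentiableAt ℝ F z) (a : ℂ)
    (j : Fin 2) : partialDeriv j (fun z => a * F z) z = a * partialDeriv j F z := by
  simp [partialDeriv, fderiv_const_mul hF]

theorem h1val_smoothH1 (F : ℂ → ℂ) (hF : ContDiff ℝ ∞ F) : h1val (smoothH1 F hF) =ᵐ[diskMeasure] F :=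
  (memLp_disk_of_continuous hF.continuous 2).coeFn_toLp

theorem h1grad_smoothH1 (F : ℂ → ℂ) (hF : ContDiff ℝ ∞ F) (j : Fin 2) :
    h1grad (smoothH1 F hF) j =ᵐ[diskMeasure] partialDeriv j F :=
  (memLp_disk_of_continuous (continuous_partialDeriv hF j) 2).coeFn_toLp

theorem partialDeriv_congr {F G : ℂ → ℂ} (h : ∀ z ∈ Metric.ball (0 : ℂ) 1, F z = G z) {z : ℂ}
    (hz : z ∈ Metric.ball (0 : ℂ) 1) (j : Fin 2) : partialDeriv j F z = partialDeriv j G z := by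
  have : F =ᶠ[𝓝 z] G := by
    filter_upwards [Metric.isOpen_ball.mem_nhds hz] with y hy using h y hy
  rw [partialDeriv, partialDeriv, this.fderiv_eq]

theorem smoothH1_congr {F G : ℂ → ℂ} (hF : ContDiff ℝ ∞ F) (hG : ContDiff ℝ ∞ G)
    (h : ∀ z ∈ Metric.ball (0 : ℂ) 1, F z = G z) : smoothH1 F hF = smoothH1 G hG := by
  refine h1_ext ?_ fun j => ?_
  · filter_upwards [h1val_smoothH1 F hF, h1val_smoothH1 G hG, ae_restrict_mem measurableSet_ball]
      with z h1 h2 h3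
    rw [h1, h2, h z h3]
  · filter_upwards [h1grad_smoothH1 F hF j, h1grad_smoothH1 G hG j,
      ae_restrict_mem measurableSet_ball] with z h1 h2 h3
    rw [h1, h2, partialDeriv_congr h h3]

theorem h1val_add (U V : H1) : h1val (U + V) =ᵐ[diskMeasure] fun z => h1val U z + h1val V z :=
  Lp.coeFn_add (h1comp 0 U) (h1comp 0 V)

theorem h1grad_add (U V : H1) (j : Fin 2) :
    h1grad (U + V) j =ᵐ[diskMeasure] fun z => h1grad U j z + h1grad V j z :=
  Lp.coeFn_add (h1comp j.succ U) (h1comp j.succ V)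

theorem h1val_smul (a : ℂ) (U : H1) : h1val (a • U) =ᵐ[diskMeasure] fun z => a * h1val U z :=
  Lp.coeFn_smul a (h1comp 0 U)

theorem h1grad_smul (a : ℂ) (U : H1) (j : Fin 2) :
    h1grad (a • U) j =ᵐ[diskMeasure] fun z => a * h1grad U j z :=
  Lp.coeFn_smul a (h1comp j.succ U)

theorem smoothH1_add {F G : ℂ → ℂ} (hF : ContDiff ℝ ∞ F) (hG : ContDiff ℝ ∞ G) :
    smoothH1 (fun z => F z + G z) (hF.add hG) = smoothH1 F hF + smoothH1 G hG := by
  refine h1_ext ?_ fun j => ?_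
  · filter_upwards [h1val_smoothH1 F hF, h1val_smoothH1 G hG, h1val_smoothH1 _ (hF.add hG),
      h1val_add (smoothH1 F hF) (smoothH1 G hG)] with z h1 h2 h3 h4
    rw [h3, h4, h1, h2]
  · filter_upwards [h1grad_smoothH1 F hF j, h1grad_smoothH1 G hG j, h1grad_smoothH1 _ (hF.add hG) j,
      h1grad_add (smoothH1 F hF) (smoothH1 G hG) j] with z h1 h2 h3 h4
    rw [h3, h4, h1, h2, partialDeriv_add (hF.differentiable (by simp) z)
      (hG.differentiable (by simp) z)]

theorem smoothH1_const_mul {F : ℂ → ℂ} (hF : ContDiff ℝ ∞ F) (a : ℂ) :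
    smoothH1 (fun z => a * F z) (contDiff_const.mul hF) = a • smoothH1 F hF := by
  refine h1_ext ?_ fun j => ?_
  · filter_upwards [h1val_smoothH1 F hF, h1val_smoothH1 _ (contDiff_const.mul hF),
      h1val_smul a (smoothH1 F hF)] with z h1 h2 h3
    rw [h2, h3, h1]
  · filter_upwards [h1grad_smoothH1 F hF j, h1grad_smoothH1 _ (contDiff_const.mul hF) j,
      h1grad_smul a (smoothH1 F hF) j] with z h1 h2 h3
    rw [h2, h3, h1, partialDeriv_const_mul (hF.differentiable (by simp) z)]

theorem conjH1_smoothH1 {F : ℂ → ℂ} (hF : ContDiff ℝ ∞ F) :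
    conjH1 (smoothH1 F hF) = smoothH1 (fun z => conj (F z)) (contDiff_conj.comp hF) := by
  refine h1_ext ?_ fun j => ?_
  · filter_upwards [h1val_smoothH1 F hF, h1val_smoothH1 _ (contDiff_conj.comp hF),
      h1val_conjH1 (smoothH1 F hF)] with z h1 h2 h3
    rw [h3, h1]; exact h2.symm
  · filter_upwards [h1grad_smoothH1 F hF j, h1grad_smoothH1 _ (contDiff_conj.comp hF) j,
      h1grad_conjH1 (smoothH1 F hF) j] with z h1 h2 h3
    rw [h3, h1, ← partialDeriv_conj (hF.differentiable (by simp) z) j]; exact h2.symm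

/-- The span of the test functions. -/
def testSpan : Submodule ℂ H1 :=
  Submodule.span ℂ (Set.range fun φ : 𝓓(disk, ℂ) => smoothH1 φ φ.contDiff)

theorem smoothH1_mem_testSpan {φ : ℂ → ℂ} (hφ : IsTest φ) : smoothH1 φ hφ.contDiff ∈ testSpan :=
  Submodule.subset_span ⟨{
    toFun := φ
    contDiff' := hφ.contDiff
    hasCompactSupport' := hφ.hasCompactSupport
    tsupport_subset' := hφ.tsupport_subset }, rfl⟩

/-- Test functions already form a subspace, so the span adds nothing and density arguments need only
single test functions. -/
theorem exists_isTest_of_mem_testSpan {V : H1} (hV : V ∈ testSpan) :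
    ∃ (φ : ℂ → ℂ) (hφ : IsTest φ), V = smoothH1 φ hφ.contDiff := by
  have h0 : IsTest fun _ => (0 : ℂ) :=
    ⟨contDiff_const, HasCompactSupport.zero, by simp [tsupport]⟩
  induction hV using Submodule.span_induction with
  | mem V hV =>
    obtain ⟨φ, rfl⟩ := hV
    exact ⟨φ, ⟨φ.contDiff, φ.hasCompactSupport, φ.tsupport_subset⟩, rfl⟩
  | zero =>
    refine ⟨_, h0, ?_⟩
    have := smoothH1_const_mul h0.contDiff 0
    rw [zero_smul] at this
    rw [← this]
    exact smoothH1_congr _ _ fun z _ => by simp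
  | add U V _ _ hU hV =>
    obtain ⟨φ, hφ, rfl⟩ := hU
    obtain ⟨ψ, hψ, rfl⟩ := hV
    exact ⟨_, hφ.add hψ, (smoothH1_add hφ.contDiff hψ.contDiff).symm⟩
  | smul a U _ hU =>
    obtain ⟨φ, hφ, rfl⟩ := hU
    exact ⟨_, hφ.mul_left contDiff_const, (smoothH1_const_mul hφ.contDiff a).symm⟩

theorem testSpan_le : testSpan ≤ H10 := Submodule.le_topologicalClosure _

theorem coe_H10 : (H10 : Set H1) = closure testSpan := Submodule.topologicalClosure_coe _

/-- A closed property that holds for test functions holds on `H¹₀`. -/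
theorem H10_induction {p : H1 → Prop} (hp : IsClosed {V | p V})
    (h : ∀ (φ : ℂ → ℂ) (hφ : IsTest φ), p (smoothH1 φ hφ.contDiff)) {V : H1} (hV : V ∈ H10) :
    p V := by
  have h1 : V ∈ closure (testSpan : Set H1) := coe_H10 ▸ hV
  refine closure_minimal (fun U hU => ?_) hp h1
  obtain ⟨φ, hφ, rfl⟩ := exists_isTest_of_mem_testSpan hU
  exact h φ hφ

/-- Coercivity of a bilinear form is tested on the pair `V`, `conjH1 V`, which must stay inside
`H10`. -/
theorem conjH1_mem_H10 {V : H1} (hV : V ∈ H10) : conjH1 V ∈ H10 := by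
  refine H10_induction (p := fun V => conjH1 V ∈ H10)
    ((Submodule.isClosed_topologicalClosure _).preimage continuous_conjH1) (fun φ hφ => ?_) hV
  rw [conjH1_smoothH1]
  exact testSpan_le (smoothH1_mem_testSpan hφ.conj)

/-! ### Integration by parts and the Poincaré inequality -/

theorem integral_mul_partialDeriv {F φ : ℂ → ℂ} (hF : ContDiff ℝ ∞ F) (hφ : IsTest φ)
    (j : Fin 2) : ∫ z, F z * partialDeriv j φ z = -∫ z, partialDeriv j F z * φ z :=
  integral_mul_fderiv_eq_neg_fderiv_mul_of_integrable
    (hφ.mul_left (contDiff_partialDeriv hF j)).integrable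
    ((hφ.partialDeriv j).mul_left hF).integrable (hφ.mul_left hF).integrable
    (fun z _ => hF.differentiable (by simp) z) (fun z _ => hφ.contDiff.differentiable (by simp) z)

/-- Integrating `x ∂₀|φ|²` by parts, with `x = z.re`, gives `∫|φ|² = -∫ x ∂₀|φ|²`, and `|x| ≤ 1` on
the disk. -/
theorem integral_norm_sq_le {φ : ℂ → ℂ} (hφ : IsTest φ) :
    ∫ z, ‖φ z‖ ^ 2 ∂diskMeasure ≤ 4 * ∫ z, ‖partialDeriv 0 φ z‖ ^ 2 ∂diskMeasure := by
  have hre : ContDiff ℝ ∞ fun z : ℂ => (z.re : ℂ) :=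
    (Complex.ofRealCLM.comp Complex.reCLM).contDiff
  have hre' : ∀ z, partialDeriv 0 (fun z : ℂ => (z.re : ℂ)) z = 1 := fun z => by
    have : HasFDerivAt (fun z : ℂ => (z.re : ℂ)) (Complex.ofRealCLM.comp Complex.reCLM) z :=
      (Complex.ofRealCLM.comp Complex.reCLM).hasFDerivAt
    rw [partialDeriv, this.fderiv]
    simp [coordDir]
  have hG := hφ.mul_left (contDiff_conj.comp hφ.contDiff)
  have hφd : Differentiable ℝ φ := hφ.contDiff.differentiable (by simp)
  have hφd' : Differentiable ℝ fun z => conj (φ z) := hφ.conj.contDiff.differentiable (by simp)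
  have hcφ : ∀ {p : ℝ≥0∞}, MemLp φ p diskMeasure := memLp_disk_of_continuous hφ.contDiff.continuous _
  have hcφ' : ∀ {p : ℝ≥0∞}, MemLp (partialDeriv 0 φ) p diskMeasure :=
    memLp_disk_of_continuous (hφ.partialDeriv 0).contDiff.continuous _
  have i1 : Integrable (fun z => ‖φ z‖ ^ 2) diskMeasure := hcφ.integrable_norm_pow (p := 2) (by simp)
  have i2 : Integrable (fun z => ‖partialDeriv 0 φ z‖ ^ 2) diskMeasure :=
    hcφ'.integrable_norm_pow (p := 2) (by simp)
  have key := integral_mul_partialDeriv hre hG 0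
  rw [← ((hG.partialDeriv 0).mul_left hre).setIntegral,
    ← (hG.mul_left (contDiff_partialDeriv hre 0)).setIntegral] at key
  have e1 : ∫ z, partialDeriv 0 (fun z : ℂ => (z.re : ℂ)) z
      * ((fun z => conj z) ∘ φ) z * φ z ∂diskMeasure
      = ((∫ z, ‖φ z‖ ^ 2 ∂diskMeasure : ℝ) : ℂ) := by
    rw [← integral_complex_ofReal]
    refine integral_congr_ae (.of_forall fun z => ?_)
    simp only [Function.comp, hre', one_mul]
    rw [← Complex.normSq_eq_conj_mul_self, Complex.normSq_eq_norm_sq]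
  have e2 : ‖∫ z, (z.re : ℂ) * partialDeriv 0 (fun z => ((fun z => conj z) ∘ φ) z * φ z) z
      ∂diskMeasure‖ ≤ ∫ z, (2⁻¹ * ‖φ z‖ ^ 2 + 2 * ‖partialDeriv 0 φ z‖ ^ 2) ∂diskMeasure := by
    refine norm_integral_le_of_norm_le ((i1.const_mul _).add (i2.const_mul _)) ?_
    filter_upwards [ae_restrict_mem measurableSet_ball] with z hz
    have hz1 : ‖(z.re : ℂ)‖ ≤ 1 := by
      rw [Complex.norm_real]
      exact (Complex.abs_re_le_norm z).trans (by simpa using (Metric.mem_ball.1 hz).le)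
    have h2 : partialDeriv 0 (fun z => ((fun z => conj z) ∘ φ) z * φ z) z
        = conj (φ z) * partialDeriv 0 φ z + φ z * conj (partialDeriv 0 φ z) := by
      rw [← partialDeriv_conj (hφd z)]
      exact partialDeriv_mul (hφd' z) (hφd z) 0
    rw [norm_mul, h2]
    have h3 : ‖conj (φ z) * partialDeriv 0 φ z + φ z * conj (partialDeriv 0 φ z)‖
        ≤ 2 * (‖φ z‖ * ‖partialDeriv 0 φ z‖) := by
      refine (norm_add_le _ _).trans ?_
      rw [norm_mul, norm_mul, RCLike.norm_conj, RCLike.norm_conj]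
      linarith
    have h4 := mul_le_mul hz1 h3 (norm_nonneg _) zero_le_one
    -- Young's inequality `2ab ≤ a²/2 + 2b²`, weighted so that half of `∫|φ|²` can be absorbed on
    -- the left; this yields the constant `4`.
    nlinarith [sq_nonneg (‖φ z‖ - 2 * ‖partialDeriv 0 φ z‖)]
  rw [integral_add (i1.const_mul _) (i2.const_mul _), integral_const_mul, integral_const_mul] at e2
  have e3 : ‖((∫ z, ‖φ z‖ ^ 2 ∂diskMeasure : ℝ) : ℂ)‖ = ∫ z, ‖φ z‖ ^ 2 ∂diskMeasure := by
    rw [Complex.norm_real, Real.norm_of_nonneg (integral_nonneg fun z => by positivity)]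
  simp only [mul_assoc] at key e1
  rw [key, norm_neg, e1, e3] at e2
  linarith

theorem norm_sq_L2 (u : L2) : ‖u‖ ^ 2 = ∫ z, ‖u z‖ ^ 2 ∂diskMeasure := by
  have h : (inner ℂ u u : ℂ) = ((∫ z, ‖u z‖ ^ 2 ∂diskMeasure : ℝ) : ℂ) := by
    rw [L2.inner_def, ← integral_complex_ofReal]
    refine integral_congr_ae (.of_forall fun z => ?_)
    simp [inner_self_eq_norm_sq_to_K]
  rw [inner_self_eq_norm_sq_to_K] at h
  refine Complex.ofReal_injective (Eq.trans ?_ h)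
  push_cast
  rfl

theorem norm_sq_h1comp_smoothH1 {F : ℂ → ℂ} (hF : ContDiff ℝ ∞ F) :
    ‖h1comp 0 (smoothH1 F hF)‖ ^ 2 = ∫ z, ‖F z‖ ^ 2 ∂diskMeasure ∧
    ∀ j : Fin 2, ‖h1comp j.succ (smoothH1 F hF)‖ ^ 2
      = ∫ z, ‖partialDeriv j F z‖ ^ 2 ∂diskMeasure := by
  constructor
  · rw [norm_sq_L2]
    refine integral_congr_ae ?_
    filter_upwards [h1val_smoothH1 F hF] with z hz
    rw [← hz]; rfl
  · intro j
    rw [norm_sq_L2]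
    refine integral_congr_ae ?_
    filter_upwards [h1grad_smoothH1 F hF j] with z hz
    rw [← hz]; rfl

theorem norm_sq_h1 (V : H1) :
    ‖V‖ ^ 2 = ‖h1comp 0 V‖ ^ 2 + (‖h1comp 1 V‖ ^ 2 + ‖h1comp 2 V‖ ^ 2) := by
  rw [Submodule.coe_norm, PiLp.norm_sq_eq_of_L2, Fin.sum_univ_three, add_assoc]
  rfl

theorem poincare {V : H1} (hV : V ∈ H10) : ‖h1comp 0 V‖ ^ 2 ≤ 4 * ‖h1comp 1 V‖ ^ 2 := by
  refine H10_induction (p := fun V => ‖h1comp 0 V‖ ^ 2 ≤ 4 * ‖h1comp 1 V‖ ^ 2)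
    (isClosed_le ?_ ?_) (fun φ hφ => ?_) hV
  · exact ((h1comp 0).continuous.norm).pow 2
  · exact continuous_const.mul (((h1comp 1).continuous.norm).pow 2)
  · obtain ⟨h0, h1⟩ := norm_sq_h1comp_smoothH1 hφ.contDiff
    rw [h0]
    exact (integral_norm_sq_le hφ).trans_eq (congrArg _ (h1 0).symm)

/-- The constant is `4` from the Poincaré inequality plus `1` for the gradient itself. -/
theorem norm_sq_h1_le {V : H1} (hV : V ∈ H10) :
    ‖V‖ ^ 2 ≤ 5 * (‖h1comp 1 V‖ ^ 2 + ‖h1comp 2 V‖ ^ 2) := by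
  have := poincare hV
  rw [norm_sq_h1]
  nlinarith [sq_nonneg ‖h1comp 2 V‖]

instance : NormedAddCommGroup H10 := Submodule.normedAddCommGroup H10

instance : InnerProductSpace ℂ H10 := Submodule.innerProductSpace H10

open scoped InnerProductSpace in
theorem bijective_formRestrict {b : H1 →L[ℂ] H1 →L[ℂ] ℂ} {c : ℝ} (hc : 0 < c)
    (h : ∀ V ∈ H10, c * ‖V‖ ^ 2 ≤ ‖b V (conjH1 V)‖) :
    Function.Bijective (formRestrict (H10.subtypeL : H10 →L[ℂ] H1) b) :=
  bijective_of_coercive (H := H10) (formRestrict (H10.subtypeL : H10 →L[ℂ] H1) b)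
    (fun V => ⟨conjH1 V, conjH1_mem_H10 V.2⟩) (fun V => Subtype.ext (conjH1_conjH1 V))
    (fun U V => inner_conjH1 U V) hc fun V => h V V.2

theorem dirichletForm_conj (V : H1) :
    dirichletForm V (conjH1 V) = ((‖h1comp 1 V‖ ^ 2 + ‖h1comp 2 V‖ ^ 2 : ℝ) : ℂ) := by
  have h : ∀ i, pairForm (h1comp i) V (conjH1 V) = ((‖h1comp i V‖ ^ 2 : ℝ) : ℂ) := fun i => by
    rw [pairForm_apply, norm_sq_L2, ← integral_complex_ofReal]
    refine integral_congr_ae ?_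
    filter_upwards [coeFn_star_L2 (h1comp i V)] with z hz
    change h1comp i V z * (star (h1comp i V) : L2) z = _
    rw [hz, Complex.mul_conj, Complex.normSq_eq_norm_sq]
  rw [Complex.ofReal_add, ← h, ← h]
  rfl

theorem potForm_constPot_conj (c : ℝ) (V : H1) :
    potForm (constPot c) V (conjH1 V) = ((c * ‖h1comp 0 V‖ ^ 2 : ℝ) : ℂ) := by
  rw [potForm_apply, norm_sq_L2, ← integral_const_mul, ← integral_complex_ofReal]
  refine integral_congr_ae ?_
  filter_upwards [h1val_conjH1 V, Lp.coeFn_const (p := ∞) (μ := diskMeasure) c] with z h1 h2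
  have h2' : constPot c z = c := h2
  rw [h1, h2', Complex.mul_conj, Complex.normSq_eq_norm_sq]
  push_cast
  rfl

theorem le_condForm_conj {γ : LInftyReal} {c : ℝ} (hγ : ∀ᵐ z ∂diskMeasure, c ≤ γ z) (V : H1) :
    c * (‖h1comp 1 V‖ ^ 2 + ‖h1comp 2 V‖ ^ 2) ≤ (condForm γ V (conjH1 V)).re := by
  have h : ∀ i, c * ‖h1comp i V‖ ^ 2 ≤ (weightForm (h1comp i) γ V (conjH1 V)).re := fun i => by
    have e1 : (fun z => ((γ z : ℝ) : ℂ) * (h1comp i V z * h1comp i (conjH1 V) z))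
        =ᵐ[diskMeasure] fun z => ((γ z * ‖h1comp i V z‖ ^ 2 : ℝ) : ℂ) := by
      filter_upwards [coeFn_star_L2 (h1comp i V)] with z hz
      change _ * (h1comp i V z * (star (h1comp i V) : L2) z) = _
      rw [hz, Complex.mul_conj, Complex.normSq_eq_norm_sq]
      push_cast
      rfl
    have e2 : Integrable (fun z => ((γ z * ‖h1comp i V z‖ ^ 2 : ℝ) : ℂ)) diskMeasure := by
      refine ((integrable_bdd_mul_comp_mul (toComplex γ) V (conjH1 V) i).congr ?_).congr e1
      filter_upwards [coeFn_toComplex γ] with z hz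
      rw [hz]
    have e3 : Integrable (fun z => γ z * ‖h1comp i V z‖ ^ 2) diskMeasure := by
      exact e2.re
    rw [weightForm_apply, integral_congr_ae e1, integral_complex_ofReal, norm_sq_L2, ← integral_const_mul]
    refine integral_mono_ae (((Lp.memLp (h1comp i V)).integrable_norm_pow (p := 2)
      (by simp)).const_mul c) e3 ?_
    filter_upwards [hγ] with z hz
    exact mul_le_mul_of_nonneg_right hz (by positivity)
  have h1 := h 1
  have h2 := h 2
  have : condForm γ V (conjH1 V) = weightForm (h1comp 1) γ V (conjH1 V)
    + weightForm (h1comp 2) γ V (conjH1 V) := rfl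
  rw [this, Complex.add_re]
  linarith

/-! ### Smooth functions vanishing on the unit circle -/

/-- The real coordinates on the plane. -/
def coord (j : Fin 2) (z : ℂ) : ℝ := if j = 0 then z.re else z.im

theorem partialDeriv_radial {g : ℝ → ℝ} {g' : ℝ} {z : ℂ} (hg : HasDerivAt g g' (Complex.normSq z))
    (j : Fin 2) : partialDeriv j (fun z => ((g (Complex.normSq z) : ℝ) : ℂ)) z
      = ((2 * coord j z * g' : ℝ) : ℂ) := by
  have h1 : HasFDerivAt (fun z : ℂ => Complex.normSq z)
      ((z.re • Complex.reCLM + z.re • Complex.reCLM)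
        + (z.im • Complex.imCLM + z.im • Complex.imCLM)) z :=
    (Complex.reCLM.hasFDerivAt.mul Complex.reCLM.hasFDerivAt).add
      (Complex.imCLM.hasFDerivAt.mul Complex.imCLM.hasFDerivAt)
  have h2 := Complex.ofRealCLM.hasFDerivAt.comp z (hg.comp_hasFDerivAt z h1)
  have h3 : partialDeriv j (fun z => ((g (Complex.normSq z) : ℝ) : ℂ)) z = _ :=
    congrArg (fun L : ℂ →L[ℝ] ℂ => L (coordDir j)) h2.fderiv
  rw [h3]
  fin_cases j <;> simp [coordDir, coord] <;> ring

theorem contDiff_normSq : ContDiff ℝ ∞ fun z : ℂ => Complex.normSq z :=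
  (Complex.reCLM.contDiff.mul Complex.reCLM.contDiff).add
    (Complex.imCLM.contDiff.mul Complex.imCLM.contDiff)

theorem contDiff_radial {g : ℝ → ℝ} (hg : ContDiff ℝ ∞ g) :
    ContDiff ℝ ∞ fun z : ℂ => ((g (Complex.normSq z) : ℝ) : ℂ) :=
  Complex.ofRealCLM.contDiff.comp (hg.comp contDiff_normSq)

theorem abs_coord_le (j : Fin 2) (z : ℂ) : |coord j z| ≤ ‖z‖ := by
  rw [coord]
  split_ifs
  · exact Complex.abs_re_le_norm z
  · exact Complex.abs_im_le_norm z

/-- The cutoff profile, `1` for `t ≤ 1 - 2 / n` and `0` for `t ≥ 1 - 1 / n`. -/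
def cutoff (n t : ℝ) : ℝ := Real.smoothTransition (n * (1 - t) - 1)

theorem contDiff_cutoff (n : ℝ) : ContDiff ℝ ∞ (cutoff n) :=
  Real.smoothTransition.contDiff.comp (by fun_prop)

theorem cutoff_eq_one {n t : ℝ} (h : 2 ≤ n * (1 - t)) : cutoff n t = 1 :=
  Real.smoothTransition.one_of_one_le (by linarith)

theorem cutoff_eq_zero {n t : ℝ} (h : n * (1 - t) ≤ 1) : cutoff n t = 0 :=
  Real.smoothTransition.zero_of_nonpos (by linarith)

/-- On the stated range the argument of the fixed transition function stays in `[-1, 1]`, so one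
bound on its derivative serves all `n`, and the chain rule contributes the factor `n`. -/
theorem exists_abs_deriv_cutoff_le : ∃ C, 0 ≤ C ∧ ∀ n t : ℝ, 0 ≤ n → t ≤ 1 → n * (1 - t) ≤ 2 →
    |deriv (cutoff n) t| ≤ C * n := by
  have hs : ContDiff ℝ ∞ Real.smoothTransition := Real.smoothTransition.contDiff
  obtain ⟨C, hC⟩ := (isCompact_Icc (a := (-1 : ℝ)) (b := 1)).exists_bound_of_continuousOn
    (hs.continuous_deriv (by simp)).continuousOn
  refine ⟨C, (norm_nonneg _).trans (hC 0 (by norm_num)), fun n t hn ht h => ?_⟩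
  have h1 : HasDerivAt (cutoff n) (deriv Real.smoothTransition (n * (1 - t) - 1) * -n) t := by
    have h2 : HasDerivAt (fun t : ℝ => n * (1 - t) - 1) (-n) t := by
      simpa using (((hasDerivAt_id t).const_sub 1).const_mul n).sub_const 1
    exact ((hs.differentiable (by simp)) _).hasDerivAt.comp t h2
  rw [h1.deriv, abs_mul, abs_neg, abs_of_nonneg hn]
  refine mul_le_mul_of_nonneg_right (hC _ ⟨?_, by linarith⟩) hn
  nlinarith [mul_nonneg hn (sub_nonneg.2 ht)]

/-- Compare `z` with its radial projection to the circle, at distance `1 - ‖z‖`, using the Lipschitz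
bound on the closed disk. -/
theorem exists_norm_le_of_eq_zero_on_circle {F : ℂ → ℂ} (hF : ContDiff ℝ ∞ F)
    (h : ∀ z, ‖z‖ = 1 → F z = 0) : ∃ L, 0 ≤ L ∧ ∀ z, ‖z‖ ≤ 1 → ‖F z‖ ≤ L * (1 - ‖z‖) := by
  obtain ⟨L, hL⟩ := (isCompact_closedBall (0 : ℂ) 1).exists_bound_of_continuousOn
    (hF.continuous_fderiv (by simp)).continuousOn
  have hlip : ∀ z w : ℂ, ‖z‖ ≤ 1 → ‖w‖ ≤ 1 → ‖F z - F w‖ ≤ L * ‖z - w‖ := fun z w hz hw =>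
    (convex_closedBall (0 : ℂ) 1).norm_image_sub_le_of_norm_fderiv_le
      (fun x _ => hF.differentiable (by simp) x) hL (by simpa using hw) (by simpa using hz)
  refine ⟨L, (norm_nonneg _).trans (hL 0 (by simp)), fun z hz => ?_⟩
  -- The origin has no radial projection; the point `1` of the circle replaces it.
  rcases eq_or_ne z 0 with rfl | hz0
  · have := hlip 0 1 (by simp) (by simp)
    rw [h 1 (by simp)] at this
    simpa using this
  · have hz1 : ‖z‖ ≠ 0 := norm_ne_zero_iff.2 hz0
    have hw : ‖((‖z‖⁻¹ : ℝ) : ℂ) * z‖ = 1 := by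
      rw [norm_mul, Complex.norm_real, norm_inv, norm_norm, inv_mul_cancel₀ hz1]
    have h1 := hlip z (((‖z‖⁻¹ : ℝ) : ℂ) * z) hz hw.le
    have h2 : z - ((‖z‖⁻¹ : ℝ) : ℂ) * z = ((1 - ‖z‖⁻¹ : ℝ) : ℂ) * z := by push_cast; ring
    have h3 : (1 : ℝ) ≤ ‖z‖⁻¹ := (one_le_inv₀ (by positivity)).2 hz
    rw [h _ hw, sub_zero, h2, norm_mul, Complex.norm_real, Real.norm_of_nonpos (by linarith)] at h1
    have h4 : -(1 - ‖z‖⁻¹) * ‖z‖ = 1 - ‖z‖ := by field_simp; ring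
    rwa [h4] at h1

theorem isTest_cutoff_mul {F : ℂ → ℂ} (hF : ContDiff ℝ ∞ F) {n : ℝ} (hn : 0 < n) :
    IsTest fun z => F z * ((cutoff n (Complex.normSq z) : ℝ) : ℂ) := by
  have hsub : tsupport (fun z => F z * ((cutoff n (Complex.normSq z) : ℝ) : ℂ))
      ⊆ {z | 1 ≤ n * (1 - Complex.normSq z)} := by
    refine closure_minimal (fun z hz => ?_) (isClosed_le continuous_const
      (continuous_const.mul (continuous_const.sub contDiff_normSq.continuous)))
    by_contra h
    exact hz (by simp only [cutoff_eq_zero (not_le.1 h).le, Complex.ofReal_zero, mul_zero])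
  have hball : tsupport (fun z => F z * ((cutoff n (Complex.normSq z) : ℝ) : ℂ))
      ⊆ Metric.ball 0 1 := fun z hz => by
    have h1 : 1 ≤ n * (1 - Complex.normSq z) := hsub hz
    have h2 : Complex.normSq z < 1 := by nlinarith
    rw [Complex.normSq_eq_norm_sq] at h2
    rw [mem_ball_zero_iff]
    nlinarith [norm_nonneg z]
  exact ⟨hF.mul (contDiff_radial (contDiff_cutoff n)),
    Metric.isCompact_of_isClosed_isBounded (isClosed_tsupport _) (Metric.isBounded_ball.subset hball),
    hball⟩

/-- A smooth function on the plane vanishing on the unit circle restricts to an element of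
`H¹₀(𝔻)`. -/
theorem smoothH1_mem_H10 {F : ℂ → ℂ} (hF : ContDiff ℝ ∞ F) (h : ∀ z, ‖z‖ = 1 → F z = 0) :
    smoothH1 F hF ∈ H10 := by
  have hn : ∀ n : ℕ, (0 : ℝ) < (n : ℝ) + 1 := fun n => by positivity
  let η : ℕ → ℂ → ℂ := fun n z => ((cutoff ((n : ℝ) + 1) (Complex.normSq z) : ℝ) : ℂ)
  have hη : ∀ n, ContDiff ℝ ∞ (η n) := fun n => contDiff_radial (contDiff_cutoff _)
  -- The remainder after cutting off. It vanishes near each point of the disk for large `n`, so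
  -- dominated convergence gives `G n → 0` in `H1` once `G n` and its gradient are bounded uniformly
  -- in `n`.
  let G : ℕ → ℂ → ℂ := fun n z => F z * (1 - η n z)
  have hG : ∀ n, ContDiff ℝ ∞ (G n) := fun n => hF.mul (contDiff_const.sub (hη n))
  have hsplit : ∀ n, smoothH1 F hF = smoothH1 _ (isTest_cutoff_mul hF (hn n)).contDiff
      + smoothH1 (G n) (hG n) := fun n => by
    rw [← smoothH1_add]
    exact smoothH1_congr _ _ fun z _ => by simp only [G, η]; ring
  have hdG : ∀ n j z, partialDeriv j (G n) z
      = (1 - η n z) * partialDeriv j F z - F z * partialDeriv j (η n) z := fun n j z => by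
    have h1 : partialDeriv j (fun z => 1 - η n z) z = -partialDeriv j (η n) z := by
      simp [partialDeriv, fderiv_const_sub]
    have h2 := partialDeriv_mul (hF.differentiable (by simp) z)
      ((contDiff_const.sub (hη n)).differentiable (by simp) z) j (G := fun z => 1 - η n z)
    rw [h1] at h2
    exact h2.trans (by ring)
  have hfar : ∀ (n : ℕ) z, 2 < ((n : ℝ) + 1) * (1 - Complex.normSq z) → G n =ᶠ[𝓝 z] fun _ => 0 := by
    intro n z hz
    have hc : Continuous fun z : ℂ => ((n : ℝ) + 1) * (1 - Complex.normSq z) :=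
      continuous_const.mul (continuous_const.sub contDiff_normSq.continuous)
    filter_upwards [hc.continuousAt.eventually (lt_mem_nhds hz)] with y hy
    simp only [G, η]
    rw [cutoff_eq_one hy.le]
    simp
  have hη1 : ∀ n z, ‖1 - η n z‖ ≤ 1 := fun n z => by
    have h1 := Real.smoothTransition.nonneg (((n : ℝ) + 1) * (1 - Complex.normSq z) - 1)
    have h2 := Real.smoothTransition.le_one (((n : ℝ) + 1) * (1 - Complex.normSq z) - 1)
    have h3 : 1 - η n z = ((1 - cutoff ((n : ℝ) + 1) (Complex.normSq z) : ℝ) : ℂ) := by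
      simp only [η]; push_cast; rfl
    rw [h3, Complex.norm_real, Real.norm_eq_abs, abs_le]
    constructor <;> simp only [cutoff] <;> linarith
  have hev : ∀ z ∈ Metric.ball (0 : ℂ) 1, ∀ᶠ n : ℕ in atTop,
      2 < ((n : ℝ) + 1) * (1 - Complex.normSq z) := fun z hz => by
    have h1 : 0 < 1 - Complex.normSq z := by
      rw [Complex.normSq_eq_norm_sq]
      nlinarith [norm_nonneg z, mem_ball_zero_iff.1 hz]
    have h2 : Tendsto (fun n : ℕ => ((n : ℝ) + 1) * (1 - Complex.normSq z)) atTop atTop :=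
      (tendsto_atTop_add_const_right _ _ tendsto_natCast_atTop_atTop).atTop_mul_const h1
    exact h2.eventually_gt_atTop 2
  obtain ⟨C, hC0, hC⟩ := exists_abs_deriv_cutoff_le
  obtain ⟨L, hL0, hL⟩ := exists_norm_le_of_eq_zero_on_circle hF h
  obtain ⟨M, hM⟩ := (isCompact_closedBall (0 : ℂ) 1).exists_bound_of_continuousOn
    hF.continuous.continuousOn
  have hlim0 : Tendsto (fun n => ∫ z, ‖G n z‖ ^ 2 ∂diskMeasure) atTop (𝓝 0) := by
    have : Tendsto (fun n => ∫ z, ‖G n z‖ ^ 2 ∂diskMeasure) atTop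
        (𝓝 (∫ z, (0 : ℝ) ∂diskMeasure)) := by
      refine tendsto_integral_of_dominated_convergence (fun _ => M ^ 2)
        (fun n => ((hG n).continuous.norm.pow 2).aestronglyMeasurable) (integrable_const _)
        (fun n => ?_) ?_
      · filter_upwards [ae_restrict_mem measurableSet_ball] with z hz
        rw [norm_pow, norm_norm, norm_mul]
        have h1 := hM z (Metric.ball_subset_closedBall hz)
        have h2 := mul_le_mul h1 (hη1 n z) (norm_nonneg _) ((norm_nonneg _).trans h1)
        rw [mul_one] at h2
        gcongr
      · filter_upwards [ae_restrict_mem measurableSet_ball] with z hz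
        refine tendsto_const_nhds.congr' ?_
        filter_upwards [hev z hz] with n hn
        rw [(hfar n z hn).eq_of_nhds]; simp
    simpa using this
  have hlim1 : ∀ j, Tendsto (fun n => ∫ z, ‖partialDeriv j (G n) z‖ ^ 2 ∂diskMeasure) atTop
      (𝓝 0) := fun j => by
    obtain ⟨M', hM'⟩ := (isCompact_closedBall (0 : ℂ) 1).exists_bound_of_continuousOn
      (continuous_partialDeriv hF j).continuousOn
    have hM'0 : 0 ≤ M' := (norm_nonneg _).trans (hM' 0 (by simp))
    have : Tendsto (fun n => ∫ z, ‖partialDeriv j (G n) z‖ ^ 2 ∂diskMeasure) atTop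
        (𝓝 (∫ z, (0 : ℝ) ∂diskMeasure)) := by
      refine tendsto_integral_of_dominated_convergence (fun _ => (M' + 4 * L * C) ^ 2)
        (fun n => ((continuous_partialDeriv (hG n) j).norm.pow 2).aestronglyMeasurable)
        (integrable_const _) (fun n => ?_) ?_
      · filter_upwards [ae_restrict_mem measurableSet_ball] with z hz
        have hz1 : ‖z‖ < 1 := mem_ball_zero_iff.1 hz
        rw [norm_pow, norm_norm]
        refine pow_le_pow_left₀ (norm_nonneg _) ?_ 2
        -- Away from the boundary layer the remainder is locally zero. In the layer, the factor `n +
        -- 1` from the derivative of the cutoff is absorbed by `‖F z‖ ≤ L (1 - |z|²)`, because `(n +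
        -- 1)(1 - |z|²) ≤ 2`; this leaves the bound `4 L C`.
        rcases lt_or_ge 2 (((n : ℝ) + 1) * (1 - Complex.normSq z)) with h1 | h1
        · have : partialDeriv j (G n) z = 0 := by
            rw [partialDeriv, (hfar n z h1).fderiv_eq]; simp
          rw [this, norm_zero]
          positivity
        · rw [hdG]
          refine (norm_sub_le _ _).trans (add_le_add ?_ ?_)
          · rw [norm_mul]
            have h2 := mul_le_mul (hη1 n z) (hM' z (Metric.ball_subset_closedBall hz))
              (norm_nonneg _) zero_le_one
            linarith
          · have h2 : partialDeriv j (η n) z = _ := partialDeriv_radial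
              (((contDiff_cutoff ((n : ℝ) + 1)).differentiable (by simp)
                (Complex.normSq z)).hasDerivAt) j
            have hnsq : Complex.normSq z ≤ ‖z‖ := by
              rw [Complex.normSq_eq_norm_sq]; nlinarith [norm_nonneg z]
            have h3 := hC ((n : ℝ) + 1) (Complex.normSq z) (hn n).le (by linarith) h1
            rw [norm_mul, h2, Complex.norm_real, Real.norm_eq_abs, abs_mul, abs_mul, abs_two]
            have h4 : ‖F z‖ ≤ L * (1 - Complex.normSq z) :=
              (hL z hz1.le).trans (by gcongr)
            calc ‖F z‖ * (2 * |coord j z| * |deriv (cutoff ((n : ℝ) + 1)) (Complex.normSq z)|)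
                ≤ (L * (1 - Complex.normSq z)) * (2 * 1 * (C * ((n : ℝ) + 1))) := by
                  have := (abs_coord_le j z).trans hz1.le
                  have h5 : 0 ≤ L * (1 - Complex.normSq z) := (norm_nonneg _).trans h4
                  gcongr
              _ = 2 * L * C * (((n : ℝ) + 1) * (1 - Complex.normSq z)) := by ring
              _ ≤ 2 * L * C * 2 := by gcongr
              _ = 4 * L * C := by ring
      · filter_upwards [ae_restrict_mem measurableSet_ball] with z hz
        refine tendsto_const_nhds.congr' ?_
        filter_upwards [hev z hz] with n hn
        rw [partialDeriv, (hfar n z hn).fderiv_eq]; simp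
    simpa using this
  have hnorm : Tendsto (fun n => smoothH1 (G n) (hG n)) atTop (𝓝 0) := by
    rw [tendsto_zero_iff_norm_tendsto_zero]
    have h1 : Tendsto (fun n => ‖smoothH1 (G n) (hG n)‖ ^ 2) atTop (𝓝 0) := by
      have h2 := hlim0.add ((hlim1 0).add (hlim1 1))
      rw [add_zero, add_zero] at h2
      refine h2.congr fun n => ?_
      obtain ⟨h3, h4⟩ := norm_sq_h1comp_smoothH1 (hG n)
      rw [norm_sq_h1, h3, ← h4, ← h4]
      rfl
    have h2 := h1.sqrt
    rw [Real.sqrt_zero] at h2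
    exact h2.congr fun n => Real.sqrt_sq (norm_nonneg _)
  have hfin : Tendsto (fun n => smoothH1 _ (isTest_cutoff_mul hF (hn n)).contDiff) atTop
      (𝓝 (smoothH1 F hF)) := by
    have h1 := (tendsto_const_nhds (x := smoothH1 F hF)).sub hnorm
    rw [sub_zero] at h1
    exact h1.congr fun n => by rw [hsplit n, add_sub_cancel_right]
  exact (Submodule.isClosed_topologicalClosure _).mem_of_tendsto hfin
    (.of_forall fun n => testSpan_le (smoothH1_mem_testSpan (isTest_cutoff_mul hF (hn n))))

/-! ### The entire functions behind the Bessel functions -/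

/-- The entire function `B_n` with `J_n(x) = (x / 2)^n B_n(x² / 4)`. -/
def besselB (n : ℕ) (s : ℝ) : ℝ :=
  ∑' k : ℕ, (-1) ^ k / ((k.factorial : ℝ) * ((k + n).factorial : ℝ)) * s ^ k

theorem norm_besselB_term_le (n k : ℕ) {s R : ℝ} (hs : |s| ≤ R) :
    ‖(-1) ^ k / ((k.factorial : ℝ) * ((k + n).factorial : ℝ)) * s ^ k‖
      ≤ R ^ k / (k.factorial : ℝ) := by
  have h1 : (1 : ℝ) ≤ ((k + n).factorial : ℝ) := by exact_mod_cast (k + n).factorial_pos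
  have h2 : (0 : ℝ) < (k.factorial : ℝ) := by exact_mod_cast k.factorial_pos
  rw [norm_mul, norm_div, norm_pow, norm_neg, norm_one, one_pow, norm_pow, Real.norm_eq_abs,
    Real.norm_eq_abs, abs_of_pos (by positivity : (0 : ℝ) < k.factorial * (k + n).factorial),
    div_mul_eq_mul_div, one_mul]
  have h3 : (k.factorial : ℝ) ≤ k.factorial * (k + n).factorial :=
    le_mul_of_one_le_right h2.le h1
  have h4 : 0 ≤ R := (abs_nonneg s).trans hs
  gcongr

theorem summable_besselB (n : ℕ) (s : ℝ) :
    Summable fun k : ℕ => (-1) ^ k / ((k.factorial : ℝ) * ((k + n).factorial : ℝ)) * s ^ k :=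
  Summable.of_norm_bounded (Real.summable_pow_div_factorial |s|)
    fun k => norm_besselB_term_le n k le_rfl

theorem besselB_zero (n : ℕ) : besselB n 0 = 1 / (n.factorial : ℝ) := by
  rw [besselB, tsum_eq_single 0 fun k hk => by simp [hk]]
  simp

/-- Differentiate term by term: the constant term disappears, and the shifted coefficients are minus
those of order `n + 1`. -/
theorem hasDerivAt_besselB (n : ℕ) (s : ℝ) : HasDerivAt (besselB n) (-besselB (n + 1) s) s := by
  set R := |s| + 1 with hR
  have hterm : ∀ (k : ℕ) (y : ℝ),
      ((k + 1 : ℕ) : ℝ) * ((-1) ^ (k + 1) / (((k + 1).factorial : ℝ)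
        * ((k + 1 + n).factorial : ℝ)) * y ^ k)
      = -((-1) ^ k / ((k.factorial : ℝ) * ((k + (n + 1)).factorial : ℝ)) * y ^ k) := fun k y => by
    have h1 : (k.factorial : ℝ) ≠ 0 := by exact_mod_cast k.factorial_ne_zero
    have h2 : ((k + 1 + n).factorial : ℝ) ≠ 0 := by exact_mod_cast (k + 1 + n).factorial_ne_zero
    have h3 : ((k : ℝ) + 1) ≠ 0 := by positivity
    rw [Nat.factorial_succ, show k + (n + 1) = k + 1 + n by ring]
    push_cast
    field_simp
    ring
  let g : ℕ → ℝ → ℝ := fun k y =>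
    (-1) ^ k / ((k.factorial : ℝ) * ((k + n).factorial : ℝ)) * y ^ k
  let g' : ℕ → ℝ → ℝ := fun k y =>
    (-1) ^ k / ((k.factorial : ℝ) * ((k + n).factorial : ℝ)) * (k * y ^ (k - 1))
  have hg'0 : ∀ y, g' 0 y = 0 := fun y => by simp [g']
  have hg's : ∀ k y, g' (k + 1) y
      = -((-1) ^ k / ((k.factorial : ℝ) * ((k + (n + 1)).factorial : ℝ)) * y ^ k) := fun k y => by
    rw [← hterm]; simp only [g', Nat.add_sub_cancel]; ring
  let u : ℕ → ℝ := fun k => if k = 0 then 0 else R ^ (k - 1) / ((k - 1).factorial : ℝ)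
  have hu : Summable u := by
    rw [← summable_nat_add_iff 1]
    simpa [u] using Real.summable_pow_div_factorial R
  have hmem : s ∈ Metric.ball (0 : ℝ) R := by
    rw [mem_ball_zero_iff, Real.norm_eq_abs]; linarith
  have h := hasDerivAt_tsum_of_isPreconnected (g := g) (g' := g') (t := Metric.ball (0 : ℝ) R) hu
    Metric.isOpen_ball (convex_ball 0 R).isPreconnected
    (fun k y _ => (hasDerivAt_pow k y).const_mul _) (fun k y hy => by
      rcases k with _ | k
      · rw [hg'0]; simp [u]
      · rw [hg's, norm_neg]
        simpa [u] using norm_besselB_term_le (n + 1) k (mem_ball_zero_iff.1 hy).le)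
    hmem (summable_besselB n s) hmem
  have h2 : ∑' k, g' k s = -besselB (n + 1) s := by
    have hs : Summable fun k => g' k s := by
      rw [← summable_nat_add_iff 1]
      simp_rw [hg's]
      exact (summable_besselB (n + 1) s).neg
    rw [hs.tsum_eq_zero_add, hg'0, zero_add]
    simp_rw [hg's]
    rw [tsum_neg]
    rfl
  rw [h2] at h
  exact h

/-- Compare coefficients: beyond the constant term, the two on the right combine through `(n + 1) +
(k + 1) = k + n + 2`, which cancels one factor of the factorial. This identity is what makes the
modes solve the Helmholtz equation. -/
theorem besselB_recurrence (n : ℕ) (s : ℝ) :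
    besselB n s = (n + 1) * besselB (n + 1) s - s * besselB (n + 2) s := by
  have h0 := (summable_besselB n s)
  have h1 := (summable_besselB (n + 1) s).mul_left ((n : ℝ) + 1)
  have h2 := (summable_besselB (n + 2) s).mul_left s
  have key : ∀ k : ℕ,
      (-1) ^ (k + 1) / (((k + 1).factorial : ℝ) * ((k + 1 + n).factorial : ℝ)) * s ^ (k + 1)
      = ((n : ℝ) + 1) * ((-1) ^ (k + 1) / (((k + 1).factorial : ℝ)
          * ((k + 1 + (n + 1)).factorial : ℝ)) * s ^ (k + 1))
        - s * ((-1) ^ k / ((k.factorial : ℝ) * ((k + (n + 2)).factorial : ℝ)) * s ^ k) := fun k => by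
    have e1 : (k.factorial : ℝ) ≠ 0 := by exact_mod_cast k.factorial_ne_zero
    have e2 : ((k + 1 + n).factorial : ℝ) ≠ 0 := by exact_mod_cast (k + 1 + n).factorial_ne_zero
    have e3 : ((k : ℝ) + 1) ≠ 0 := by positivity
    have e4 : ((k : ℝ) + 1 + n + 1) ≠ 0 := by positivity
    rw [show k + 1 + (n + 1) = k + 1 + n + 1 by ring, show k + (n + 2) = k + 1 + n + 1 by ring,
      Nat.factorial_succ (k + 1 + n), Nat.factorial_succ k]
    push_cast
    field_simp
    ring
  have hz : (1 : ℝ) / (n.factorial : ℝ) = (n + 1) * (1 / ((n + 1).factorial : ℝ)) := by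
    have e1 : (n.factorial : ℝ) ≠ 0 := by exact_mod_cast n.factorial_ne_zero
    rw [Nat.factorial_succ]
    push_cast
    field_simp
  have e0 : besselB n s = 1 / (n.factorial : ℝ) + ∑' k : ℕ,
      (-1) ^ (k + 1) / (((k + 1).factorial : ℝ) * ((k + 1 + n).factorial : ℝ)) * s ^ (k + 1) := by
    rw [besselB, h0.tsum_eq_zero_add]; simp
  have e1 : ((n : ℝ) + 1) * besselB (n + 1) s = (n + 1) * (1 / ((n + 1).factorial : ℝ))
      + ∑' k : ℕ, ((n : ℝ) + 1) * ((-1) ^ (k + 1) / (((k + 1).factorial : ℝ)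
          * ((k + 1 + (n + 1)).factorial : ℝ)) * s ^ (k + 1)) := by
    rw [besselB, ← tsum_mul_left, h1.tsum_eq_zero_add]; simp
  have e2 : s * besselB (n + 2) s = ∑' k : ℕ,
      s * ((-1) ^ k / ((k.factorial : ℝ) * ((k + (n + 2)).factorial : ℝ)) * s ^ k) := by
    rw [besselB, ← tsum_mul_left]
  rw [e0, e1, e2, hz, add_sub_assoc, ← Summable.tsum_sub ((summable_nat_add_iff 1).2 h1) h2]
  simp_rw [key]

theorem contDiff_besselB (n : ℕ) : ContDiff ℝ ∞ (besselB n) := by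
  refine contDiff_infty.2 fun m => ?_
  induction m generalizing n with
  | zero =>
    exact contDiff_zero.2 (continuous_iff_continuousAt.2 fun s =>
      (hasDerivAt_besselB n s).continuousAt)
  | succ m ih =>
    have hd : deriv (besselB n) = fun s => -besselB (n + 1) s :=
      funext fun s => (hasDerivAt_besselB n s).deriv
    rw [show ((m + 1 : ℕ) : WithTop ℕ∞) = (m : WithTop ℕ∞) + 1 by norm_cast, contDiff_succ_iff_deriv]
    refine ⟨fun s => (hasDerivAt_besselB n s).differentiableAt, by simp, ?_⟩
    rw [hd]
    exact (ih (n + 1)).neg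

/-- For `s ≤ 0` the signs cancel: every term is nonnegative and the constant term is positive. -/
theorem besselB_pos_of_nonpos (n : ℕ) {s : ℝ} (hs : s ≤ 0) : 0 < besselB n s := by
  have hnn : ∀ k : ℕ,
      0 ≤ (-1) ^ k / ((k.factorial : ℝ) * ((k + n).factorial : ℝ)) * s ^ k := fun k => by
    rw [div_mul_eq_mul_div, ← mul_pow]
    have : 0 ≤ -1 * s := by linarith
    positivity
  refine (summable_besselB n s).tsum_pos hnn 0 ?_
  simp only [pow_zero, Nat.factorial_zero, Nat.cast_one, one_mul, mul_one, zero_add]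
  positivity

/-- Apart from the prefactor only even powers of `√κ` occur, so the second factor is real for either
sign of `κ`. -/
theorem besselJ_eq (n : ℕ) (κ r : ℝ) : besselJ n (sqrtC κ * (r : ℂ))
    = (sqrtC κ * r / 2) ^ n * ((besselB n (κ * r ^ 2 / 4) : ℝ) : ℂ) := by
  rw [besselB, Complex.ofReal_tsum, besselJ, ← tsum_mul_left]
  refine tsum_congr fun k => ?_
  have h : (sqrtC κ * (r : ℂ) / 2) ^ (2 * k + n)
      = (sqrtC κ * (r : ℂ) / 2) ^ n * ((κ : ℂ) * r ^ 2 / 4) ^ k := by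
    rw [pow_add, pow_mul, div_pow, mul_pow, sqrtC_sq, mul_comm]; norm_num
  rw [h]
  push_cast
  ring

theorem sqrtC_ne_zero {κ : ℝ} (hκ : κ ≠ 0) : sqrtC κ ≠ 0 := fun h => by
  have := sqrtC_sq κ
  rw [h] at this
  exact hκ (by exact_mod_cast (by simpa using this.symm : (κ : ℂ) = 0))

theorem sqrtC_zero : sqrtC 0 = 0 := by
  have := sqrtC_sq 0
  simpa using this

theorem besselJ_sqrtC (n : ℕ) (κ : ℝ) : besselJ n (sqrtC κ)
    = (sqrtC κ / 2) ^ n * ((besselB n (κ / 4) : ℝ) : ℂ) := by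
  have := besselJ_eq n κ 1
  simpa using this

/-- The powers of `√κ / 2` cancel, and at `κ = 0` the two constant values of `besselB` cancel, so
both branches of the definition obey one formula free of roots. -/
theorem phi_eq (κ : ℝ) (l : ℤ) (r : ℝ) : phi κ l r
    = (r : ℂ) ^ l.natAbs * ((besselB l.natAbs (κ * r ^ 2 / 4) : ℝ) : ℂ)
      / ((besselB l.natAbs (κ / 4) : ℝ) : ℂ) := by
  rw [phi]
  split_ifs with h
  · have h1 : ((1 / (l.natAbs.factorial : ℝ) : ℝ) : ℂ) ≠ 0 := by
      rw [Complex.ofReal_ne_zero]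
      positivity
    rw [h, zero_mul, zero_div, besselB_zero, mul_div_assoc, div_self h1, mul_one]
  · have h1 : (sqrtC κ / 2) ^ l.natAbs ≠ 0 :=
      pow_ne_zero _ (div_ne_zero (sqrtC_ne_zero h) two_ne_zero)
    rw [besselJ_eq, besselJ_sqrtC, show sqrtC κ * r / 2 = sqrtC κ / 2 * r by ring, mul_pow,
      mul_assoc, mul_div_mul_left _ _ h1]

/-- Each quotient of consecutive Bessel functions leaves one factor `√κ r / 2`, which together with
the outer `√κ r` gives `κ r² / 2`. The formula also covers `r = 0` and `κ = 0`. -/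
theorem psi_eq (κ : ℝ) (l : ℤ) (r : ℝ) : psi κ l r
    = ((κ * r ^ 2 / 2 * (besselB 1 (κ * r ^ 2 / 4) / besselB 0 (κ * r ^ 2 / 4)
      - besselB (l.natAbs + 1) (κ * r ^ 2 / 4) / besselB l.natAbs (κ * r ^ 2 / 4)) : ℝ) : ℂ) := by
  rw [psi]
  split_ifs with h
  · simp [h]
  · rcases eq_or_ne κ 0 with rfl | hκ
    · simp [sqrtC_zero]
    · have hx : sqrtC κ * r / 2 ≠ 0 :=
        div_ne_zero (mul_ne_zero (sqrtC_ne_zero hκ) (by exact_mod_cast h)) two_ne_zero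
      have h2 : sqrtC κ * r * (sqrtC κ * r / 2) = (κ : ℂ) * r ^ 2 / 2 := by
        rw [← sqrtC_sq κ]; ring
      rw [besselJ_eq, besselJ_eq, besselJ_eq, besselJ_eq, pow_zero, one_mul, pow_one,
        pow_succ (sqrtC κ * (r : ℂ) / 2) l.natAbs,
        mul_assoc ((sqrtC κ * (r : ℂ) / 2) ^ l.natAbs),
        mul_div_mul_left _ _ (pow_ne_zero l.natAbs hx)]
      push_cast
      linear_combination ((besselB 1 (κ * r ^ 2 / 4) : ℂ) / (besselB 0 (κ * r ^ 2 / 4) : ℂ)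
        - (besselB (l.natAbs + 1) (κ * r ^ 2 / 4) : ℂ)
          / (besselB l.natAbs (κ * r ^ 2 / 4) : ℂ)) * h2

/-- A nonpositive value would force, by the intermediate value theorem, a zero `s` with `0 < s ≤ κ t
/ 4`. Then `2√s` is a positive zero of `J_0` with square at most `κ`, against `κ < firstZero ^ 2`.
The set defining `firstZero` is shown nonempty only in this contradictory case. -/
theorem besselB_pos_of_lt_firstZero {κ : ℝ} (hκ : κ < firstZero ^ 2) {t : ℝ} (ht : 0 ≤ t)
    (ht1 : t ≤ 1) : 0 < besselB 0 (κ * t / 4) := by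
  rcases le_or_gt (κ * t) 0 with h | h
  · exact besselB_pos_of_nonpos 0 (by linarith)
  by_contra hneg
  have hκ0 : 0 < κ := by
    by_contra h0
    nlinarith [mul_nonneg ht (neg_nonneg.2 (not_lt.1 h0))]
  obtain ⟨s, hs, hs0⟩ : ∃ s ∈ Set.Icc 0 (κ * t / 4), besselB 0 s = 0 := by
    have hc : ContinuousOn (besselB 0) (Set.Icc 0 (κ * t / 4)) :=
      (contDiff_besselB 0).continuous.continuousOn
    exact intermediate_value_Icc' (by linarith) hc
      ⟨not_lt.1 hneg, (besselB_pos_of_nonpos 0 le_rfl).le⟩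
  have hspos : 0 < s := by
    refine lt_of_le_of_ne hs.1 fun h0 => ?_
    rw [← h0] at hs0
    exact (besselB_pos_of_nonpos 0 le_rfl).ne' hs0
  have hx : 2 * √s ∈ {x : ℝ | 0 < x ∧ besselJ 0 (x : ℂ) = 0} := by
    refine ⟨by positivity, ?_⟩
    have h1 : sqrtC 1 = 1 := by simp [sqrtC]
    have h2 := besselJ_eq 0 1 (2 * √s)
    rw [h1, one_mul] at h2
    have h3 : 1 * (2 * √s) ^ 2 / 4 = s := by
      rw [mul_pow, Real.sq_sqrt hspos.le]; ring
    rw [h2, h3, hs0]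
    simp
  have hle : firstZero ≤ 2 * √s := csInf_le ⟨0, fun x hx => hx.1.le⟩ hx
  have h0 : 0 ≤ firstZero := Real.sInf_nonneg fun x hx => hx.1.le
  have h4 : firstZero ^ 2 ≤ (2 * √s) ^ 2 := pow_le_pow_left₀ h0 hle 2
  rw [mul_pow, Real.sq_sqrt hspos.le] at h4
  nlinarith [hs.2]

/-! ### The modes -/

/-- The orientation `z` or `conj z` of a mode. -/
def orient (l : ℤ) : ℂ →L[ℝ] ℂ :=
  if 0 ≤ l then ContinuousLinearMap.id ℝ ℂ else (Complex.conjCLE : ℂ →L[ℝ] ℂ)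

theorem eExt_eq_orient (l : ℤ) (z : ℂ) :
    eExt l z = orient l z ^ l.natAbs / (Real.sqrt (2 * Real.pi) : ℂ) := by
  rw [eExt, orient]
  split_ifs <;> rfl

theorem coord_sum_orient (l : ℤ) (z : ℂ) :
    (coord 0 z : ℂ) * orient l (coordDir 0) + coord 1 z * orient l (coordDir 1) = orient l z := by
  rw [orient]
  split_ifs
  · simp [coord, coordDir]
  · apply Complex.ext <;> simp [coord, coordDir]

/-- The gradient of `z`, or of its conjugate, is isotropic for the bilinear product: this is why
their powers are harmonic. -/
theorem orient_dir_sq (l : ℤ) : orient l (coordDir 0) ^ 2 + orient l (coordDir 1) ^ 2 = 0 := by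
  rw [orient]
  split_ifs <;> simp [coordDir]

theorem coord_sq_sum (z : ℂ) : coord 0 z * coord 0 z + coord 1 z * coord 1 z = Complex.normSq z := by
  simp [coord, Complex.normSq_apply]

/-- The separated solution `w^{|l|} B_{|l|}(κ|z|²/4)`, `w = z` or `conj z`, of `Δu = -κu`. -/
def mode (κ : ℝ) (l : ℤ) (z : ℂ) : ℂ :=
  orient l z ^ l.natAbs * ((besselB l.natAbs (κ * Complex.normSq z / 4) : ℝ) : ℂ)

theorem contDiff_besselB_comp (n : ℕ) (κ : ℝ) :
    ContDiff ℝ ∞ fun t : ℝ => besselB n (κ * t / 4) :=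
  (contDiff_besselB n).comp (by fun_prop)

theorem contDiff_mode (κ : ℝ) (l : ℤ) : ContDiff ℝ ∞ (mode κ l) :=
  ((orient l).contDiff.pow _).mul (contDiff_radial (contDiff_besselB_comp _ κ))

theorem hasDerivAt_besselB_comp (n : ℕ) (κ t : ℝ) :
    HasDerivAt (fun t : ℝ => besselB n (κ * t / 4)) (-besselB (n + 1) (κ * t / 4) * (κ / 4)) t := by
  have h1 : HasDerivAt (fun t : ℝ => κ * t / 4) (κ / 4) t := by
    simpa using ((hasDerivAt_id t).const_mul κ).div_const 4
  exact (hasDerivAt_besselB n (κ * t / 4)).comp t h1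

theorem partialDeriv_besselB (n : ℕ) (κ : ℝ) (j : Fin 2) (z : ℂ) :
    partialDeriv j (fun z => ((besselB n (κ * Complex.normSq z / 4) : ℝ) : ℂ)) z
      = -(κ / 2) * coord j z * ((besselB (n + 1) (κ * Complex.normSq z / 4) : ℝ) : ℂ) := by
  rw [partialDeriv_radial (g := fun t => besselB n (κ * t / 4))
    (hasDerivAt_besselB_comp n κ (Complex.normSq z)) j]
  push_cast
  ring

theorem partialDeriv_orient_pow (l : ℤ) (n : ℕ) (j : Fin 2) (z : ℂ) :
    partialDeriv j (fun z => orient l z ^ n) z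
      = n * orient l z ^ (n - 1) * orient l (coordDir j) := by
  have h := (orient l).hasFDerivAt (x := z)
  rw [partialDeriv, (h.pow n).fderiv]
  simp

theorem partialDeriv_coord (j : Fin 2) (z : ℂ) :
    partialDeriv j (fun z => (coord j z : ℂ)) z = 1 := by
  have h0 : HasFDerivAt (fun z : ℂ => (z.re : ℂ)) (Complex.ofRealCLM.comp Complex.reCLM) z :=
    (Complex.ofRealCLM.comp Complex.reCLM).hasFDerivAt
  have h1 : HasFDerivAt (fun z : ℂ => (z.im : ℂ)) (Complex.ofRealCLM.comp Complex.imCLM) z :=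
    (Complex.ofRealCLM.comp Complex.imCLM).hasFDerivAt
  fin_cases j
  · simp [partialDeriv, coord, h0.fderiv, coordDir]
  · simp [partialDeriv, coord, h1.fderiv, coordDir]

theorem contDiff_coord (j : Fin 2) : ContDiff ℝ ∞ fun z => (coord j z : ℂ) := by
  fin_cases j
  · exact (Complex.ofRealCLM.comp Complex.reCLM).contDiff
  · exact (Complex.ofRealCLM.comp Complex.imCLM).contDiff

theorem partialDeriv_mode (κ : ℝ) (l : ℤ) (j : Fin 2) (z : ℂ) :
    partialDeriv j (mode κ l) z
      = orient l z ^ l.natAbs * (-(κ / 2) * coord j z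
          * ((besselB (l.natAbs + 1) (κ * Complex.normSq z / 4) : ℝ) : ℂ))
        + ((besselB l.natAbs (κ * Complex.normSq z / 4) : ℝ) : ℂ)
          * (l.natAbs * orient l z ^ (l.natAbs - 1) * orient l (coordDir j)) := by
  rw [← partialDeriv_besselB, ← partialDeriv_orient_pow]
  exact partialDeriv_mul ((((orient l).contDiff (n := ∞)).pow _).differentiable (by simp) z)
    ((contDiff_radial (contDiff_besselB_comp _ κ)).differentiable (by simp) z) j

/-- The factor `n` absorbs the truncated subtraction at `n = 0`. -/
theorem natCast_mul_pow_pred (n : ℕ) (w : ℂ) : (n : ℂ) * w ^ (n - 1) * w = n * w ^ n := by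
  rcases n with _ | n
  · simp
  · rw [Nat.add_sub_cancel, mul_assoc, ← pow_succ]

/-- The modes solve the Helmholtz equation. -/
theorem laplacian_mode (κ : ℝ) (l : ℤ) (z : ℂ) :
    partialDeriv 0 (partialDeriv 0 (mode κ l)) z + partialDeriv 1 (partialDeriv 1 (mode κ l)) z
      = -κ * mode κ l z := by
  set n := l.natAbs with hn
  set w := orient l z with hw
  set b : ℕ → ℂ := fun m => ((besselB m (κ * Complex.normSq z / 4) : ℝ) : ℂ) with hb
  have hp : ∀ m, ContDiff ℝ ∞ fun z => orient l z ^ m := fun m => (orient l).contDiff.pow m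
  have hB : ∀ m, ContDiff ℝ ∞ fun z => ((besselB m (κ * Complex.normSq z / 4) : ℝ) : ℂ) :=
    fun m => contDiff_radial (contDiff_besselB_comp m κ)
  have h : ∀ j, partialDeriv j (partialDeriv j (mode κ l)) z
      = w ^ n * (-(κ / 2) * (b (n + 1) - (κ / 2) * coord j z ^ 2 * b (n + 2)))
        + 2 * (n * w ^ (n - 1) * orient l (coordDir j)) * (-(κ / 2) * coord j z * b (n + 1))
        + b n * (n * ((n - 1 : ℕ) * w ^ (n - 1 - 1)) * orient l (coordDir j) ^ 2) := by
    intro j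
    have e1 : partialDeriv j (mode κ l) = fun z => orient l z ^ n * (-(κ / 2) * (coord j z
          * ((besselB (n + 1) (κ * Complex.normSq z / 4) : ℝ) : ℂ)))
        + ((besselB n (κ * Complex.normSq z / 4) : ℝ) : ℂ)
          * ((n * orient l (coordDir j)) * orient l z ^ (n - 1)) := by
      funext y
      rw [partialDeriv_mode]
      ring
    have c1 := (contDiff_coord j).mul (hB (n + 1))
    have c2 := (contDiff_const (c := -((κ : ℂ) / 2))).mul c1
    have c3 := (contDiff_const (c := ((n : ℂ) * orient l (coordDir j)))).mul (hp (n - 1))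
    rw [e1, partialDeriv_add (((hp n).mul c2).differentiable (by simp) z)
        (((hB n).mul c3).differentiable (by simp) z),
      partialDeriv_mul ((hp n).differentiable (by simp) z) (c2.differentiable (by simp) z),
      partialDeriv_mul ((hB n).differentiable (by simp) z) (c3.differentiable (by simp) z),
      partialDeriv_const_mul (c1.differentiable (by simp) z),
      partialDeriv_const_mul ((hp (n - 1)).differentiable (by simp) z),
      partialDeriv_mul ((contDiff_coord j).differentiable (by simp) z)
        ((hB (n + 1)).differentiable (by simp) z),
      partialDeriv_coord, partialDeriv_besselB, partialDeriv_besselB, partialDeriv_orient_pow,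
      partialDeriv_orient_pow]
    simp only [hb, ← hw]
    ring
  have hrec : b n = (n + 1) * b (n + 1) - (κ * Complex.normSq z / 4) * b (n + 2) := by
    simp only [hb]
    rw [besselB_recurrence n]
    push_cast
    ring
  have hmode : mode κ l z = w ^ n * b n := rfl
  have h1 := coord_sum_orient l z
  have h2 := orient_dir_sq l
  have h3 : (coord 0 z : ℂ) * coord 0 z + coord 1 z * coord 1 z = Complex.normSq z := by
    exact_mod_cast coord_sq_sum z
  have h4 := natCast_mul_pow_pred n w
  -- Summing over `j`: the cross terms combine by `Σ x_j a_j = w`, with `a_j` the components of the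
  -- gradient of `w`; the second derivatives of the power cancel by `Σ a_j² = 0`; the radial terms
  -- use `Σ x_j² = |z|²`; and the recurrence collects the rest into `-κ w^n B_n`.
  rw [h 0, h 1, hmode]
  rw [← hw] at h1
  linear_combination (-(κ : ℂ) * n * w ^ (n - 1) * b (n + 1)) * h1 - (κ : ℂ) * b (n + 1) * h4
    + b n * n * ((n - 1 : ℕ) * w ^ (n - 1 - 1)) * h2 + w ^ n * (κ / 2) ^ 2 * b (n + 2) * h3
    + (κ : ℂ) * w ^ n * hrec

/-! ### Weak solutions -/

theorem gradDot_smoothH1 {F G : ℂ → ℂ} (hF : ContDiff ℝ ∞ F) (hG : ContDiff ℝ ∞ G) :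
    gradDot (smoothH1 F hF) (smoothH1 G hG) =ᵐ[diskMeasure] fun z =>
      partialDeriv 0 F z * partialDeriv 0 G z + partialDeriv 1 F z * partialDeriv 1 G z := by
  filter_upwards [h1grad_smoothH1 F hF 0, h1grad_smoothH1 F hF 1, h1grad_smoothH1 G hG 0,
    h1grad_smoothH1 G hG 1] with z h1 h2 h3 h4
  rw [gradDot, Fin.sum_univ_two, h1, h2, h3, h4]

theorem integrable_disk_of_continuous {F : ℂ → ℂ} (hF : Continuous F) : Integrable F diskMeasure :=
  memLp_one_iff_integrable.1 (memLp_disk_of_continuous hF 1)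

/-- Weak form of the Helmholtz equation for a smooth solution. -/
theorem integral_grad_mul_grad {F φ : ℂ → ℂ} {κ : ℂ} (hF : ContDiff ℝ ∞ F)
    (hΔ : ∀ z, partialDeriv 0 (partialDeriv 0 F) z + partialDeriv 1 (partialDeriv 1 F) z
      = -κ * F z) (hφ : IsTest φ) :
    ∫ z, (partialDeriv 0 F z * partialDeriv 0 φ z + partialDeriv 1 F z * partialDeriv 1 φ z)
      ∂diskMeasure = κ * ∫ z, F z * φ z ∂diskMeasure := by
  have hd := fun j => contDiff_partialDeriv hF j
  have hdd := fun j => contDiff_partialDeriv (hd j) j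
  have h : ∀ j, ∫ z, partialDeriv j F z * partialDeriv j φ z ∂diskMeasure
      = -∫ z, partialDeriv j (partialDeriv j F) z * φ z ∂diskMeasure := fun j => by
    rw [((hφ.partialDeriv j).mul_left (hd j)).setIntegral, (hφ.mul_left (hdd j)).setIntegral]
    exact integral_mul_partialDeriv (hd j) hφ j
  have i1 : ∀ j, Integrable (fun z => partialDeriv j F z * partialDeriv j φ z) diskMeasure :=
    fun j => ((hφ.partialDeriv j).mul_left (hd j)).integrable.restrict
  have i2 : ∀ j, Integrable (fun z => partialDeriv j (partialDeriv j F) z * φ z) diskMeasure :=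
    fun j => (hφ.mul_left (hdd j)).integrable.restrict
  rw [integral_add (i1 0) (i1 1), h, h, ← neg_add, ← integral_add (i2 0) (i2 1),
    ← integral_const_mul, ← integral_neg]
  refine integral_congr_ae (.of_forall fun z => ?_)
  linear_combination (-φ z) * hΔ z

theorem constPot_ae (c : ℝ) : ∀ᵐ z ∂diskMeasure, constPot c z = c :=
  Lp.coeFn_const (p := ∞) (μ := diskMeasure) c

/-- A smooth solution of the Helmholtz equation is a weak solution. -/
theorem schrForm_smoothH1 {F : ℂ → ℂ} {κ : ℝ} (hF : ContDiff ℝ ∞ F)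
    (hΔ : ∀ z, partialDeriv 0 (partialDeriv 0 F) z + partialDeriv 1 (partialDeriv 1 F) z
      = -κ * F z) {V : H1} (hV : V ∈ H10) : schrForm (constPot (-κ)) (smoothH1 F hF) V = 0 := by
  refine H10_induction (p := fun V => schrForm (constPot (-κ)) (smoothH1 F hF) V = 0) ?_
    (fun φ hφ => ?_) hV
  · simp_rw [schrForm_eq]
    exact isClosed_eq (ContinuousLinearMap.continuous _) continuous_const
  · have e : schrForm (constPot (-κ)) (smoothH1 F hF) (smoothH1 φ hφ.contDiff)
        = ∫ z, ((partialDeriv 0 F z * partialDeriv 0 φ z + partialDeriv 1 F z * partialDeriv 1 φ z)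
          - κ * (F z * φ z)) ∂diskMeasure := by
      refine integral_congr_ae ?_
      filter_upwards [gradDot_smoothH1 hF hφ.contDiff, h1val_smoothH1 F hF,
        h1val_smoothH1 φ hφ.contDiff, constPot_ae (-κ)] with z h1 h2 h3 h4
      rw [h1, h2, h3, h4]
      push_cast
      ring
    have i1 : Integrable (fun z => partialDeriv 0 F z * partialDeriv 0 φ z
        + partialDeriv 1 F z * partialDeriv 1 φ z) diskMeasure :=
      (((hφ.partialDeriv 0).mul_left (contDiff_partialDeriv hF 0)).integrable.add
        ((hφ.partialDeriv 1).mul_left (contDiff_partialDeriv hF 1)).integrable).restrict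
    have i2 : Integrable (fun z => (κ : ℂ) * (F z * φ z)) diskMeasure :=
      ((hφ.mul_left hF).integrable.const_mul _).restrict
    rw [e, integral_sub i1 i2, integral_grad_mul_grad hF hΔ hφ, integral_const_mul, sub_self]

/-! ### The Dirichlet spectrum -/

/-- The form `∫ ∇u·∇v + q u v` on `H¹₀`. -/
def schrRestrict (q : LInftyReal) : H10 →L[ℂ] H10 →L[ℂ] ℂ :=
  formRestrict (H10.subtypeL : H10 →L[ℂ] H1) (dirichletForm + potForm q)

theorem schrRestrict_apply (q : LInftyReal) (U V : H10) : schrRestrict q U V = schrForm q U V :=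
  (schrForm_eq q U V).symm

theorem bijective_dirichlet :
    Function.Bijective (formRestrict (H10.subtypeL : H10 →L[ℂ] H1) dirichletForm) := by
  refine bijective_formRestrict (c := 1 / 5) (by norm_num) fun V hV => ?_
  have := norm_sq_h1_le hV
  rw [dirichletForm_conj, Complex.norm_real, Real.norm_of_nonneg (by positivity)]
  linarith

theorem integral_zero_L2_mul (V : H1) : ∫ z, (0 : L2) z * h1val V z ∂diskMeasure = 0 := by
  refine integral_eq_zero_of_ae ?_
  filter_upwards [Lp.coeFn_zero ℂ 2 diskMeasure] with z hz
  rw [hz]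
  simp

theorem eq_zero_of_zeroNotInDirichletSpectrum {q : LInftyReal} (hq : ZeroNotInDirichletSpectrum q)
    {U : H1} (hU : U ∈ H10) (h : ∀ V ∈ H10, schrForm q U V = 0) : U = 0 := by
  refine (hq 0).unique ⟨hU, fun V hV => ?_⟩ ⟨H10.zero_mem, fun V hV => ?_⟩
  · rw [h V hV, integral_zero_L2_mul]
  · rw [schrForm_eq, map_zero, integral_zero_L2_mul]
    rfl

/-- The spectral condition only provides solutions for right-hand sides in `L2`. A general
functional is first represented through the Dirichlet form by some `U₁`; the defect is then `-q U₁`,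
which does lie in `L2`. -/
theorem bijective_schrRestrict {q : LInftyReal} (hq : ZeroNotInDirichletSpectrum q) :
    Function.Bijective (schrRestrict q) := by
  refine ⟨(injective_iff_map_eq_zero _).2 fun U hU => Subtype.ext ?_, fun f => ?_⟩
  · refine eq_zero_of_zeroNotInDirichletSpectrum hq U.2 fun V hV => ?_
    have := schrRestrict_apply q U ⟨V, hV⟩
    rw [hU] at this
    exact this.symm
  · obtain ⟨U₁, hU₁⟩ := bijective_dirichlet.2 f
    obtain ⟨U₂, ⟨hU₂, h2⟩, -⟩ := hq (-mulL2 (toComplex q) (h1comp 0 U₁))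
    refine ⟨U₁ + ⟨U₂, hU₂⟩, ?_⟩
    ext V
    have e1 : f V = dirichletForm U₁ V := by rw [← hU₁]; rfl
    have e2 : schrForm q U₂ V = -potForm q U₁ V := by
      rw [h2 V V.2]
      change ∫ z, (-mulL2 (toComplex q) (h1comp 0 U₁) : L2) z * h1comp 0 V z ∂diskMeasure = _
      rw [← pairL2_apply, map_neg]
      rfl
    rw [schrForm_eq] at e2
    rw [map_add, add_apply, schrRestrict_apply, schrRestrict_apply, schrForm_eq, schrForm_eq, e2,
      e1]
    exact add_neg_cancel_right _ _

theorem zeroNotInDirichletSpectrum_of_bijective {q : LInftyReal}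
    (hq : Function.Bijective (schrRestrict q)) : ZeroNotInDirichletSpectrum q := by
  intro h
  let f : H10 →L[ℂ] ℂ := (pairL2 h).comp ((h1comp 0).comp (H10.subtypeL : H10 →L[ℂ] H1))
  have hf : ∀ V : H10, f V = ∫ z, h z * h1val V z ∂diskMeasure := fun V => pairL2_apply _ _
  obtain ⟨W, hW⟩ := hq.2 f
  refine ⟨W, ⟨W.2, fun V hV => ?_⟩, fun W' hW' => ?_⟩
  · rw [← schrRestrict_apply q W ⟨V, hV⟩, hW, hf]
  · have h1 : schrRestrict q ⟨W', hW'.1⟩ = schrRestrict q W := by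
      rw [hW]
      ext V
      rw [schrRestrict_apply, hf]
      exact hW'.2 V V.2
    exact congrArg Subtype.val (hq.1 h1)

/-! ### A positive solution bounds the Dirichlet form below -/

/-- A function positive on `[0, 1]` agrees there with a function positive on `[0, ∞)`. -/
theorem exists_pos_extension {g : ℝ → ℝ} (hg : ContDiff ℝ ∞ g) (hpos : ∀ t, 0 ≤ t → t ≤ 1 → 0 < g t) :
    ∃ G : ℝ → ℝ, ContDiff ℝ ∞ G ∧ (∀ t, 0 ≤ t → 0 < G t) ∧ ∀ t ≤ 1, G t = g t := by
  obtain ⟨δ, hδ, hball⟩ := Metric.eventually_nhds_iff.1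
    (hg.continuous.continuousAt.eventually (lt_mem_nhds (hpos 1 zero_le_one le_rfl)))
  -- The transition from `1` at `t = 1` to `0` at `1 + δ/2` happens where `g` is still positive, so
  -- the convex combination of `g` and `1` is positive throughout.
  let χ : ℝ → ℝ := fun t => Real.smoothTransition ((1 + δ / 2 - t) / (δ / 2))
  have hχ : ContDiff ℝ ∞ χ := Real.smoothTransition.contDiff.comp (by fun_prop)
  refine ⟨fun t => χ t * g t + (1 - χ t), (hχ.mul hg).add (contDiff_const.sub hχ), fun t ht => ?_,
    fun t ht => ?_⟩
  · have h0 : 0 ≤ χ t := Real.smoothTransition.nonneg _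
    have h1 : χ t ≤ 1 := Real.smoothTransition.le_one _
    rcases lt_or_ge t (1 + δ / 2) with h | h
    · have hgt : 0 < g t := by
        rcases le_or_gt t 1 with h2 | h2
        · exact hpos t ht h2
        · exact hball (by rw [Real.dist_eq, abs_of_pos (by linarith)]; linarith)
      rcases h0.eq_or_lt with h2 | h2
      · simp [← h2]
      · have := mul_pos h2 hgt
        linarith
    · have : χ t = 0 := Real.smoothTransition.zero_of_nonpos
        (div_nonpos_of_nonpos_of_nonneg (by linarith) (by positivity))
      simp [this]
  · have : χ t = 1 := Real.smoothTransition.one_of_one_le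
      ((one_le_div (by positivity)).2 (by linarith))
    simp [this]

theorem normSq_le_one {z : ℂ} (hz : z ∈ Metric.ball (0 : ℂ) 1) : Complex.normSq z ≤ 1 := by
  rw [Complex.normSq_eq_norm_sq]
  exact pow_le_one₀ (norm_nonneg z) (mem_ball_zero_iff.1 hz).le

theorem mode_zero (κ : ℝ) (z : ℂ) :
    mode κ 0 z = ((besselB 0 (κ * Complex.normSq z / 4) : ℝ) : ℂ) := by
  simp [mode]

/-- The radial mode may vanish outside the disk, whereas quotients by it have to be smooth on the
whole plane. -/
theorem exists_pos_extension_mode {κ : ℝ} (hκ : κ < firstZero ^ 2) :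
    ∃ w : ℂ → ℂ, ContDiff ℝ ∞ w ∧ (∀ z, w z ≠ 0) ∧ ∀ z, ‖z‖ ≤ 1 → w z = mode κ 0 z := by
  obtain ⟨G, hG, hpos, heq⟩ := exists_pos_extension (contDiff_besselB_comp 0 κ)
    fun t h0 h1 => besselB_pos_of_lt_firstZero hκ h0 h1
  refine ⟨_, contDiff_radial hG, fun z => ?_, fun z hz => ?_⟩
  · exact Complex.ofReal_ne_zero.2 (hpos _ (Complex.normSq_nonneg z)).ne'
  · rw [mode_zero, heq]
    rw [Complex.normSq_eq_norm_sq]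
    exact pow_le_one₀ (norm_nonneg z) hz

theorem conj_partialDeriv_mode_zero (κ : ℝ) (j : Fin 2) (z : ℂ) :
    conj (partialDeriv j (mode κ 0) z) = partialDeriv j (mode κ 0) z := by
  rw [partialDeriv_mode]
  simp [map_ofNat]

theorem conj_mode_zero (κ : ℝ) (z : ℂ) : conj (mode κ 0 z) = mode κ 0 z := by
  simp [mode]

/-- Ground state substitution: with `φ = w v` one has pointwise `|∂_jφ|² = ∂_jw ∂_j(w|v|²) + |w
∂_jv|²`. Testing the equation for `w` with `w|v|²` shows that the first terms integrate to `κ∫|φ|²`,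
and the second ones are nonnegative. -/
theorem mul_integral_norm_sq_le {κ : ℝ} (hκ : κ < firstZero ^ 2) {φ : ℂ → ℂ} (hφ : IsTest φ) :
    κ * ∫ z, ‖φ z‖ ^ 2 ∂diskMeasure
      ≤ ∫ z, ‖partialDeriv 0 φ z‖ ^ 2 ∂diskMeasure + ∫ z, ‖partialDeriv 1 φ z‖ ^ 2 ∂diskMeasure := by
  obtain ⟨W, hW, hW0, hWm⟩ := exists_pos_extension_mode hκ
  set w := mode κ 0 with hw
  have hwc : ContDiff ℝ ∞ w := contDiff_mode κ 0
  let v : ℂ → ℂ := fun z => (W z)⁻¹ * φ z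
  have hv : IsTest v := hφ.mul_left (hW.inv hW0)
  have hφv : φ = fun z => w z * v z := by
    funext z
    by_cases hz : z ∈ Metric.ball (0 : ℂ) 1
    · rw [← hWm z (mem_ball_zero_iff.1 hz).le, mul_inv_cancel_left₀ (hW0 z)]
    · rw [hφ.eq_zero hz, hv.eq_zero hz, mul_zero]
  have hψ' : IsTest fun z => conj (v z) * v z := hv.mul_left hv.conj.contDiff
  have hψ : IsTest fun z => w z * (conj (v z) * v z) := hψ'.mul_left hwc
  have hdv : ∀ z, DifferentiableAt ℝ v z := fun z => hv.contDiff.differentiable (by simp) z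
  have hdw : ∀ z, DifferentiableAt ℝ w z := fun z => hwc.differentiable (by simp) z
  have hdvc : ∀ z, DifferentiableAt ℝ (fun z => conj (v z)) z :=
    fun z => hv.conj.contDiff.differentiable (by simp) z
  have key := integral_grad_mul_grad hwc (laplacian_mode κ 0) hψ
  have hpt : ∀ j z, ((‖partialDeriv j φ z‖ ^ 2 : ℝ) : ℂ)
      = partialDeriv j w z * partialDeriv j (fun z => w z * (conj (v z) * v z)) z
        + ((‖w z * partialDeriv j v z‖ ^ 2 : ℝ) : ℂ) := fun j z => by
    rw [← Complex.normSq_eq_norm_sq, ← Complex.normSq_eq_norm_sq, ← Complex.mul_conj,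
      ← Complex.mul_conj, hφv,
      partialDeriv_mul (hdw z) (hdv z), partialDeriv_mul (hdw z)
        (hψ'.contDiff.differentiable (by simp) z), partialDeriv_mul (hdvc z) (hdv z),
      partialDeriv_conj (hdv z)]
    simp only [map_add, map_mul, hw, conj_mode_zero, conj_partialDeriv_mode_zero]
    ring
  have hpt2 : ∀ z, ((‖φ z‖ ^ 2 : ℝ) : ℂ) = w z * (w z * (conj (v z) * v z)) := fun z => by
    rw [← Complex.normSq_eq_norm_sq, ← Complex.mul_conj, hφv]
    simp only [map_mul, hw, conj_mode_zero]
    ring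
  have i0 : ∀ j, Integrable (fun z => ‖partialDeriv j φ z‖ ^ 2) diskMeasure := fun j =>
    (memLp_disk_of_continuous (continuous_partialDeriv hφ.contDiff j) 2).integrable_norm_pow
      (p := 2) (by simp)
  have i1 : ∀ j, Integrable (fun z => ‖w z * partialDeriv j v z‖ ^ 2) diskMeasure := fun j =>
    (memLp_disk_of_continuous (hwc.continuous.mul (continuous_partialDeriv hv.contDiff j))
      2).integrable_norm_pow (p := 2) (by simp)
  have i2 : ∀ j, Integrable (fun z => partialDeriv j w z
      * partialDeriv j (fun z => w z * (conj (v z) * v z)) z) diskMeasure := fun j =>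
    ((hψ.partialDeriv j).mul_left (contDiff_partialDeriv hwc j)).integrable.restrict
  have e1 : ∀ j, ((∫ z, ‖partialDeriv j φ z‖ ^ 2 ∂diskMeasure : ℝ) : ℂ)
      = ∫ z, partialDeriv j w z * partialDeriv j (fun z => w z * (conj (v z) * v z)) z
          ∂diskMeasure
        + ((∫ z, ‖w z * partialDeriv j v z‖ ^ 2 ∂diskMeasure : ℝ) : ℂ) := fun j => by
    have i1' : Integrable (fun z => ((‖w z * partialDeriv j v z‖ ^ 2 : ℝ) : ℂ)) diskMeasure :=
      (i1 j).ofReal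
    rw [← integral_complex_ofReal, ← integral_complex_ofReal, ← integral_add (i2 j) i1']
    exact integral_congr_ae (.of_forall fun z => hpt j z)
  have e2 : (κ : ℂ) * ((∫ z, ‖φ z‖ ^ 2 ∂diskMeasure : ℝ) : ℂ)
      = ∫ z, partialDeriv 0 w z * partialDeriv 0 (fun z => w z * (conj (v z) * v z)) z ∂diskMeasure
        + ∫ z, partialDeriv 1 w z * partialDeriv 1 (fun z => w z * (conj (v z) * v z)) z
          ∂diskMeasure := by
    rw [← integral_add (i2 0) (i2 1), key, ← integral_complex_ofReal]
    congr 1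
    exact integral_congr_ae (.of_forall hpt2)
  have e3 : ((∫ z, ‖partialDeriv 0 φ z‖ ^ 2 ∂diskMeasure
        + ∫ z, ‖partialDeriv 1 φ z‖ ^ 2 ∂diskMeasure : ℝ) : ℂ)
      = ((κ * ∫ z, ‖φ z‖ ^ 2 ∂diskMeasure + (∫ z, ‖w z * partialDeriv 0 v z‖ ^ 2 ∂diskMeasure
        + ∫ z, ‖w z * partialDeriv 1 v z‖ ^ 2 ∂diskMeasure) : ℝ) : ℂ) := by
    rw [Complex.ofReal_add, e1, e1, Complex.ofReal_add, Complex.ofReal_mul, e2]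
    push_cast
    ring
  rw [Complex.ofReal_injective e3]
  have n0 : ∀ j, 0 ≤ ∫ z, ‖w z * partialDeriv j v z‖ ^ 2 ∂diskMeasure :=
    fun j => integral_nonneg fun z => by positivity
  linarith [n0 0, n0 1]

theorem mul_norm_sq_le {κ : ℝ} (hκ : κ < firstZero ^ 2) {V : H1} (hV : V ∈ H10) :
    κ * ‖h1comp 0 V‖ ^ 2 ≤ ‖h1comp 1 V‖ ^ 2 + ‖h1comp 2 V‖ ^ 2 := by
  refine H10_induction (p := fun V => κ * ‖h1comp 0 V‖ ^ 2
    ≤ ‖h1comp 1 V‖ ^ 2 + ‖h1comp 2 V‖ ^ 2) (isClosed_le ?_ ?_) (fun φ hφ => ?_) hV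
  · exact continuous_const.mul (((h1comp 0).continuous.norm).pow 2)
  · exact (((h1comp 1).continuous.norm).pow 2).add (((h1comp 2).continuous.norm).pow 2)
  · obtain ⟨h0, h1⟩ := norm_sq_h1comp_smoothH1 hφ.contDiff
    rw [h0]
    exact (mul_integral_norm_sq_le hκ hφ).trans_eq (congrArg₂ _ (h1 0).symm (h1 1).symm)

/-- `0` is not a Dirichlet eigenvalue of `-Δ - κ` for `κ < λ_{0,1}²`. -/
theorem zeroNotInDirichletSpectrum_of_lt {κ : ℝ} (hκ : κ < firstZero ^ 2) :
    ZeroNotInDirichletSpectrum (constPot (-κ)) := by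
  obtain ⟨c, hc, hbound⟩ : ∃ c : ℝ, 0 < c ∧ ∀ V ∈ H10,
      c * (‖h1comp 1 V‖ ^ 2 + ‖h1comp 2 V‖ ^ 2)
        ≤ ‖h1comp 1 V‖ ^ 2 + ‖h1comp 2 V‖ ^ 2 + -κ * ‖h1comp 0 V‖ ^ 2 := by
    rcases le_or_gt κ 0 with h | h
    · refine ⟨1, one_pos, fun V _ => ?_⟩
      nlinarith [mul_nonneg (neg_nonneg.2 h) (sq_nonneg ‖h1comp 0 V‖)]
    -- The inequality at `κ` itself leaves no gap. A slightly larger `κ'` does: it bounds `κ‖V‖²` by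
    -- the fraction `κ / κ'` of the Dirichlet energy.
    · obtain ⟨κ', h1, h2⟩ := exists_between hκ
      have hκ' : 0 < κ' := h.trans h1
      refine ⟨1 - κ / κ', by rw [sub_pos, div_lt_one hκ']; exact h1, fun V hV => ?_⟩
      have h3 := mul_norm_sq_le h2 hV
      have h4 : κ / κ' * (κ' * ‖h1comp 0 V‖ ^ 2)
          ≤ κ / κ' * (‖h1comp 1 V‖ ^ 2 + ‖h1comp 2 V‖ ^ 2) :=
        mul_le_mul_of_nonneg_left h3 (by positivity)
      have h5 : κ / κ' * (κ' * ‖h1comp 0 V‖ ^ 2) = κ * ‖h1comp 0 V‖ ^ 2 := by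
        field_simp
      linarith
  refine zeroNotInDirichletSpectrum_of_bijective
    (bijective_formRestrict (c := c / 5) (by positivity) fun V hV => ?_)
  rw [add_apply, add_apply, dirichletForm_conj, potForm_constPot_conj, ← Complex.ofReal_add,
    Complex.norm_real]
  refine le_trans ?_ (le_abs_self _)
  have h1 := norm_sq_h1_le hV
  have h2 := hbound V hV
  nlinarith

/-- `J_n(√κ) ≠ 0` when `0` is not in the Dirichlet spectrum of `-Δ - κ`. -/
theorem besselB_ne_zero {κ : ℝ} (hκ : ZeroNotInDirichletSpectrum (constPot (-κ))) (n : ℕ) :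
    besselB n (κ / 4) ≠ 0 := by
  intro h0
  -- If `B_n(κ/4) = 0`, the mode vanishes on the circle and is a homogeneous Dirichlet solution,
  -- hence zero.
  have hmem : smoothH1 (mode κ n) (contDiff_mode κ n) ∈ H10 := by
    refine smoothH1_mem_H10 _ fun z hz => ?_
    have : Complex.normSq z = 1 := by rw [Complex.normSq_eq_norm_sq, hz, one_pow]
    rw [mode, this, mul_one, Int.natAbs_natCast, h0]
    simp
  have hz := eq_zero_of_zeroNotInDirichletSpectrum hκ hmem
    fun V hV => schrForm_smoothH1 _ (laplacian_mode κ n) hV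
  have hae : mode κ n =ᵐ[volume.restrict (Metric.ball 0 1)] fun _ => (0 : ℂ) := by
    have h1 := h1val_smoothH1 (mode κ n) (contDiff_mode κ n)
    rw [hz] at h1
    have h2 : h1val 0 =ᵐ[diskMeasure] fun _ => (0 : ℂ) := Lp.coeFn_zero ℂ 2 diskMeasure
    exact h1.symm.trans h2
  have heq := Measure.eqOn_open_of_ae_eq hae Metric.isOpen_ball
    (contDiff_mode κ n).continuous.continuousOn continuousOn_const
  -- The contradiction: `B_n(0) = 1/n!` is nonzero, so the mode does not vanish at small positive
  -- radii.
  have hcont : ContinuousAt (fun r : ℝ => besselB n (κ * r ^ 2 / 4)) 0 :=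
    ((contDiff_besselB n).continuous.comp (by fun_prop)).continuousAt
  have hne : ∀ᶠ r : ℝ in 𝓝 0, besselB n (κ * r ^ 2 / 4) ≠ 0 := by
    refine hcont.eventually_ne ?_
    simpa [besselB_zero] using n.factorial_ne_zero
  obtain ⟨ε, hε, hball⟩ := Metric.eventually_nhds_iff.1 hne
  set r : ℝ := min (ε / 2) (1 / 2) with hr
  have hr0 : 0 < r := by positivity
  have hr1 : r ≤ ε / 2 := min_le_left _ _
  have hr2 : r ≤ 1 / 2 := min_le_right _ _
  have h1 : besselB n (κ * r ^ 2 / 4) ≠ 0 :=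
    hball (by rw [Real.dist_eq, sub_zero, abs_of_pos hr0]; linarith)
  have h2 : mode κ n (r : ℂ) = 0 := heq (by
    rw [mem_ball_zero_iff, Complex.norm_real, Real.norm_of_nonneg hr0.le]; linarith)
  rw [mode, Complex.normSq_ofReal, ← sq, Int.natAbs_natCast, mul_eq_zero] at h2
  rcases h2 with h2 | h2
  · have h3 : orient n (r : ℂ) = r := by
      rw [orient]; simp
    rw [h3] at h2
    exact hr0.ne' (by exact_mod_cast eq_zero_of_pow_eq_zero h2)
  · exact h1 (by exact_mod_cast h2)

/-- Scaling: for `κ t > 0` the value is the boundary value belonging to the parameter `κ t ≤ κ`,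
which again lies below the threshold. -/
theorem besselB_ne_zero_of_lt {κ : ℝ} (hκ : κ < firstZero ^ 2) (n : ℕ) {t : ℝ} (h0 : 0 ≤ t)
    (h1 : t ≤ 1) : besselB n (κ * t / 4) ≠ 0 := by
  rcases le_or_gt (κ * t) 0 with h | h
  · exact (besselB_pos_of_nonpos n (by linarith)).ne'
  · have hκ0 : 0 < κ := by
      by_contra hneg
      nlinarith [mul_nonneg h0 (neg_nonneg.2 (not_lt.1 hneg))]
    exact besselB_ne_zero (zeroNotInDirichletSpectrum_of_lt (by nlinarith)) n

/-! ### Differentiability of the Dirichlet-to-Neumann maps -/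

theorem mkQL_eq_zero (U : H1) : H10.mkQL U = 0 ↔ ∃ V : H10, H10.subtypeL V = U := by
  refine (Submodule.Quotient.mk_eq_zero H10).trans ⟨fun h => ⟨⟨U, h⟩, rfl⟩, ?_⟩
  rintro ⟨V, rfl⟩
  exact V.2

theorem isSchrSol_schrSol {q : LInftyReal} {g : HHalf} (h : ∃ U, IsSchrSol q g U) :
    IsSchrSol q g (schrSol q g) := by
  rw [schrSol, dif_pos h]
  exact h.choose_spec

theorem isSchrDtN_PhiS {q : LInftyReal} (h : ∃ A, IsSchrDtN q A) : IsSchrDtN q (PhiS q) := by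
  rw [PhiS, dif_pos h]
  exact h.choose_spec

theorem isCondSol_condSol {γ : LInftyReal} {g : HHalf} (h : ∃ U, IsCondSol γ g U) :
    IsCondSol γ g (condSol γ g) := by
  rw [condSol, dif_pos h]
  exact h.choose_spec

theorem isDtN_Phi {γ : LInftyReal} (h : ∃ A, IsDtN γ A) : IsDtN γ (Phi γ) := by
  rw [Phi, dif_pos h]
  exact h.choose_spec

instance : NormedAddCommGroup HHalf := Submodule.Quotient.normedAddCommGroup H10

instance : NormedSpace ℂ HHalf := Submodule.Quotient.normedSpace H10 ℂ

theorem fderiv_PhiS {q₀ : LInftyReal} (hq : ZeroNotInDirichletSpectrum q₀) :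
    (∀ g U, IsSchrSol q₀ g U → schrSol q₀ g = U) ∧
    DifferentiableAt ℝ PhiS q₀ ∧
    ∀ h g f, fderiv ℝ PhiS q₀ h g f = potForm h (schrSol q₀ f) (schrSol q₀ g) := by
  obtain ⟨s, hs⟩ := exists_section_of_quotient H10
  obtain ⟨K, hK⟩ := isFormFamily_potForm
  have hiff : ∀ q g U, IsSchrSol q g U ↔ H10.mkQL U = g ∧
      ∀ V : H10, (dirichletForm + potForm q) U (H10.subtypeL V) = 0 := fun q g U =>
    and_congr Iff.rfl ⟨fun h V => (schrForm_eq q U V).symm.trans (h V V.2),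
      fun h V hV => (schrForm_eq q U V).trans (h ⟨V, hV⟩)⟩
  obtain ⟨h1, h2⟩ := fderiv_dtn (X := H1) (Y := H10) (Q := HHalf)
    (ι := H10.subtypeL) (π := H10.mkQL) (s := s) (b₀ := dirichletForm) mkQL_eq_zero hs hK q₀
    dirichletForm_symm (bijective_schrRestrict hq) schrSol PhiS
    (fun q g ⟨U, hU⟩ => (hiff q g _).1 (isSchrSol_schrSol ⟨U, (hiff q g U).2 hU⟩))
    (fun q ⟨A, hA⟩ g V => (isSchrDtN_PhiS ⟨A, fun g V => (hA g V).trans (schrForm_eq q V _).symm⟩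
      g V).trans (schrForm_eq q V _))
  exact ⟨fun g U hU => h1 g U ((hiff q₀ g U).1 hU).1 ((hiff q₀ g U).1 hU).2, h2⟩

/-- Here the form is linear in the conductivity, so `b₀ = 0`. The lower bound `c` on `γ₀` gives
coercivity, with `c / 5` after the Poincaré inequality. -/
theorem fderiv_Phi {γ₀ : LInftyReal} {c : ℝ} (hc : 0 < c)
    (hγ : ∀ᵐ z ∂diskMeasure, c ≤ γ₀ z) :
    (∀ g U, IsCondSol γ₀ g U → condSol γ₀ g = U) ∧
    DifferentiableAt ℝ Phi γ₀ ∧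
    ∀ h g f, fderiv ℝ Phi γ₀ h g f = condForm h (condSol γ₀ f) (condSol γ₀ g) := by
  obtain ⟨s, hs⟩ := exists_section_of_quotient H10
  obtain ⟨K, hK⟩ := isFormFamily_condForm
  have heq : ∀ γ U V, (0 + condForm γ : H1 →L[ℂ] H1 →L[ℂ] ℂ) U V
      = ∫ z, ((γ z : ℝ) : ℂ) * gradDot U V z ∂diskMeasure := fun γ U V => by
    rw [← condForm_apply, add_apply, add_apply]
    exact zero_add _
  have hiff : ∀ γ g U, IsCondSol γ g U ↔ H10.mkQL U = g ∧
      ∀ V : H10, (0 + condForm γ : H1 →L[ℂ] H1 →L[ℂ] ℂ) U (H10.subtypeL V) = 0 := fun γ g U =>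
    and_congr Iff.rfl ⟨fun h V => (heq γ U V).trans (h V V.2),
      fun h V hV => (heq γ U V).symm.trans (h ⟨V, hV⟩)⟩
  have hb : Function.Bijective (formRestrict (H10.subtypeL : H10 →L[ℂ] H1) (0 + condForm γ₀)) := by
    refine bijective_formRestrict (c := c / 5) (by positivity) fun V hV => ?_
    have h1 := norm_sq_h1_le hV
    have h2 := le_condForm_conj hγ V
    have h3 := Complex.re_le_norm (condForm γ₀ V (conjH1 V))
    rw [heq, ← condForm_apply]
    nlinarith
  obtain ⟨h1, h2⟩ := fderiv_dtn (X := H1) (Y := H10) (Q := HHalf)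
    (ι := H10.subtypeL) (π := H10.mkQL) (s := s) (b₀ := 0) mkQL_eq_zero hs hK γ₀
    (fun _ _ => rfl) hb condSol Phi
    (fun γ g ⟨U, hU⟩ => (hiff γ g _).1 (isCondSol_condSol ⟨U, (hiff γ g U).2 hU⟩))
    (fun γ ⟨A, hA⟩ g V => (isDtN_Phi ⟨A, fun g V => (hA g V).trans (heq γ V _)⟩
      g V).trans (heq γ V _).symm)
  exact ⟨fun g U hU => h1 g U ((hiff γ₀ g U).1 hU).1 ((hiff γ₀ g U).1 hU).2, h2⟩

/-! ### Complex linear extension of the differentials -/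

theorem integral_complexify (q : LInfty) {G : ℂ → ℂ}
    (hG : ∀ p : LInfty, Integrable (fun z => p z * G z) diskMeasure) :
    ∫ z, ((Complex.reCLM.compLp q z : ℝ) : ℂ) * G z ∂diskMeasure
      + Complex.I * ∫ z, ((Complex.imCLM.compLp q z : ℝ) : ℂ) * G z ∂diskMeasure
      = ∫ z, q z * G z ∂diskMeasure := by
  rw [integral_toComplex_mul, integral_toComplex_mul, ← integral_const_mul, ← integral_add (hG _)
    ((hG _).const_mul _)]
  refine integral_congr_ae ?_
  filter_upwards [coeFn_toComplex (Complex.reCLM.compLp q), coeFn_toComplex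
    (Complex.imCLM.compLp q), Complex.reCLM.coeFn_compLp q, Complex.imCLM.coeFn_compLp q]
    with z h1 h2 h3 h4
  rw [h1, h2, h3, h4, ← mul_assoc, ← add_mul]
  congr 1
  rw [mul_comm Complex.I]
  exact Complex.re_add_im (q z)

theorem complexify_apply (D : LInftyReal →L[ℝ] BdryOp) (q : LInfty) (g f : HHalf) :
    complexify D q g f
      = D (Complex.reCLM.compLp q) g f + Complex.I * D (Complex.imCLM.compLp q) g f := rfl

theorem differentiableAt_PhiS {q₀ : LInftyReal} (hq : ZeroNotInDirichletSpectrum q₀) :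
    DifferentiableAt ℝ PhiS q₀ := by
  exact (fderiv_PhiS hq).2.1

/-- The distributional parts agree by definition; only the bounded part uses the derivative formula.
-/
theorem dPhiS_eq_integralPair {q₀ : LInftyReal} (hq : ZeroNotInDirichletSpectrum q₀) (q : LInfty)
    (T : 𝓓'(disk, ℂ)) (f g : HHalf) : dPhiS q₀ q T f g
      = integralPair q T fun z => h1val (schrSol q₀ f) z * h1val (schrSol q₀ g) z := by
  obtain ⟨-, -, hD⟩ := fderiv_PhiS hq
  rw [dPhiS, integralPair, complexify_apply, hD, hD, potForm_apply, potForm_apply,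
    integral_complexify q fun p => integrable_bdd_mul_val p _ _]

theorem differentiableAt_Phi {γ₀ : LInftyReal} {c : ℝ} (hc : 0 < c)
    (hγ : ∀ᵐ z ∂diskMeasure, c ≤ γ₀ z) : DifferentiableAt ℝ Phi γ₀ := by
  exact (fderiv_Phi hc hγ).2.1

theorem dPhi_eq_integralPair {γ₀ : LInftyReal} {c : ℝ} (hc : 0 < c)
    (hγ : ∀ᵐ z ∂diskMeasure, c ≤ γ₀ z) (γ : LInfty) (T : 𝓓'(disk, ℂ)) (f g : HHalf) :
    dPhi γ₀ γ T f g = integralPair γ T (gradDot (condSol γ₀ f) (condSol γ₀ g)) := by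
  obtain ⟨-, -, hD⟩ := fderiv_Phi hc hγ
  rw [dPhi, integralPair, complexify_apply, hD, hD, condForm_apply, condForm_apply,
    integral_complexify γ fun p => integrable_bdd_mul_gradDot p _ _]

/-! ### The pairing with smooth functions -/

theorem isSmoothRep_congr {G G' : ℂ → ℂ} (h : G =ᵐ[diskMeasure] G') (W : ℂ → ℂ) :
    IsSmoothRep G W ↔ IsSmoothRep G' W :=
  and_congr Iff.rfl ⟨fun h1 => h1.trans h, fun h1 => h1.trans h.symm⟩

/-- Continuous functions equal almost everywhere on an open set agree there, so the choice of
representative is immaterial. -/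
theorem IsSmoothRep.eqOn {G W W' : ℂ → ℂ} (h : IsSmoothRep G W) (h' : IsSmoothRep G W') :
    Set.EqOn W W' (Metric.ball 0 1) :=
  Measure.eqOn_open_of_ae_eq (h.2.trans h'.2.symm) Metric.isOpen_ball h.1.continuousOn
    h'.1.continuousOn

theorem IsSmoothRep.const_mul {G W : ℂ → ℂ} (h : IsSmoothRep G W) (a : ℂ) :
    IsSmoothRep (fun z => a * G z) fun z => a * W z :=
  ⟨contDiffOn_const.mul h.1, h.2.mono fun _ hz => congrArg (a * ·) hz⟩

theorem cutPair_congr (T : 𝓓'(disk, ℂ)) (χ : 𝓓(disk, ℝ)) {W W' : ℂ → ℂ} {hW : ContDiffOn ℝ ∞ W disk}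
    {hW' : ContDiffOn ℝ ∞ W' disk} (h : Set.EqOn W W' (Metric.ball 0 1)) :
    cutPair T χ W hW = cutPair T χ W' hW' := by
  have h0 : ∀ z, z ∉ Metric.ball (0 : ℂ) 1 → χ z = 0 := fun z hz =>
    image_eq_zero_of_notMem_tsupport fun h => hz (χ.tsupport_subset h)
  have h1 : ∀ (g : ℂ → ℝ) z, χ z * g (W z) = χ z * g (W' z) := fun g z => by
    by_cases hz : z ∈ Metric.ball (0 : ℂ) 1
    · rw [h hz]
    · rw [h0 z hz, zero_mul, zero_mul]
  have hre : cutMul χ (fun z => (W z).re) (Complex.reCLM.contDiff.comp_contDiffOn hW)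
      = cutMul χ (fun z => (W' z).re) (Complex.reCLM.contDiff.comp_contDiffOn hW') := by
    ext z
    exact h1 Complex.re z
  have him : cutMul χ (fun z => (W z).im) (Complex.imCLM.contDiff.comp_contDiffOn hW)
      = cutMul χ (fun z => (W' z).im) (Complex.imCLM.contDiff.comp_contDiffOn hW') := by
    ext z
    exact h1 Complex.im z
  rw [cutPair, cutPair, hre, him]

/-- The chosen cutoff depends on `T` alone, so both sides use the same one and only the
representatives have to be compared. -/
theorem distPair_congr (T : 𝓓'(disk, ℂ)) {G G' : ℂ → ℂ} (h : G =ᵐ[diskMeasure] G') :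
    distPair T G = distPair T G' := by
  have hrep : ∀ W W', IsSmoothRep G W → IsSmoothRep G' W' → Set.EqOn W W' (Metric.ball 0 1) :=
    fun W W' h1 h2 => h1.eqOn ((isSmoothRep_congr h W').2 h2)
  have hiff : (∃ W, IsSmoothRep G W) ↔ ∃ W, IsSmoothRep G' W :=
    exists_congr (isSmoothRep_congr h)
  by_cases hG : (∃ W, IsSmoothRep G W) ∧ ∃ χ, IsCutoffFor χ T
  · have hG' : (∃ W, IsSmoothRep G' W) ∧ ∃ χ, IsCutoffFor χ T := ⟨hiff.1 hG.1, hG.2⟩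
    rw [distPair, distPair, dif_pos hG, dif_pos hG']
    exact cutPair_congr T _ (hrep _ _ hG.1.choose_spec hG'.1.choose_spec)
  · rw [distPair, distPair, dif_neg hG, dif_neg fun h => hG ⟨hiff.2 h.1, h.2⟩]

theorem integralPair_congr (q : LInfty) (T : 𝓓'(disk, ℂ)) {G G' : ℂ → ℂ}
    (h : G =ᵐ[diskMeasure] G') : integralPair q T G = integralPair q T G' := by
  rw [integralPair, integralPair, distPair_congr T h]
  congr 1
  refine integral_congr_ae ?_
  filter_upwards [h] with z hz
  rw [hz]

/-- A real factor does not mix real and imaginary parts, so linearity of `T` on real test functions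
is enough; the only factor needed later is `J_0(√κ)²`, which is real. -/
theorem cutPair_const_mul (T : 𝓓'(disk, ℂ)) (χ : 𝓓(disk, ℝ)) {W : ℂ → ℂ}
    (hW : ContDiffOn ℝ ∞ W disk) (a : ℝ) :
    cutPair T χ (fun z => a * W z) (contDiffOn_const.mul hW) = a * cutPair T χ W hW := by
  have hT : ∀ φ : 𝓓(disk, ℝ), T (a • φ) = a * T φ := fun φ => by
    rw [map_smul, Complex.real_smul]
  have hre : cutMul χ (fun z => (a * W z).re)
      (Complex.reCLM.contDiff.comp_contDiffOn (contDiffOn_const.mul hW))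
      = a • cutMul χ (fun z => (W z).re) (Complex.reCLM.contDiff.comp_contDiffOn hW) := by
    ext z
    change χ z * ((a : ℂ) * W z).re = a * (χ z * (W z).re)
    rw [Complex.re_ofReal_mul, mul_left_comm]
  have him : cutMul χ (fun z => (a * W z).im)
      (Complex.imCLM.contDiff.comp_contDiffOn (contDiffOn_const.mul hW))
      = a • cutMul χ (fun z => (W z).im) (Complex.imCLM.contDiff.comp_contDiffOn hW) := by
    ext z
    change χ z * ((a : ℂ) * W z).im = a * (χ z * (W z).im)
    rw [Complex.im_ofReal_mul, mul_left_comm]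
  rw [cutPair, cutPair, hre, him, hT, hT, mul_add, mul_left_comm]

theorem distPair_const_mul (T : 𝓓'(disk, ℂ)) {G : ℂ → ℂ} (hG : ∃ W, IsSmoothRep G W) (a : ℝ) :
    distPair T (fun z => a * G z) = a * distPair T G := by
  have hG' : ∃ W, IsSmoothRep (fun z => a * G z) W := hG.imp' _ fun W hW => hW.const_mul a
  by_cases hχ : ∃ χ, IsCutoffFor χ T
  · rw [distPair, distPair, dif_pos ⟨hG', hχ⟩, dif_pos ⟨hG, hχ⟩, ← cutPair_const_mul]
    exact cutPair_congr T _ (hG'.choose_spec.eqOn (hG.choose_spec.const_mul a))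
  · rw [distPair, distPair, dif_neg fun h => hχ h.2, dif_neg fun h => hχ h.2, mul_zero]

theorem integralPair_const_mul (q : LInfty) (T : 𝓓'(disk, ℂ)) {G : ℂ → ℂ}
    (hG : ∃ W, IsSmoothRep G W) (a : ℝ) :
    integralPair q T (fun z => a * G z) = a * integralPair q T G := by
  rw [integralPair, integralPair, distPair_const_mul T hG, mul_add, ← integral_const_mul]
  congr 1
  exact integral_congr_ae (.of_forall fun z => mul_left_comm _ _ _)

/-! ### The explicit solutions -/

/-- The difference vanishes on the circle, hence lies in `H10`; this links pointwise boundary values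
with the quotient definition of the trace. -/
theorem trace_smoothH1_congr {F G : ℂ → ℂ} (hF : ContDiff ℝ ∞ F) (hG : ContDiff ℝ ∞ G)
    (h : ∀ z, ‖z‖ = 1 → F z = G z) : trace (smoothH1 F hF) = trace (smoothH1 G hG) := by
  refine (Submodule.Quotient.eq H10).2 ?_
  have hD : ContDiff ℝ ∞ fun z => F z - G z := hF.sub hG
  have e : smoothH1 F hF = smoothH1 (fun z => F z - G z) hD + smoothH1 G hG := by
    rw [← smoothH1_add]
    exact smoothH1_congr _ _ fun z _ => (sub_add_cancel _ _).symm
  rw [e, add_sub_cancel_right]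
  exact smoothH1_mem_H10 hD fun z hz => sub_eq_zero.2 (h z hz)

theorem conj_eExt (l : ℤ) (z : ℂ) : conj (eExt l z) = eExt (-l) z := by
  rcases lt_trichotomy l 0 with h | h | h
  · rw [eExt, eExt, if_neg h.not_ge, if_pos (by omega)]
    simp [Complex.conj_ofReal]
  · subst h
    simp [eExt, Complex.conj_ofReal]
  · rw [eExt, eExt, if_pos h.le, if_neg (by omega)]
    simp [Complex.conj_ofReal]

theorem eBarTrace_eq (l : ℤ) : eBarTrace l = eTrace (-l) :=
  congrArg trace (smoothH1_congr _ _ fun z _ => conj_eExt l z)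

theorem phi_neg (κ : ℝ) (l : ℤ) (r : ℝ) : phi κ (-l) r = phi κ l r := by
  rw [phi, phi, Int.natAbs_neg]

theorem psi_neg (κ : ℝ) (l : ℤ) (r : ℝ) : psi κ (-l) r = psi κ l r := by
  rw [psi, psi, Int.natAbs_neg]

theorem sqrt_two_pi_ne_zero : (Real.sqrt (2 * Real.pi) : ℂ) ≠ 0 :=
  Complex.ofReal_ne_zero.2 (Real.sqrt_pos.2 (by positivity)).ne'

/-- The mode whose trace is `e_ℓ`. -/
def unitMode (κ : ℝ) (l : ℤ) (z : ℂ) : ℂ :=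
  ((Real.sqrt (2 * Real.pi) : ℂ) * ((besselB l.natAbs (κ / 4) : ℝ) : ℂ))⁻¹ * mode κ l z

theorem contDiff_unitMode (κ : ℝ) (l : ℤ) : ContDiff ℝ ∞ (unitMode κ l) :=
  contDiff_const.mul (contDiff_mode κ l)

theorem unitMode_eq_eExt {κ : ℝ} {l : ℤ} (h0 : besselB l.natAbs (κ / 4) ≠ 0) {z : ℂ}
    (hz : ‖z‖ = 1) : unitMode κ l z = eExt l z := by
  have h1 : Complex.normSq z = 1 := by rw [Complex.normSq_eq_norm_sq, hz, one_pow]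
  have h2 : ((besselB l.natAbs (κ / 4) : ℝ) : ℂ) ≠ 0 := Complex.ofReal_ne_zero.2 h0
  have h3 := sqrt_two_pi_ne_zero
  rw [unitMode, mode, h1, mul_one, eExt_eq_orient]
  field_simp

theorem schrSol_eTrace {κ : ℝ} (hκ : ZeroNotInDirichletSpectrum (constPot (-κ))) (l : ℤ) :
    schrSol (constPot (-κ)) (eTrace l) = smoothH1 (unitMode κ l) (contDiff_unitMode κ l) := by
  refine (fderiv_PhiS hκ).1 _ _ ⟨trace_smoothH1_congr _ _ fun z hz =>
    unitMode_eq_eExt (besselB_ne_zero hκ _) hz, fun V hV => ?_⟩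
  have h := schrForm_smoothH1 (contDiff_mode κ l) (laplacian_mode κ l) hV
  rw [schrForm_eq] at h ⊢
  have e : smoothH1 (unitMode κ l) (contDiff_unitMode κ l)
      = ((Real.sqrt (2 * Real.pi) : ℂ) * ((besselB l.natAbs (κ / 4) : ℝ) : ℂ))⁻¹
        • smoothH1 (mode κ l) (contDiff_mode κ l) := smoothH1_const_mul (contDiff_mode κ l) _
  rw [e, map_smul, smul_apply, h, smul_zero]

theorem norm_hat {z : ℂ} (hz : z ≠ 0) : ‖hat z‖ = 1 := by
  rw [hat, norm_div, Complex.norm_real, norm_norm, div_self (norm_ne_zero_iff.2 hz)]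

theorem orient_hat (l : ℤ) (z : ℂ) : orient l (hat z) = orient l z / (‖z‖ : ℂ) := by
  have h : hat z = (‖z‖⁻¹ : ℝ) • z := by
    rw [hat, Complex.real_smul, Complex.ofReal_inv, div_eq_inv_mul]
  rw [h, map_smul, Complex.real_smul, Complex.ofReal_inv, div_eq_inv_mul]

/-- The radial factor `‖z‖^|ℓ|` and the angular factor recombine into a power of `z` or of its
conjugate, which is smooth across the origin. -/
theorem phi_mul_e (κ : ℝ) (l : ℤ) {z : ℂ} (hz : z ≠ 0) :
    phi κ l ‖z‖ * e l (hat z) = unitMode κ l z := by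
  have h1 : (‖z‖ : ℂ) ≠ 0 := Complex.ofReal_ne_zero.2 (norm_ne_zero_iff.2 hz)
  rw [← eExt_eq l _ (norm_hat hz), eExt_eq_orient, orient_hat, phi_eq, unitMode, mode,
    Complex.normSq_eq_norm_sq, div_pow, mul_inv]
  field_simp

theorem phi_mul_conj_e (κ : ℝ) (l : ℤ) {z : ℂ} (hz : z ≠ 0) :
    phi κ l ‖z‖ * conj (e l (hat z)) = unitMode κ (-l) z := by
  rw [← eExt_eq l _ (norm_hat hz), conj_eExt, eExt_eq _ _ (norm_hat hz), ← phi_neg,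
    phi_mul_e κ _ hz]

theorem ae_ne_zero_disk : ∀ᵐ z ∂diskMeasure, z ≠ (0 : ℂ) :=
  ae_restrict_of_ae (Measure.ae_ne volume 0)

theorem muWeight_ae_eq (κ : ℝ) (l m : ℤ) :
    (fun z => unitMode κ (-l) z * unitMode κ m z) =ᵐ[diskMeasure] muWeight κ l m := by
  filter_upwards [ae_ne_zero_disk] with z hz
  rw [muWeight, ← phi_mul_e κ m hz, ← phi_mul_conj_e κ l hz]
  ring

theorem contDiff_muWeight (κ : ℝ) (l m : ℤ) :
    ContDiff ℝ ∞ fun z => unitMode κ (-l) z * unitMode κ m z :=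
  (contDiff_unitMode κ _).mul (contDiff_unitMode κ m)

theorem integrable_muWeight (κ : ℝ) (l m : ℤ) : Integrable (muWeight κ l m) diskMeasure :=
  (integrable_disk_of_continuous (contDiff_muWeight κ l m).continuous).congr (muWeight_ae_eq κ l m)

theorem exists_isSmoothRep_muWeight (κ : ℝ) (l m : ℤ) : ∃ W, IsSmoothRep (muWeight κ l m) W :=
  ⟨_, (contDiff_muWeight κ l m).contDiffOn, muWeight_ae_eq κ l m⟩

theorem dPhiS_eq_muMoment {κ : ℝ} (hκ : ZeroNotInDirichletSpectrum (constPot (-κ))) (l m : ℤ)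
    (q : LInfty) (T : 𝓓'(disk, ℂ)) :
    dPhiS (constPot (-κ)) q T (eBarTrace l) (eTrace m) = muMoment κ l m q T := by
  rw [dPhiS_eq_integralPair hκ, muMoment, eBarTrace_eq]
  refine integralPair_congr q T ?_
  rw [schrSol_eTrace hκ, schrSol_eTrace hκ]
  filter_upwards [h1val_smoothH1 _ (contDiff_unitMode κ (-l)),
    h1val_smoothH1 _ (contDiff_unitMode κ m), muWeight_ae_eq κ l m] with z h1 h2 h3
  rw [h1, h2, ← h3]

/-! ### The conductivity `σ_κ` -/

theorem sigmaFun_eq_besselB (κ : ℝ) (z : ℂ) :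
    sigmaFun κ z = besselB 0 (κ * Complex.normSq z / 4) ^ 2 := by
  refine Complex.ofReal_injective ?_
  rw [sigmaFun_eq, besselJ_eq, pow_zero, one_mul, Complex.normSq_eq_norm_sq, Complex.ofReal_pow]

theorem sigma_ae (κ : ℝ) : sigma κ =ᵐ[diskMeasure] sigmaFun κ := (memLp_sigmaFun κ).coeFn_toLp

/-- `σ_κ` is the square of the radial mode, which attains a positive minimum on the closed disk. -/
theorem exists_pos_le_sigma {κ : ℝ} (hκ : κ < firstZero ^ 2) :
    ∃ c : ℝ, 0 < c ∧ ∀ᵐ z ∂diskMeasure, c ≤ sigma κ z := by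
  obtain ⟨t, ht, hmin⟩ := (isCompact_Icc (a := (0 : ℝ)) (b := 1)).exists_isMinOn
    ⟨0, by simp⟩ (contDiff_besselB_comp 0 κ).continuous.continuousOn
  have hpos := besselB_pos_of_lt_firstZero hκ ht.1 ht.2
  refine ⟨_, pow_pos hpos 2, ?_⟩
  filter_upwards [sigma_ae κ, ae_restrict_mem measurableSet_ball] with z h1 h2
  rw [h1, sigmaFun_eq_besselB]
  exact pow_le_pow_left₀ hpos.le (hmin ⟨Complex.normSq_nonneg z, normSq_le_one h2⟩) 2

theorem wronskian_quotient {w F : ℂ → ℂ} (hw : ContDiff ℝ ∞ w) (hw0 : ∀ z, w z ≠ 0)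
    (hF : ContDiff ℝ ∞ F) (j : Fin 2) (z : ℂ) :
    w z ^ 2 * partialDeriv j (fun z => F z * (w z)⁻¹) z
      = w z * partialDeriv j F z - F z * partialDeriv j w z := by
  have h1 : F = fun z => w z * (F z * (w z)⁻¹) := funext fun z => by
    rw [mul_left_comm, mul_inv_cancel₀ (hw0 z), mul_one]
  have hu : ContDiff ℝ ∞ fun z => F z * (w z)⁻¹ := hF.mul (hw.inv hw0)
  have h2 := partialDeriv_mul (hw.differentiable (by simp) z) (hu.differentiable (by simp) z) j
  rw [← h1] at h2
  have h3 := hw0 z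
  rw [h2]
  field_simp
  ring

/-- The quotient of two solutions of the Helmholtz equation solves a conductivity equation. -/
theorem integral_sq_mul_grad_quotient {κ : ℂ} {w F φ : ℂ → ℂ} (hw : ContDiff ℝ ∞ w)
    (hF : ContDiff ℝ ∞ F)
    (hwΔ : ∀ z, partialDeriv 0 (partialDeriv 0 w) z + partialDeriv 1 (partialDeriv 1 w) z
      = -κ * w z)
    (hFΔ : ∀ z, partialDeriv 0 (partialDeriv 0 F) z + partialDeriv 1 (partialDeriv 1 F) z
      = -κ * F z) (hφ : IsTest φ) :
    ∫ z, ((w z * partialDeriv 0 F z - F z * partialDeriv 0 w z) * partialDeriv 0 φ z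
      + (w z * partialDeriv 1 F z - F z * partialDeriv 1 w z) * partialDeriv 1 φ z)
      ∂diskMeasure = 0 := by
  have hwφ := hφ.mul_left hw
  have hFφ := hφ.mul_left hF
  have i : ∀ {G ψ : ℂ → ℂ}, ContDiff ℝ ∞ G → IsTest ψ → Integrable (fun z =>
      partialDeriv 0 G z * partialDeriv 0 ψ z + partialDeriv 1 G z * partialDeriv 1 ψ z)
      diskMeasure := fun hG hψ =>
    (((hψ.partialDeriv 0).mul_left (contDiff_partialDeriv hG 0)).integrable.add
      ((hψ.partialDeriv 1).mul_left (contDiff_partialDeriv hG 1)).integrable).restrict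
  -- Green's identity: testing the equation of `F` with `wφ` and that of `w` with `Fφ` gives the
  -- same right-hand side, and the terms `φ ∇F · ∇w` cancel in the difference.
  have e1 := integral_grad_mul_grad hF hFΔ hwφ
  have e2 := integral_grad_mul_grad hw hwΔ hFφ
  have e3 : ∫ z, F z * (w z * φ z) ∂diskMeasure = ∫ z, w z * (F z * φ z) ∂diskMeasure :=
    integral_congr_ae (.of_forall fun z => mul_left_comm _ _ _)
  rw [e3, ← e2, ← sub_eq_zero, ← integral_sub (i hF hwφ) (i hw hFφ)] at e1
  rw [← e1]
  refine integral_congr_ae (.of_forall fun z => ?_)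
  have hdφ := hφ.contDiff.differentiable (by simp) z
  simp only [partialDeriv_mul (hw.differentiable (by simp) z) hdφ,
    partialDeriv_mul (hF.differentiable (by simp) z) hdφ]
  ring

/-- The solution of the conductivity equation with trace `e_ℓ`. -/
theorem condSol_eTrace {κ : ℝ} (hκ : κ < firstZero ^ 2) {w : ℂ → ℂ} (hw : ContDiff ℝ ∞ w)
    (hw0 : ∀ z, w z ≠ 0) (hwm : ∀ z, ‖z‖ ≤ 1 → w z = mode κ 0 z) (l : ℤ) :
    condSol (sigma κ) (eTrace l)
      = smoothH1 (fun z => ((besselB 0 (κ / 4) : ℝ) : ℂ) * (unitMode κ l z * (w z)⁻¹))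
        (contDiff_const.mul ((contDiff_unitMode κ l).mul (hw.inv hw0))) := by
  obtain ⟨c, hc, hσ⟩ := exists_pos_le_sigma hκ
  have hu : ContDiff ℝ ∞ fun z => unitMode κ l z * (w z)⁻¹ :=
    (contDiff_unitMode κ l).mul (hw.inv hw0)
  have hne : ∀ n, besselB n (κ / 4) ≠ 0 :=
    besselB_ne_zero (zeroNotInDirichletSpectrum_of_lt hκ)
  refine (fderiv_Phi hc hσ).1 _ _ ⟨trace_smoothH1_congr _ _ fun z hz => ?_, fun V hV => ?_⟩
  · have h1 : Complex.normSq z = 1 := by rw [Complex.normSq_eq_norm_sq, hz, one_pow]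
    have h2 : ((besselB 0 (κ / 4) : ℝ) : ℂ) ≠ 0 := Complex.ofReal_ne_zero.2 (hne 0)
    rw [hwm z hz.le, mode_zero, h1, mul_one, unitMode_eq_eExt (hne _) hz]
    field_simp
  · rw [smoothH1_const_mul hu, ← condForm_apply, map_smul, smul_apply]
    refine smul_eq_zero_of_right _ ?_
    refine H10_induction (p := fun V => condForm (sigma κ) (smoothH1 _ hu) V = 0)
      (isClosed_eq (ContinuousLinearMap.continuous _) continuous_const) (fun φ hφ => ?_) hV
    rw [condForm_apply, ← integral_sq_mul_grad_quotient (contDiff_mode κ 0)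
      (contDiff_unitMode κ l) (laplacian_mode κ 0) (fun z => ?_) hφ]
    · refine integral_congr_ae ?_
      filter_upwards [sigma_ae κ, gradDot_smoothH1 hu hφ.contDiff,
        ae_restrict_mem measurableSet_ball] with z h1 h2 hz
      have h3 : ((sigmaFun κ z : ℝ) : ℂ) = w z ^ 2 := by
        rw [hwm z (mem_ball_zero_iff.1 hz).le, mode_zero, sigmaFun_eq_besselB, Complex.ofReal_pow]
      have h4 := wronskian_quotient hw hw0 (contDiff_unitMode κ l)
      -- The global extension and the radial mode agree on the open disk, so their derivatives agree
      -- there too.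
      have h5 : ∀ j, partialDeriv j w z = partialDeriv j (mode κ 0) z :=
        partialDeriv_congr (fun z hz => hwm z (mem_ball_zero_iff.1 hz).le) hz
      rw [h1, h2, h3, mul_add, ← mul_assoc, ← mul_assoc, h4, h4, h5, h5,
        hwm z (mem_ball_zero_iff.1 hz).le]
    · have hd := fun j => (contDiff_partialDeriv (contDiff_mode κ l) j)
      have e1 : ∀ j, partialDeriv j (unitMode κ l) = fun z =>
          ((Real.sqrt (2 * Real.pi) : ℂ) * ((besselB l.natAbs (κ / 4) : ℝ) : ℂ))⁻¹
            * partialDeriv j (mode κ l) z := fun j => funext fun z =>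
        partialDeriv_const_mul ((contDiff_mode κ l).differentiable (by simp) z) _ j
      rw [e1, e1, partialDeriv_const_mul ((hd 0).differentiable (by simp) z),
        partialDeriv_const_mul ((hd 1).differentiable (by simp) z), unitMode]
      linear_combination ((Real.sqrt (2 * Real.pi) : ℂ)
        * ((besselB l.natAbs (κ / 4) : ℝ) : ℂ))⁻¹ * laplacian_mode κ l z

/-! ### The weight of the conductivity moments -/

theorem orient_of_nonneg {l : ℤ} (hl : 0 ≤ l) (z : ℂ) : orient l z = z := by
  rw [orient, if_pos hl]
  rfl

theorem orient_of_neg {l : ℤ} (hl : l < 0) (z : ℂ) : orient l z = conj z := by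
  rw [orient, if_neg hl.not_ge]
  rfl

theorem orient_ne_zero (l : ℤ) {z : ℂ} (hz : z ≠ 0) : orient l z ≠ 0 := by
  rw [orient]
  split_ifs
  · exact hz
  · exact (map_ne_zero (starRingEnd ℂ)).2 hz

/-- Equal orientations have gradients with product `0`, opposite ones with product `2`. Since the
first factor is oriented by `-l`, these cases match `l m + |l||m|` being `0` or `2|l||m|`. -/
theorem orient_grad_mul (l m : ℤ) (z : ℂ) :
    (l.natAbs : ℂ) * m.natAbs * Complex.normSq z
      * (orient (-l) (coordDir 0) * orient m (coordDir 0)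
        + orient (-l) (coordDir 1) * orient m (coordDir 1))
      = (l * m + (l.natAbs : ℂ) * m.natAbs) * (orient (-l) z * orient m z) := by
  have hnat : ∀ k : ℤ, (k.natAbs : ℂ) = ((|k| : ℤ) : ℂ) := fun k => by
    rw [Int.abs_eq_natAbs, Int.cast_natCast]
  rw [hnat, hnat, Complex.normSq_eq_conj_mul_self]
  rcases le_or_gt 0 (-l) with hl | hl <;> rcases le_or_gt 0 m with hm | hm
  · rw [abs_of_nonpos (by omega : l ≤ 0), abs_of_nonneg hm]
    simp [orient_of_nonneg hl, orient_of_nonneg hm, coordDir]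
  · rw [abs_of_nonpos (by omega : l ≤ 0), abs_of_neg hm]
    simp [orient_of_nonneg hl, orient_of_neg hm, coordDir]
    ring
  · rw [abs_of_pos (by omega : 0 < l), abs_of_nonneg hm]
    simp [orient_of_neg hl, orient_of_nonneg hm, coordDir]
    ring
  · rw [abs_of_pos (by omega : 0 < l), abs_of_neg hm]
    simp [orient_of_neg hl, orient_of_neg hm, coordDir]

/-- The gradient of the quotient of a mode by the radial mode. -/
theorem wronskian_mode {κ : ℝ} (hκ : κ < firstZero ^ 2) (l : ℤ) (j : Fin 2) {z : ℂ} (hz : z ≠ 0)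
    (hz1 : z ∈ Metric.ball (0 : ℂ) 1) :
    mode κ 0 z * partialDeriv j (unitMode κ l) z - unitMode κ l z * partialDeriv j (mode κ 0) z
      = mode κ 0 z * unitMode κ l z * (l.natAbs * orient l (coordDir j) / orient l z
        + coord j z * psi κ l ‖z‖ / Complex.normSq z) := by
  have hB : ∀ n, ((besselB n (κ * Complex.normSq z / 4) : ℝ) : ℂ) ≠ 0 := fun n =>
    Complex.ofReal_ne_zero.2
      (besselB_ne_zero_of_lt hκ n (Complex.normSq_nonneg z) (normSq_le_one hz1))
  have hO := orient_ne_zero l hz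
  have hR : ((Complex.normSq z : ℝ) : ℂ) ≠ 0 := Complex.ofReal_ne_zero.2 (Complex.normSq_pos.2 hz).ne'
  have h1 : partialDeriv j (unitMode κ l) z
      = ((Real.sqrt (2 * Real.pi) : ℂ) * ((besselB l.natAbs (κ / 4) : ℝ) : ℂ))⁻¹
        * partialDeriv j (mode κ l) z :=
    partialDeriv_const_mul ((contDiff_mode κ l).differentiable (by simp) z) _ j
  have h2 : partialDeriv j (mode κ 0) z
      = -(κ / 2) * coord j z * ((besselB 1 (κ * Complex.normSq z / 4) : ℝ) : ℂ) := by
    rw [funext (mode_zero κ), partialDeriv_besselB]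
  have h3 := natCast_mul_pow_pred l.natAbs (orient l z)
  have h4 := hB 0
  have h5 := hB l.natAbs
  -- Divided by the product of the two modes, the left side is a difference of logarithmic
  -- derivatives. The power contributes the `|ℓ|` term, and the quotients `B_{n+1}/B_n` and
  -- `B_1/B_0` combine into `ψ_ℓ`.
  rw [h1, h2, psi_eq, partialDeriv_mode, mode_zero, unitMode, mode, ← Complex.normSq_eq_norm_sq]
  set a := ((Real.sqrt (2 * Real.pi) : ℂ) * ((besselB l.natAbs (κ / 4) : ℝ) : ℂ))⁻¹
  push_cast
  generalize ((besselB 0 (κ * Complex.normSq z / 4) : ℝ) : ℂ) = B0 at *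
  generalize ((besselB 1 (κ * Complex.normSq z / 4) : ℝ) : ℂ) = B1 at *
  generalize ((besselB l.natAbs (κ * Complex.normSq z / 4) : ℝ) : ℂ) = Bn at *
  generalize ((besselB (l.natAbs + 1) (κ * Complex.normSq z / 4) : ℝ) : ℂ) = Bn1 at *
  generalize ((Complex.normSq z : ℝ) : ℂ) = R at *
  have h6 : (l.natAbs : ℂ) * orient l z ^ (l.natAbs - 1)
      = l.natAbs * orient l z ^ l.natAbs / orient l z := by
    rw [eq_div_iff hO, h3]
  rw [h6]
  field_simp
  ring

theorem besselJ_zero_sqrtC_eq (κ : ℝ) :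
    besselJ 0 (sqrtC κ) = ((besselB 0 (κ / 4) : ℝ) : ℂ) := by
  rw [besselJ_sqrtC, pow_zero, one_mul]

/-- One smooth function represents both the product of gradients and the explicit weight, so the
singularity of the weight at the origin is removable. -/
theorem gradDot_condSol_ae_eq {κ : ℝ} (hκ : κ < firstZero ^ 2) (l m : ℤ) :
    ∃ W : ℂ → ℂ, ContDiff ℝ ∞ W ∧
      W =ᵐ[diskMeasure] gradDot (condSol (sigma κ) (eTrace (-l))) (condSol (sigma κ) (eTrace m)) ∧
      W =ᵐ[diskMeasure] fun z => ((besselB 0 (κ / 4) ^ 2 : ℝ) : ℂ) * mWeight κ l m z := by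
  obtain ⟨w, hw, hw0, hwm⟩ := exists_pos_extension_mode hκ
  have hu : ∀ l, ContDiff ℝ ∞ fun z =>
      ((besselB 0 (κ / 4) : ℝ) : ℂ) * (unitMode κ l z * (w z)⁻¹) := fun l =>
    contDiff_const.mul ((contDiff_unitMode κ l).mul (hw.inv hw0))
  have hdu := fun l j => contDiff_partialDeriv (hu l) j
  refine ⟨_, ((hdu (-l) 0).mul (hdu m 0)).add ((hdu (-l) 1).mul (hdu m 1)), ?_, ?_⟩
  · rw [condSol_eTrace hκ hw hw0 hwm, condSol_eTrace hκ hw hw0 hwm]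
    exact (gradDot_smoothH1 (hu (-l)) (hu m)).symm
  · filter_upwards [ae_ne_zero_disk, ae_restrict_mem measurableSet_ball] with z hz hz1
    have hz1' := (mem_ball_zero_iff.1 hz1).le
    have hwz : ((besselB 0 (κ * Complex.normSq z / 4) : ℝ) : ℂ) = w z := by
      rw [hwm z hz1', mode_zero]
    have hgrad : ∀ l j, partialDeriv j
        (fun z => ((besselB 0 (κ / 4) : ℝ) : ℂ) * (unitMode κ l z * (w z)⁻¹)) z
        = ((besselB 0 (κ / 4) : ℝ) : ℂ) * (unitMode κ l z / w z)
          * (l.natAbs * orient l (coordDir j) / orient l z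
            + coord j z * psi κ l ‖z‖ / Complex.normSq z) := fun l j => by
      have hv : ContDiff ℝ ∞ fun z => unitMode κ l z * (w z)⁻¹ :=
        (contDiff_unitMode κ l).mul (hw.inv hw0)
      have h1 := wronskian_quotient hw hw0 (contDiff_unitMode κ l) j z
      have h2 : partialDeriv j w z = partialDeriv j (mode κ 0) z :=
        partialDeriv_congr (fun z hz => hwm z (mem_ball_zero_iff.1 hz).le) hz1 j
      rw [h2, hwm z hz1', wronskian_mode hκ l j hz hz1, ← hwm z hz1'] at h1
      have h3 := hw0 z
      rw [partialDeriv_const_mul (hv.differentiable (by simp) z), mul_assoc]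
      congr 1
      refine mul_left_cancel₀ (pow_ne_zero 2 h3) (h1.trans ?_)
      field_simp
    have hO := orient_ne_zero (-l) hz
    have hO' := orient_ne_zero m hz
    have hR : ((Complex.normSq z : ℝ) : ℂ) ≠ 0 :=
      Complex.ofReal_ne_zero.2 (Complex.normSq_pos.2 hz).ne'
    have hw3 := hw0 z
    have e1 := orient_grad_mul l m z
    have e2 := coord_sum_orient (-l) z
    have e3 := coord_sum_orient m z
    have e4 : (coord 0 z : ℂ) * coord 0 z + coord 1 z * coord 1 z = Complex.normSq z := by
      exact_mod_cast coord_sq_sum z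
    -- Product of the two logarithmic gradients. Angular times angular gives `ℓm + |ℓ||m|` by
    -- `orient_grad_mul`, the mixed terms give `|m|ψ_ℓ + |ℓ|ψ_m` by Euler's identity, and radial
    -- times radial gives `ψ_ℓψ_m`.
    have key : (l.natAbs * orient (-l) (coordDir 0) / orient (-l) z
            + coord 0 z * psi κ l ‖z‖ / Complex.normSq z)
          * (m.natAbs * orient m (coordDir 0) / orient m z
            + coord 0 z * psi κ m ‖z‖ / Complex.normSq z)
        + (l.natAbs * orient (-l) (coordDir 1) / orient (-l) z
            + coord 1 z * psi κ l ‖z‖ / Complex.normSq z)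
          * (m.natAbs * orient m (coordDir 1) / orient m z
            + coord 1 z * psi κ m ‖z‖ / Complex.normSq z)
        = ((l : ℂ) * m + ((l.natAbs : ℂ) + psi κ l ‖z‖) * ((m.natAbs : ℂ) + psi κ m ‖z‖))
          / Complex.normSq z := by
      generalize ((Complex.normSq z : ℝ) : ℂ) = R at *
      generalize psi κ l ‖z‖ = p at *
      generalize psi κ m ‖z‖ = q at *
      field_simp
      linear_combination (R) * e1 + (m.natAbs : ℂ) * p * R * orient (-l) z * e3
        + (l.natAbs : ℂ) * q * R * orient m z * e2 + p * q * orient (-l) z * orient m z * e4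
    have hmw : mWeight κ l m z = 1 / w z ^ 2
        * (((l : ℂ) * m + ((l.natAbs : ℂ) + psi κ l ‖z‖) * ((m.natAbs : ℂ) + psi κ m ‖z‖))
          / Complex.normSq z) * (unitMode κ (-l) z * unitMode κ m z) := by
      rw [mWeight, ← phi_mul_e κ m hz, ← phi_mul_conj_e κ l hz, sigmaFun_eq_besselB,
        Complex.ofReal_pow, hwz, Complex.normSq_eq_norm_sq, Complex.ofReal_pow]
      ring
    simp only [hgrad, psi_neg, Int.natAbs_neg]
    rw [hmw, ← key, Complex.ofReal_pow]
    field_simp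

/-- `ψ_ℓ` is `r²` times a function continuous at `0`, because no `B_n` vanishes there. -/
theorem tendsto_psi {κ : ℝ} (l : ℤ) : Tendsto (psi κ l) (𝓝[>] 0) (𝓝 0) := by
  have hB : ∀ n, ContinuousAt (fun r : ℝ => besselB n (κ * r ^ 2 / 4)) 0 := fun n =>
    ((contDiff_besselB n).continuous.comp (by fun_prop)).continuousAt
  have h0 : ∀ n, besselB n (κ * 0 ^ 2 / 4) ≠ 0 := fun n => by
    simpa [besselB_zero] using n.factorial_ne_zero
  have hc : ContinuousAt (fun r : ℝ => ((κ * r ^ 2 / 2 * (besselB 1 (κ * r ^ 2 / 4)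
      / besselB 0 (κ * r ^ 2 / 4) - besselB (l.natAbs + 1) (κ * r ^ 2 / 4)
        / besselB l.natAbs (κ * r ^ 2 / 4)) : ℝ) : ℂ)) 0 :=
    Complex.continuous_ofReal.continuousAt.comp (ContinuousAt.mul (by fun_prop)
      (((hB 1).div (hB 0) (h0 0)).sub ((hB _).div (hB _) (h0 _))))
  have h := hc.tendsto
  rw [funext (psi_eq κ l)]
  refine (tendsto_nhdsWithin_of_tendsto_nhds ?_)
  simpa using h

/-- The weight is a product of gradients of smooth functions divided by the nonzero constant
`J_0(√κ)²`. -/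
theorem mWeight_smooth {κ : ℝ} (hκ : κ < firstZero ^ 2) (l m : ℤ) :
    Integrable (mWeight κ l m) diskMeasure ∧ ∃ W, IsSmoothRep (mWeight κ l m) W := by
  obtain ⟨W, hW, -, hWm⟩ := gradDot_condSol_ae_eq hκ l m
  have h0 : ((besselB 0 (κ / 4) ^ 2 : ℝ) : ℂ) ≠ 0 := Complex.ofReal_ne_zero.2
    (pow_ne_zero 2 (besselB_ne_zero (zeroNotInDirichletSpectrum_of_lt hκ) 0))
  have hW' : ContDiff ℝ ∞ fun z => ((besselB 0 (κ / 4) ^ 2 : ℝ) : ℂ)⁻¹ * W z :=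
    contDiff_const.mul hW
  have hae : (fun z => ((besselB 0 (κ / 4) ^ 2 : ℝ) : ℂ)⁻¹ * W z)
      =ᵐ[diskMeasure] mWeight κ l m := by
    filter_upwards [hWm] with z hz
    rw [hz, inv_mul_cancel_left₀ h0]
  exact ⟨(integrable_disk_of_continuous hW'.continuous).congr hae, _, hW'.contDiffOn, hae⟩

theorem mMoment_eq {κ : ℝ} (hκ : κ < firstZero ^ 2) (l m : ℤ) (γ : LInfty) (T : 𝓓'(disk, ℂ)) :
    mMoment κ l m γ T = besselJ 0 (sqrtC κ) ^ 2 * integralPair γ T (mWeight κ l m) := by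
  obtain ⟨c, hc, hσ⟩ := exists_pos_le_sigma hκ
  obtain ⟨W, -, hW, hWm⟩ := gradDot_condSol_ae_eq hκ l m
  rw [mMoment, eBarTrace_eq, dPhi_eq_integralPair hc hσ, integralPair_congr γ T (hW.symm.trans hWm),
    integralPair_const_mul γ T (mWeight_smooth hκ l m).2, besselJ_zero_sqrtC_eq, Complex.ofReal_pow]

end

end Calderon

/-! ### The moment formulas -/

open MeasureTheory Filter Topology Calderon in
open scoped Distributions in
theorem lemmal :
    (∀ κ : ℝ, κ < firstZero ^ 2 → ZeroNotInDirichletSpectrum (constPot (-κ))) ∧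
    (∀ κ : ℝ, ZeroNotInDirichletSpectrum (constPot (-κ)) →
      DifferentiableAt ℝ PhiS (constPot (-κ)) ∧
      ∀ l m : ℤ,
        Integrable (muWeight κ l m) diskMeasure ∧ (∃ W, IsSmoothRep (muWeight κ l m) W) ∧
        ∀ (q : LInfty) (T : 𝓓'(disk, ℂ)), IsCompactlySupported T →
          dPhiS (constPot (-κ)) q T (eBarTrace l) (eTrace m) = muMoment κ l m q T) ∧
    (∀ κ : ℝ, κ < firstZero ^ 2 →
      DifferentiableAt ℝ Phi (sigma κ) ∧
      ∀ l m : ℤ,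
        Tendsto (psi κ l) (𝓝[>] 0) (𝓝 0) ∧
        Integrable (mWeight κ l m) diskMeasure ∧ (∃ W, IsSmoothRep (mWeight κ l m) W) ∧
        ∀ (γ : LInfty) (T : 𝓓'(disk, ℂ)), IsCompactlySupported T →
          mMoment κ l m γ T
            = besselJ 0 (sqrtC κ) ^ 2 * integralPair γ T (mWeight κ l m)) := by
  refine ⟨fun κ hκ => zeroNotInDirichletSpectrum_of_lt hκ, fun κ hκ =>
    ⟨differentiableAt_PhiS hκ, fun l m => ⟨integrable_muWeight κ l m,
      exists_isSmoothRep_muWeight κ l m, fun q T _ => dPhiS_eq_muMoment hκ l m q T⟩⟩,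
    fun κ hκ => ?_⟩
  obtain ⟨c, hc, hσ⟩ := exists_pos_le_sigma hκ
  exact ⟨differentiableAt_Phi hc hσ, fun l m => ⟨tendsto_psi l, (mWeight_smooth hκ l m).1,
    (mWeight_smooth hκ l m).2, fun γ T _ => mMoment_eq hκ l m γ T⟩⟩
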